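/- Let $\mathcal V$ be a combinatorial, closed symmetric monoidal model category satisfying the monoid axiom (every transfinite composition of pushouts of maps $j\otimes Z$, with $j$ a trivial cofibration and $Z\in\mathcal V$, is a weak equivalence), whose unit $S$ is cofibrant. Let $\mathcal M$ be a model category. Definitions. An *enrichment* of a category $\mathcal C$ by $\mathcal V$ is a functor $\tau:\mathcal C^{op}\times\mathcal C\to\mathcal V$ together with composition maps $\tau(b,c)\otimes\tau(a,b)\to\tau(a,c)$, natural in $a$ and $c$, and units $S\to\tau(c,c)$, which are associative and unital and such that for every $f:a\to b$ in $\mathcal C$ the composites $S\to\tau(a,a)\xrightarrow{f_*}\tau(a,b)$ and $S\to\tau(b,b)\xrightarrow{f^*}\tau(a,b)$ agree. A map of enrichments is a natural transformation compatible with units and composition. A *$\sigma$-$\tau$ bimodule* is a collection of objects $M(a,b)\in\mathcal V$ with commuting, associative and unital actions $\sigma(b,c)\otimes M(a,b)\to M(a,c)$ and $M(b,c)\otimes\tau(a,b)\to M(a,c)$; it is *pointed* if it comes with maps $S\to M(c,c)$ such that for every $f:a\to b$ the two induced maps $S\to M(a,a)\to M(a,b)$ and $S\to M(b,b)\to M(a,b)$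 agree. For $\mathcal C=\mathcal M$ or $\mathcal C$ a full subcategory of $\mathcal M$: - an enrichment $\tau$ of $\mathcal C$ by $\mathcal V$ is a *model enrichment* (of $\mathcal M$, respectively over $\mathcal C$) if $\tau(a',x)\to\tau(a,x)$ and $\tau(a,x)\to\tau(a,x')$ are weak equivalences whenever $a\to a'$ is a weak equivalence between cofibrant objects and $x\to x'$ is a weak equivalence between fibrant objects; - a *quasi-equivalence* between model enrichments $\sigma,\tau$ is a pointed $\sigma$-$\tau$ bimodule $M$ such that $\sigma(a,b)\otimes S\to\sigma(a,b)\otimes M(a,a)\to M(a,b)$ and $S\otimes\tau(a,b)\to M(b,b)\otimes\tau(a,b)\to M(a,b)$ are weak equivalences whenever $a$ is cofibrant and $b$ is fibrant; $\sigma$ and $\tau$ are *quasi-equivalent* if they are related by the equivalence relation generated by quasi-equivalences; - a map $\sigma\to\tau$ of model enrichments is a *direct equivalence* if $\sigma(a,b)\to\tau(a,b)$ is a weak equivalence whenever $a$ is cofibrant and $b$ is fibrant. Two monoids in $\mathcal V$ are *weakly equivalent* if they are connected by a finite zig-zag of monoid maps that are weak equivalences in $\mathcal V$. Proposition. Let $\sigma$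 and $\tau$ be model enrichments of $\mathcal M$ by $\mathcal V$. (1) Let $\mathcal I$ be a small full subcategory of $\mathcal M$ consisting of objects that are both cofibrant and fibrant. If the restrictions of $\sigma$ and $\tau$ to $\mathcal I$ are quasi-equivalent over $\mathcal I$, then these restrictions are connected by a finite zig-zag of direct equivalences between model enrichments over $\mathcal I$; in particular, for every $X\in\mathcal I$ the monoids $\sigma(X,X)$ and $\tau(X,X)$ are weakly equivalent. (2) If $\sigma$ and $\tau$ are quasi-equivalent as model enrichments of $\mathcal M$, then for every object $X$ of $\mathcal M$ that is both cofibrant and fibrant the monoids $\sigma(X,X)$ and $\tau(X,X)$ are weakly equivalent. -/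

import Mathlib

open CategoryTheory Category MonoidalCategory Limits Opposite HomotopicalAlgebra

universe v v₁ v₂ u u₁ u₂

namespace ModelEnrich

/-! ### Monoidal and combinatorial model categories -/

section ModelCategories

variable (V : Type u) [Category.{v} V] [MonoidalCategory V] [ModelCategory V]

/-- The compatibility axioms of a (closed symmetric) monoidal model category: the pushout-product
axiom and the unit axiom. The closed symmetric monoidal structure and the model structure are
separate instance arguments. -/
class IsMonoidalModelCategory : Prop where
  cofibration_pushoutProduct (i k : Arrow V) :
    Cofibration i.hom → Cofibration k.hom →
      Cofibration ((Arrow.pushoutProduct.obj i).obj k).hom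
  weakEquivalence_pushoutProduct (i k : Arrow V) :
    Cofibration i.hom → Cofibration k.hom →
      (WeakEquivalence i.hom ∨ WeakEquivalence k.hom) →
        WeakEquivalence ((Arrow.pushoutProduct.obj i).obj k).hom
  weakEquivalence_unit_whiskerRight {Q : V} (q : Q ⟶ 𝟙_ V) (X : V) :
    IsCofibrant Q → WeakEquivalence q → IsCofibrant X → WeakEquivalence (q ▷ X)
  weakEquivalence_whiskerLeft_unit {Q : V} (q : Q ⟶ 𝟙_ V) (X : V) :
    IsCofibrant Q → WeakEquivalence q → IsCofibrant X → WeakEquivalence (X ◁ q)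

/-- The maps `j ⊗ Z` with `j` a trivial cofibration and `Z` an arbitrary object. -/
inductive tensorTrivialCofibrations : MorphismProperty V
  | mk {A B : V} (j : A ⟶ B) (hj : Cofibration j) (hj' : WeakEquivalence j) (Z : V) :
      tensorTrivialCofibrations (j ▷ Z)

/-- The monoid axiom: every transfinite composition of pushouts of maps `j ⊗ Z`, with `j` a
trivial cofibration, is a weak equivalence. -/
def MonoidAxiom : Prop :=
  MorphismProperty.transfiniteCompositions.{v} (tensorTrivialCofibrations V).pushouts ≤
    weakEquivalences V

end ModelCategories

section Combinatorial

variable (V : Type u) [Category.{v} V] [ModelCategory V]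

/-- A combinatorial model category: the underlying category is locally presentable, and the model
structure is cofibrantly generated by a (small) set `I` of generating cofibrations and a (small)
set `J` of generating trivial cofibrations. The usual smallness conditions on the domains of `I`
and `J` hold automatically in a locally presentable category. -/
structure IsCombinatorial : Prop where
  isLocallyPresentable : IsLocallyPresentable.{v} V
  exists_generatingCofibrations : ∃ I : MorphismProperty V,
    MorphismProperty.IsSmall.{v} I ∧ trivialFibrations V = I.rlp
  exists_generatingTrivialCofibrations : ∃ J : MorphismProperty V,
    MorphismProperty.IsSmall.{v} J ∧ fibrations V = J.rlp

end Combinatorial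

/-! ### Enrichments -/

section Enrichments

variable (C : Type u₁) [Category.{v₁} C] (V : Type u) [Category.{v} V] [MonoidalCategory V]

/-- An enrichment of the category `C` by the monoidal category `V`: a functor
`Cᵒᵖ × C ⥤ V` (written in curried form), `τ(a, b) = (τ.hom.obj (op a)).obj b`, with natural
composition maps and with units. -/
structure Enrichment where
  hom : Cᵒᵖ ⥤ C ⥤ V
  comp (a b c : C) :
    (hom.obj (op b)).obj c ⊗ (hom.obj (op a)).obj b ⟶ (hom.obj (op a)).obj c
  unit (c : C) : 𝟙_ V ⟶ (hom.obj (op c)).obj c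
  comp_natural_left {a a' : C} (f : a ⟶ a') (b c : C) :
    (hom.obj (op b)).obj c ◁ (hom.map f.op).app b ≫ comp a b c =
      comp a' b c ≫ (hom.map f.op).app c
  comp_natural_right (a b : C) {c c' : C} (g : c ⟶ c') :
    (hom.obj (op b)).map g ▷ (hom.obj (op a)).obj b ≫ comp a b c' =
      comp a b c ≫ (hom.obj (op a)).map g
  comp_assoc (a b c d : C) :
    comp b c d ▷ (hom.obj (op a)).obj b ≫ comp a b d =
      (α_ _ _ _).hom ≫ (hom.obj (op c)).obj d ◁ comp a b c ≫ comp a c d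
  unit_comp (a b : C) :
    unit b ▷ (hom.obj (op a)).obj b ≫ comp a b b = (λ_ _).hom
  comp_unit (a b : C) :
    (hom.obj (op a)).obj b ◁ unit a ≫ comp a a b = (ρ_ _).hom
  unit_natural {a b : C} (f : a ⟶ b) :
    unit a ≫ (hom.obj (op a)).map f = unit b ≫ (hom.map f.op).app b

variable {C V}

namespace Enrichment

/-- The object `τ(a, b)` of `V`. -/
abbrev obj (τ : Enrichment C V) (a b : C) : V := (τ.hom.obj (op a)).obj b

/-- The map `τ(a', x) ⟶ τ(a, x)` induced by `f : a ⟶ a'`. -/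
abbrev mapLeft (τ : Enrichment C V) {a a' : C} (f : a ⟶ a') (x : C) :
    τ.obj a' x ⟶ τ.obj a x :=
  (τ.hom.map f.op).app x

/-- The map `τ(a, x) ⟶ τ(a, x')` induced by `g : x ⟶ x'`. -/
abbrev mapRight (τ : Enrichment C V) (a : C) {x x' : C} (g : x ⟶ x') :
    τ.obj a x ⟶ τ.obj a x' :=
  (τ.hom.obj (op a)).map g

/-- The map `S ⟶ τ(a, b)` picked out by a map `f : a ⟶ b` of `C`. -/
def elt (τ : Enrichment C V) {a b : C} (f : a ⟶ b) : 𝟙_ V ⟶ τ.obj a b :=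
  τ.unit a ≫ τ.mapRight a f

/-- A map of enrichments: a natural transformation compatible with units and composition. -/
structure Hom (σ τ : Enrichment C V) where
  app : σ.hom ⟶ τ.hom
  unit_app (c : C) : σ.unit c ≫ (app.app (op c)).app c = τ.unit c
  comp_app (a b c : C) :
    σ.comp a b c ≫ (app.app (op a)).app c =
      ((app.app (op b)).app c ⊗ₘ (app.app (op a)).app b) ≫ τ.comp a b c

/-- The enrichment `(a, b) ↦ τ(G a, G b)`. For `G` the inclusion of a full subcategory, this is
the restriction of `τ` to the subcategory. -/
def pullback {D : Type u₂} [Category.{v₂} D] (τ : Enrichment C V) (G : D ⥤ C) :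
    Enrichment D V where
  hom := G.op ⋙ τ.hom ⋙ (Functor.whiskeringLeft D C V).obj G
  comp a b c := τ.comp (G.obj a) (G.obj b) (G.obj c)
  unit c := τ.unit (G.obj c)
  comp_natural_left f b c := τ.comp_natural_left (G.map f) (G.obj b) (G.obj c)
  comp_natural_right a b _ _ g := τ.comp_natural_right (G.obj a) (G.obj b) (G.map g)
  comp_assoc a b c d := τ.comp_assoc (G.obj a) (G.obj b) (G.obj c) (G.obj d)
  unit_comp a b := τ.unit_comp (G.obj a) (G.obj b)
  comp_unit a b := τ.comp_unit (G.obj a) (G.obj b)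
  unit_natural f := τ.unit_natural (G.map f)

/-- The endomorphism monoid `τ(X, X)` in `V`. -/
def endMon (τ : Enrichment C V) (X : C) : Mon V where
  X := τ.obj X X
  mon :=
    { one := τ.unit X
      mul := τ.comp X X X
      one_mul := τ.unit_comp X X
      mul_one := τ.comp_unit X X
      mul_assoc := τ.comp_assoc X X X X }

end Enrichment

/-- A `σ`-`τ` bimodule: objects `M(a, b)` of `V` with a left action of `σ` and a right action of
`τ` that are associative, unital, and commute with each other. The bifunctor structure on `M`
(`mapRight`, `mapLeft` below) is induced by the actions; functoriality and the naturality of the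
actions then follow from associativity and unitality. -/
structure Bimodule (σ τ : Enrichment C V) where
  obj : C → C → V
  lact (a b c : C) : σ.obj b c ⊗ obj a b ⟶ obj a c
  ract (a b c : C) : obj b c ⊗ τ.obj a b ⟶ obj a c
  lact_assoc (a b c d : C) :
    σ.comp b c d ▷ obj a b ≫ lact a b d =
      (α_ _ _ _).hom ≫ σ.obj c d ◁ lact a b c ≫ lact a c d
  unit_lact (a b : C) : σ.unit b ▷ obj a b ≫ lact a b b = (λ_ _).hom
  ract_assoc (a b c d : C) :
    ract b c d ▷ τ.obj a b ≫ ract a b d =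
      (α_ _ _ _).hom ≫ obj c d ◁ τ.comp a b c ≫ ract a c d
  ract_unit (a b : C) : obj a b ◁ τ.unit a ≫ ract a a b = (ρ_ _).hom
  lact_ract (a b c d : C) :
    lact b c d ▷ τ.obj a b ≫ ract a b d =
      (α_ _ _ _).hom ≫ σ.obj c d ◁ ract a b c ≫ lact a c d

namespace Bimodule

variable {σ τ : Enrichment C V}

/-- The map `M(a, b) ⟶ M(a, c)` induced by `f : b ⟶ c`. -/
def mapRight (M : Bimodule σ τ) (a : C) {b c : C} (f : b ⟶ c) : M.obj a b ⟶ M.obj a c :=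
  (λ_ _).inv ≫ σ.elt f ▷ M.obj a b ≫ M.lact a b c

/-- The map `M(b, c) ⟶ M(a, c)` induced by `f : a ⟶ b`. -/
def mapLeft (M : Bimodule σ τ) {a b : C} (f : a ⟶ b) (c : C) : M.obj b c ⟶ M.obj a c :=
  (ρ_ _).inv ≫ M.obj b c ◁ τ.elt f ≫ M.ract a b c

end Bimodule

/-- A pointed bimodule: a bimodule with maps `S ⟶ M(c, c)` that are compatible with all maps
of `C`. -/
structure PointedBimodule (σ τ : Enrichment C V) extends Bimodule σ τ where
  pt (c : C) : 𝟙_ V ⟶ obj c c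
  pt_natural {a b : C} (f : a ⟶ b) :
    pt a ≫ toBimodule.mapRight a f = pt b ≫ toBimodule.mapLeft f b

namespace PointedBimodule

variable {σ τ : Enrichment C V}

/-- The composite `σ(a, b) ⊗ S ⟶ σ(a, b) ⊗ M(a, a) ⟶ M(a, b)`. -/
def leftComparison (M : PointedBimodule σ τ) (a b : C) : σ.obj a b ⊗ 𝟙_ V ⟶ M.obj a b :=
  σ.obj a b ◁ M.pt a ≫ M.lact a a b

/-- The composite `S ⊗ τ(a, b) ⟶ M(b, b) ⊗ τ(a, b) ⟶ M(a, b)`. -/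
def rightComparison (M : PointedBimodule σ τ) (a b : C) : 𝟙_ V ⊗ τ.obj a b ⟶ M.obj a b :=
  M.pt b ▷ τ.obj a b ≫ M.ract a b b

end PointedBimodule

end Enrichments

/-! ### Model enrichments

Everything is defined for enrichments of a category `C` relative to a functor `F : C ⥤ M` to a
model category. It is used in two cases only: for `F = 𝟭 M` one gets the notions for `M` itself,
and for `F = I.ι` the inclusion of a full subcategory `I` one gets the notions "over `I`". -/

section ModelEnrichments

variable {C : Type u₁} [Category.{v₁} C] {M : Type u₂} [Category.{v₂} M] [ModelCategory M]
  (F : C ⥤ M) (V : Type u) [Category.{v} V] [MonoidalCategory V] [ModelCategory V]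

/-- A model enrichment: an enrichment `τ` such that `τ(a', x) ⟶ τ(a, x)` and
`τ(a, x) ⟶ τ(a, x')` are weak equivalences whenever `a ⟶ a'` is a weak equivalence between
cofibrant objects and `x ⟶ x'` is a weak equivalence between fibrant objects. -/
structure ModelEnrichment extends Enrichment C V where
  weakEquivalence_mapLeft {a a' : C} (f : a ⟶ a') (x : C) :
    IsCofibrant (F.obj a) → IsCofibrant (F.obj a') → WeakEquivalence (F.map f) →
      IsFibrant (F.obj x) → WeakEquivalence (toEnrichment.mapLeft f x)
  weakEquivalence_mapRight (a : C) {x x' : C} (g : x ⟶ x') :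
    IsCofibrant (F.obj a) → IsFibrant (F.obj x) → IsFibrant (F.obj x') →
      WeakEquivalence (F.map g) → WeakEquivalence (toEnrichment.mapRight a g)

variable {F V}

/-- The restriction to a full subcategory `I` of a model enrichment of `M`. -/
def ModelEnrichment.restrict (τ : ModelEnrichment (𝟭 M) V) (I : ObjectProperty M) :
    ModelEnrichment I.ι V where
  toEnrichment := τ.toEnrichment.pullback I.ι
  weakEquivalence_mapLeft f x h₁ h₂ h₃ h₄ :=
    τ.weakEquivalence_mapLeft (I.ι.map f) (I.ι.obj x) h₁ h₂ h₃ h₄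
  weakEquivalence_mapRight a _ _ g h₁ h₂ h₃ h₄ :=
    τ.weakEquivalence_mapRight (I.ι.obj a) (I.ι.map g) h₁ h₂ h₃ h₄

/-- The pointed bimodule `P` is a quasi-equivalence between `σ` and `τ`. -/
def IsQuasiEquivalence {σ τ : ModelEnrichment F V}
    (P : PointedBimodule σ.toEnrichment τ.toEnrichment) : Prop :=
  ∀ a b : C, IsCofibrant (F.obj a) → IsFibrant (F.obj b) →
    WeakEquivalence (P.leftComparison a b) ∧ WeakEquivalence (P.rightComparison a b)

/-- Two model enrichments are quasi-equivalent if they are related by the equivalence relation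
generated by the existence of a quasi-equivalence. -/
def QuasiEquivalent (σ τ : ModelEnrichment F V) : Prop :=
  Relation.EqvGen (fun σ' τ' : ModelEnrichment F V ↦
    ∃ P : PointedBimodule σ'.toEnrichment τ'.toEnrichment, IsQuasiEquivalence P) σ τ

/-- A map of model enrichments is a direct equivalence if `σ(a, b) ⟶ τ(a, b)` is a weak
equivalence whenever `a` is cofibrant and `b` is fibrant. -/
def IsDirectEquivalence {σ τ : ModelEnrichment F V}
    (φ : Enrichment.Hom σ.toEnrichment τ.toEnrichment) : Prop :=
  ∀ a b : C, IsCofibrant (F.obj a) → IsFibrant (F.obj b) →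
    WeakEquivalence ((φ.app.app (op a)).app b)

/-- Two model enrichments are connected by a (finite) zig-zag of direct equivalences. -/
def DirectZigzag (σ τ : ModelEnrichment F V) : Prop :=
  Relation.EqvGen (fun σ' τ' : ModelEnrichment F V ↦
    ∃ φ : Enrichment.Hom σ'.toEnrichment τ'.toEnrichment, IsDirectEquivalence φ) σ τ

/-- Two monoids in `V` are weakly equivalent: they are connected by a (finite) zig-zag of
monoid maps that are weak equivalences in `V`. -/
def WeaklyEquivalentMonoids (A B : Mon V) : Prop :=
  Relation.EqvGen (fun A' B' : Mon V ↦ ∃ f : A' ⟶ B', WeakEquivalence f.hom) A B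

end ModelEnrichments

end ModelEnrich

-- Quasi-equivalence is generated by single bimodules, so consider one quasi-equivalence `P` over a
-- small category all of whose objects are cofibrant and fibrant; both comparison maps are then weak
-- equivalences at all pairs of objects. The right τ-modules form a category enriched in V. Write
-- Hom for its objects of maps, τ_b for the representable module τ(-, b), and X_b for the module
-- X(-, b) given by a bimodule X.
--
-- Replace `P` by a levelwise fibrant bimodule X. The point of X gives a map τ_b → X_b, natural in
-- b, which is a levelwise weak equivalence. Factor it functorially in b as f : τ_b → N_b followed
-- by p : N_b → X_b, where f has the left lifting property against levelwise fibrations and p is a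
-- levelwise fibration. By the monoid axiom f is a levelwise weak equivalence
-- (`BiMod.llp_levelwise_fibrations_le`), so p is a levelwise trivial fibration and N_b is levelwise
-- fibrant.
--
-- The zig-zag is σ ← E₁ → End(N) ← E₂ → τ, where End(N)(a, b) = Hom(N_a, N_b), E₁ is the fiber
-- product of σ(a, b) and Hom(N_a, N_b) over Hom(N_a, X_b), and E₂ is that of Hom(N_a, N_b) and τ(a,
-- b) over Hom(τ_a, N_b). These are enrichments because they consist of the endomorphisms of the
-- natural maps p and f (`Enrichment.exists_fiberProduct`).
--
-- Four maps have to be weak equivalences. Hom(N_a, N_b) → Hom(τ_a, N_b) is a trivial fibration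
-- because N_b is fibrant (`RMod.trivialFibrations_homMapLeft`). Hom(N_a, N_b) → Hom(N_a, X_b) is
-- one because N_a arises from a representable by f, and on representables the Yoneda lemma
-- identifies the map with a component of p (`RMod.trivialFibrations_homMapRight`). The legs σ(a, b)
-- → Hom(N_a, X_b) and τ(a, b) → Hom(τ_a, N_b) become, after mapping on to Hom(τ_a, X_b) ≅ X(a, b)
-- and to Hom(τ_a, N_b) ≅ N_b(a), the left comparison map and a component of f. Base change of
-- trivial fibrations and two-out-of-three finish the argument, and the second claim is the case of
-- a one-object subcategory.
--
-- The monoid axiom speaks of pushouts of single maps, whereas the small object argument produces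
-- pushouts of coproducts. Cells are therefore attached one at a time and the resulting transfinite
-- compositions concatenated along a lexicographic product.

universe w w'

namespace ModelEnrich

/-! ### Concatenation of transfinite compositions -/

section Concatenation

variable {C : Type u} [Category.{v} C]
  {J : Type w} [LinearOrder J] [SuccOrder J] [OrderBot J] [WellFoundedLT J]
  {K : Type w'} [LinearOrder K] [SuccOrder K] [OrderBot K] [WellFoundedLT K]
  {X Y : C} {f : X ⟶ Y} (h : TransfiniteCompositionOfShape J f)
  (g : ∀ α : J, TransfiniteCompositionOfShape K (h.F.map (homOfLE (Order.le_succ α))))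

@[simp]
lemma concat_isoBot_inv_incl_assoc (α : J) {Z : C} (φ : h.F.obj (Order.succ α) ⟶ Z) :
    (g α).isoBot.inv ≫ (g α).incl.app ⊥ ≫ φ = h.F.map (homOfLE (Order.le_succ α)) ≫ φ := by
  rw [← assoc]
  exact congrArg (· ≫ φ) (g α).fac

lemma concat_map_incl (α : J) {k l : K} (hkl : k ≤ l) :
    (g α).F.map (homOfLE hkl) ≫ (g α).incl.app l = (g α).incl.app k := by
  simp

lemma concat_map_incl_assoc (α : J) {k l : K} (hkl : k ≤ l) {Z : C}
    (φ : h.F.obj (Order.succ α) ⟶ Z) :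
    (g α).F.map (homOfLE hkl) ≫ (g α).incl.app l ≫ φ = (g α).incl.app k ≫ φ := by
  rw [← assoc]
  exact congrArg (· ≫ φ) (concat_map_incl h g α hkl)

/-- The lexicographic order relation, in unbundled form. -/
def LexLE (α : J) (k : K) (β : J) (l : K) : Prop := α < β ∨ α = β ∧ k ≤ l

/-- Transition map of a concatenation. -/
def concatMap {α β : J} {k l : K} (hr : LexLE α k β l) : (g α).F.obj k ⟶ (g β).F.obj l :=
  -- Between different blocks, the map leaves block α through its colimit `h.F.obj (succ α)` and
  -- enters block β at its bottom, which is `h.F.obj β`.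
  if hαβ : α < β then
    (g α).incl.app k ≫ h.F.map (homOfLE (Order.succ_le_of_lt hαβ)) ≫
      (g β).isoBot.inv ≫ (g β).F.map (homOfLE bot_le)
  else eqToHom (by rw [(hr.resolve_left hαβ).1]) ≫
    (g β).F.map (homOfLE (hr.resolve_left hαβ).2)

lemma concatMap_of_lt {α β : J} {k l : K} (hr : LexLE α k β l) (hαβ : α < β) :
    concatMap h g hr = (g α).incl.app k ≫ h.F.map (homOfLE (Order.succ_le_of_lt hαβ)) ≫
      (g β).isoBot.inv ≫ (g β).F.map (homOfLE bot_le) :=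
  dif_pos hαβ

lemma concatMap_of_lt_bot {α β : J} {k : K} (hr : LexLE α k β (⊥ : K)) (hαβ : α < β) :
    concatMap h g hr = (g α).incl.app k ≫ h.F.map (homOfLE (Order.succ_le_of_lt hαβ)) ≫
      (g β).isoBot.inv := by
  rw [concatMap_of_lt h g hr hαβ]
  have : homOfLE (bot_le (a := (⊥ : K))) = 𝟙 _ := rfl
  rw [this, CategoryTheory.Functor.map_id, comp_id]

lemma concatMap_succ {α : J} {k : K} (hr : LexLE α k (Order.succ α) (⊥ : K))
    (hα : α < Order.succ α) :
    concatMap h g hr = (g α).incl.app k ≫ (g (Order.succ α)).isoBot.inv := by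
  rw [concatMap_of_lt_bot h g hr hα]
  refine congrArg ((g α).incl.app k ≫ ·) ?_
  have : homOfLE (Order.succ_le_of_lt hα) = 𝟙 _ := rfl
  rw [this, CategoryTheory.Functor.map_id]
  exact id_comp _

lemma concatMap_of_le {α : J} {k l : K} (hr : LexLE α k α l) (hkl : k ≤ l) :
    concatMap h g hr = (g α).F.map (homOfLE hkl) :=
  (dif_neg (lt_irrefl α)).trans (by simp)

lemma LexLE.trans {α β γ : J} {k l m : K} (h₁ : LexLE α k β l) (h₂ : LexLE β l γ m) :
    LexLE α k γ m := by
  obtain h₁ | ⟨rfl, h₁'⟩ := h₁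
  · obtain h₂ | ⟨rfl, h₂'⟩ := h₂
    · exact .inl (h₁.trans h₂)
    · exact .inl h₁
  · obtain h₂ | ⟨rfl, h₂'⟩ := h₂
    · exact .inl h₂
    · exact .inr ⟨rfl, h₁'.trans h₂'⟩

/-- The case with content is α < β < γ: crossing block β from its bottom to its colimit is the
transition map of `h.F` that the block refines. -/
lemma concatMap_comp {α β γ : J} {k l m : K} (h₁ : LexLE α k β l) (h₂ : LexLE β l γ m) :
    concatMap h g (h₁.trans h₂) = concatMap h g h₁ ≫ concatMap h g h₂ := by
  obtain h₁' | ⟨rfl, h₁'⟩ := id h₁ <;> obtain h₂' | ⟨rfl, h₂'⟩ := id h₂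
  · rw [concatMap_of_lt h g h₁ h₁', concatMap_of_lt h g h₂ h₂',
      concatMap_of_lt h g _ (h₁'.trans h₂')]
    simp only [assoc]
    rw [concat_map_incl_assoc, concat_isoBot_inv_incl_assoc, ← Functor.map_comp_assoc,
      ← Functor.map_comp_assoc]
    rfl
  · rw [concatMap_of_lt h g h₁ h₁', concatMap_of_le h g h₂ h₂', concatMap_of_lt h g _ h₁']
    simp only [assoc, ← Functor.map_comp]
    rfl
  · rw [concatMap_of_le h g h₁ h₁', concatMap_of_lt h g h₂ h₂', concatMap_of_lt h g _ h₂',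
      concat_map_incl_assoc]
  · rw [concatMap_of_le h g h₁ h₁', concatMap_of_le h g h₂ h₂',
      concatMap_of_le h g _ (h₁'.trans h₂'), ← Functor.map_comp]
    rfl

/-- The functor underlying the concatenation of transfinite compositions. -/
def concatFunctor : J ×ₗ K ⥤ C where
  obj p := (g (ofLex p).1).F.obj (ofLex p).2
  map φ := concatMap h g (Prod.Lex.le_iff.1 (leOfHom φ))
  map_id p := (concatMap_of_le h g _ le_rfl).trans ((g _).F.map_id _)
  map_comp φ ψ := concatMap_comp h g (Prod.Lex.le_iff.1 (leOfHom φ))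
    (Prod.Lex.le_iff.1 (leOfHom ψ))

lemma concatMap_incl {α β : J} {k l : K} (hr : LexLE α k β l) :
    concatMap h g hr ≫ (g β).incl.app l ≫ h.incl.app (Order.succ β) =
      (g α).incl.app k ≫ h.incl.app (Order.succ α) := by
  obtain hr' | ⟨rfl, hr'⟩ := id hr
  · rw [concatMap_of_lt h g hr hr']
    simp
  · rw [concatMap_of_le h g hr hr', concat_map_incl_assoc]

/-- The cocone of the concatenation. -/
def concatIncl : concatFunctor h g ⟶ (Functor.const _).obj Y where
  app p := (g (ofLex p).1).incl.app (ofLex p).2 ≫ h.incl.app (Order.succ (ofLex p).1)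
  naturality _ _ φ := (concatMap_incl h g (Prod.Lex.le_iff.1 (leOfHom φ))).trans (comp_id _).symm

/-- A family of maps out of the initial stages of a concatenation, compatible with the
transition maps, is compatible with the transition maps of `h.F`. -/
lemma concat_glue {Z : C} {α β : J} (hαβ : α ≤ β)
    (a : (g α).F.obj ⊥ ⟶ Z) (b : (g β).F.obj ⊥ ⟶ Z)
    (hab : ∀ hr : LexLE α (⊥ : K) β (⊥ : K), concatMap h g hr ≫ b = a) :
    h.F.map (homOfLE hαβ) ≫ (g β).isoBot.inv ≫ b = (g α).isoBot.inv ≫ a := by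
  obtain rfl | hlt := hαβ.eq_or_lt
  · have hr : LexLE α (⊥ : K) α ⊥ := .inr ⟨rfl, le_rfl⟩
    have := hab hr
    rw [concatMap_of_le h g hr le_rfl] at this
    have e : homOfLE (le_refl (⊥ : K)) = 𝟙 _ := rfl
    rw [e, CategoryTheory.Functor.map_id, id_comp] at this
    have e' : homOfLE hαβ = 𝟙 α := rfl
    rw [this, e', CategoryTheory.Functor.map_id, id_comp]
  · have hr : LexLE α (⊥ : K) β ⊥ := .inl hlt
    rw [← hab hr, concatMap_of_lt_bot h g hr hlt]
    simp only [assoc, concat_isoBot_inv_incl_assoc]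
    rw [← Functor.map_comp_assoc]
    rfl

omit [SuccOrder J] [OrderBot J] [WellFoundedLT J] [SuccOrder K] [OrderBot K]
  [WellFoundedLT K] in
lemma LexLE.le {α β : J} {k l : K} (hr : LexLE α k β l) : toLex (α, k) ≤ toLex (β, l) :=
  Prod.Lex.le_iff.2 hr

omit [SuccOrder J] [OrderBot J] [WellFoundedLT J] [SuccOrder K] [OrderBot K]
  [WellFoundedLT K] in
lemma LexLE.of_le {α β : J} {k l : K} (hr : toLex (α, k) ≤ toLex (β, l)) : LexLE α k β l :=
  Prod.Lex.le_iff.1 hr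

/-- Colimit property of `(g α).F.obj k` for a limit element `k`. -/
lemma concat_hom_ext_limit {Z : C} {α : J} {k : K} (hk : Order.IsSuccLimit k)
    {a b : (g α).F.obj k ⟶ Z}
    (hab : ∀ l (hl : l < k), (g α).F.map (homOfLE hl.le) ≫ a = (g α).F.map (homOfLE hl.le) ≫ b) :
    a = b :=
  ((g α).F.isColimitOfIsWellOrderContinuous k hk).hom_ext (fun l ↦ hab l.1 l.2)

lemma concat_exists_desc_limit {Z : C} {α : J} {k : K} (hk : Order.IsSuccLimit k)
    (s : ∀ l, l < k → ((g α).F.obj l ⟶ Z))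
    (hs : ∀ l m (hlm : l ≤ m) (hm : m < k),
      (g α).F.map (homOfLE hlm) ≫ s m hm = s l (hlm.trans_lt hm)) :
    ∃ d : (g α).F.obj k ⟶ Z, ∀ l (hl : l < k), (g α).F.map (homOfLE hl.le) ≫ d = s l hl :=
  ⟨((g α).F.isColimitOfIsWellOrderContinuous k hk).desc (Cocone.mk Z
    { app l := s l.1 l.2
      naturality l m φ := (hs l.1 m.1 (leOfHom φ) m.2).trans (comp_id _).symm }),
    fun l hl ↦ ((g α).F.isColimitOfIsWellOrderContinuous k hk).fac _ ⟨l, hl⟩⟩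

/-- Two maps out of a stage `h.F.obj β` which is a colimit of the previous stages agree if they
agree on the previous stages. -/
lemma concat_hom_ext_base {Z : C} {β : J} (hβ : Order.IsSuccLimit β) {a b : h.F.obj β ⟶ Z}
    (hab : ∀ α (hα : α < β), h.F.map (homOfLE hα.le) ≫ a = h.F.map (homOfLE hα.le) ≫ b) :
    a = b :=
  (h.F.isColimitOfIsWellOrderContinuous β hβ).hom_ext (fun l ↦ hab l.1 l.2)

lemma concat_exists_desc_base {Z : C} {β : J} (hβ : Order.IsSuccLimit β)
    (s : ∀ l, l < β → (h.F.obj l ⟶ Z))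
    (hs : ∀ l m (hlm : l ≤ m) (hm : m < β),
      h.F.map (homOfLE hlm) ≫ s m hm = s l (hlm.trans_lt hm)) :
    ∃ d : h.F.obj β ⟶ Z, ∀ l (hl : l < β), h.F.map (homOfLE hl.le) ≫ d = s l hl :=
  ⟨(h.F.isColimitOfIsWellOrderContinuous β hβ).desc (Cocone.mk Z
    { app l := s l.1 l.2
      naturality l m φ := (hs l.1 m.1 (leOfHom φ) m.2).trans (comp_id _).symm }),
    fun l hl ↦ (h.F.isColimitOfIsWellOrderContinuous β hβ).fac _ ⟨l, hl⟩⟩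

/-- A predecessor l of k would make (α, l) a predecessor of (α, k), since nothing from another block
fits between them. -/
lemma isSuccLimit_right_of_lex {α : J} {k : K} (hk : k ≠ ⊥)
    (hp : Order.IsSuccLimit (toLex (α, k))) : Order.IsSuccLimit k := by
  refine ⟨fun hm ↦ hk (hm.eq_bot), fun l hl ↦ hp.2 (toLex (α, l)) ?_⟩
  refine ⟨Prod.Lex.lt_iff.2 (.inr ⟨rfl, hl.1⟩), ?_⟩
  rintro ⟨γ, m⟩ h₁ h₂
  change toLex (α, l) < toLex (γ, m) at h₁
  change toLex (γ, m) < toLex (α, k) at h₂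
  obtain h₁ | ⟨h₁, h₁'⟩ := Prod.Lex.lt_iff.1 h₁ <;>
    obtain h₂ | ⟨h₂, h₂'⟩ := Prod.Lex.lt_iff.1 h₂ <;> simp only [ofLex_toLex] at h₁ h₂
  · exact lt_asymm h₁ h₂
  · exact h₁.ne' h₂
  · exact h₂.ne' h₁
  · exact hl.2 h₁' h₂'

/-- The value of a concatenation at a limit element is the colimit of the previous values:
uniqueness of the factorizations. -/
lemma concat_hom_ext [NoMaxOrder K] {Z : C} {β : J} {k : K}
    (hp : Order.IsSuccLimit (toLex (β, k))) {a b : (g β).F.obj k ⟶ Z}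
    (hab : ∀ α l (hr : LexLE α l β k), toLex (α, l) < toLex (β, k) →
      concatMap h g hr ≫ a = concatMap h g hr ≫ b) : a = b := by
  -- There are three kinds of limit elements: inside a block; the bottom of a block with β a limit,
  -- where continuity of `h.F` applies; and the bottom of a block with β = succ α, where block α has
  -- colimit `h.F.obj β`.
  by_cases hk : k = ⊥
  · subst hk
    have hlt : ∀ α < β, ∀ l, toLex (α, l) < toLex (β, (⊥ : K)) :=
      fun α hα l ↦ Prod.Lex.lt_iff.2 (.inl hα)
    by_cases hβ : Order.IsSuccPrelimit β
    · have hβ' : Order.IsSuccLimit β := by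
        refine ⟨fun hm ↦ hp.1 ?_, hβ⟩
        obtain rfl := hm.eq_bot
        exact isMin_bot
      rw [← cancel_epi (g β).isoBot.inv]
      refine concat_hom_ext_base h hβ' (fun α hα ↦ ?_)
      have hr : LexLE α (⊥ : K) β ⊥ := .inl hα
      have := (g α).isoBot.inv ≫= hab α ⊥ hr (hlt α hα ⊥)
      rw [concatMap_of_lt_bot h g hr hα] at this
      simp only [assoc, concat_isoBot_inv_incl_assoc] at this
      rw [← Functor.map_comp_assoc, ← Functor.map_comp_assoc] at this
      exact this
    · obtain ⟨α, hα⟩ := Order.not_isSuccPrelimit_iff_exists_covBy.1 hβ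
      have hs : Order.succ α = β := hα.succ_eq
      subst hs
      rw [← cancel_epi (g _).isoBot.inv]
      refine (g α).isColimit.hom_ext (fun l ↦ ?_)
      have hr : LexLE α l (Order.succ α) (⊥ : K) := .inl hα.1
      have := hab α l hr (hlt α hα.1 l)
      rw [concatMap_of_lt_bot h g hr hα.1] at this
      simpa using this
  · refine concat_hom_ext_limit h g (isSuccLimit_right_of_lex hk hp) (fun l hl ↦ ?_)
    have hr : LexLE β l β k := .inr ⟨rfl, hl.le⟩
    have := hab β l hr (Prod.Lex.lt_iff.2 (.inr ⟨rfl, hl⟩))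
    rwa [concatMap_of_le h g hr hl.le] at this

/-- The value of a concatenation at a limit element is the colimit of the previous values:
existence of the factorizations. -/
lemma concat_exists_desc {Z : C} {β : J} {k : K}
    (hp : Order.IsSuccLimit (toLex (β, k)))
    (s : ∀ α l, toLex (α, l) < toLex (β, k) → ((g α).F.obj l ⟶ Z))
    (hs : ∀ α l γ m (hr : LexLE α l γ m) (hm : toLex (γ, m) < toLex (β, k)),
      concatMap h g hr ≫ s γ m hm = s α l (hr.le.trans_lt hm)) :
    ∃ d : (g β).F.obj k ⟶ Z, ∀ α l (hr : LexLE α l β k) (hl : toLex (α, l) < toLex (β, k)),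
      concatMap h g hr ≫ d = s α l hl := by
  by_cases hk : k = ⊥
  · subst hk
    have hlt : ∀ α < β, ∀ l, toLex (α, l) < toLex (β, (⊥ : K)) :=
      fun α hα l ↦ Prod.Lex.lt_iff.2 (.inl hα)
    have hlt' : ∀ α l, toLex (α, l) < toLex (β, (⊥ : K)) → α < β := by
      intro α l hl
      obtain hl | ⟨-, hl⟩ := Prod.Lex.lt_iff.1 hl
      · exact hl
      · simp at hl
    by_cases hβ : Order.IsSuccPrelimit β
    · have hβ' : Order.IsSuccLimit β := by
        refine ⟨fun hm ↦ hp.1 ?_, hβ⟩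
        obtain rfl := hm.eq_bot
        exact isMin_bot
      -- The bottoms of the blocks are the objects `h.F.obj α`, so their values alone define the
      -- map; `concat_glue` gives compatibility.
      obtain ⟨d, hd⟩ := concat_exists_desc_base h hβ'
        (fun α hα ↦ (g α).isoBot.inv ≫ s α ⊥ (hlt α hα ⊥))
        (fun α γ hαγ hγ ↦ concat_glue h g hαγ _ _ (fun hr ↦ hs _ _ _ _ hr _))
      refine ⟨(g β).isoBot.hom ≫ d, fun α l hr hl ↦ ?_⟩
      have hα := hlt' α l hl
      rw [concatMap_of_lt_bot h g hr hα]
      -- Since β is a limit, every (α, l) lies below the bottom of the block succ α, which is still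
      -- below (β, ⊥).
      have hsα : Order.succ α < β := hβ.succ_lt hα
      have := (g α).incl.app l ≫= hd (Order.succ α) hsα
      simp only [assoc, Iso.inv_hom_id_assoc]
      refine this.trans ?_
      have hr' : LexLE α l (Order.succ α) (⊥ : K) := .inl (Order.lt_succ_of_not_isMax hα.not_isMax)
      rw [← hs α l (Order.succ α) ⊥ hr' (hlt _ hsα ⊥),
        concatMap_of_lt_bot h g hr' (Order.lt_succ_of_not_isMax hα.not_isMax)]
      simp
    · obtain ⟨α, hα⟩ := Order.not_isSuccPrelimit_iff_exists_covBy.1 hβ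
      have he : Order.succ α = β := hα.succ_eq
      subst he
      refine ⟨(g _).isoBot.hom ≫ (g α).isColimit.desc (Cocone.mk Z
        { app l := s α l (hlt α hα.1 l)
          naturality l m φ := ?_ }), ?_⟩
      · have hr : LexLE α l α m := .inr ⟨rfl, leOfHom φ⟩
        have := hs α l α m hr (hlt α hα.1 m)
        rw [concatMap_of_le h g hr (leOfHom φ)] at this
        exact this.trans (comp_id _).symm
      · have key : ∀ l (hr : LexLE α l (Order.succ α) (⊥ : K)), concatMap h g hr ≫
            (g _).isoBot.hom ≫ (g α).isColimit.desc (Cocone.mk Z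
              { app l := s α l (hlt α hα.1 l)
                naturality l m φ := by
                  have hr : LexLE α l α m := .inr ⟨rfl, leOfHom φ⟩
                  have := hs α l α m hr (hlt α hα.1 m)
                  rw [concatMap_of_le h g hr (leOfHom φ)] at this
                  exact this.trans (comp_id _).symm }) = s α l (hlt α hα.1 l) := by
          intro l hr
          rw [concatMap_succ h g hr hα.1]
          simp only [assoc, Iso.inv_hom_id_assoc]
          exact (g α).isColimit.fac _ l
        intro γ l hr hl
        -- Blocks before α are handled by passing through the bottom of block α.
        obtain hγ | rfl := (Order.le_of_lt_succ (hlt' γ l hl)).lt_or_eq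
        · have h₁ : LexLE γ l α (⊥ : K) := .inl hγ
          have h₂ : LexLE α (⊥ : K) (Order.succ α) (⊥ : K) := .inl hα.1
          have := concatMap_comp h g h₁ h₂
          rw [this, assoc, key ⊥ h₂, hs]
        · exact key l hr
  · have hk' := isSuccLimit_right_of_lex hk hp
    have hlt : ∀ l < k, toLex (β, l) < toLex (β, k) :=
      fun l hl ↦ Prod.Lex.lt_iff.2 (.inr ⟨rfl, hl⟩)
    obtain ⟨d, hd⟩ := concat_exists_desc_limit h g hk' (fun l hl ↦ s β l (hlt l hl))
      (fun l m hlm hm ↦ by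
        have hr : LexLE β l β m := .inr ⟨rfl, hlm⟩
        rw [← hs β l β m hr (hlt m hm), concatMap_of_le h g hr hlm])
    refine ⟨d, fun α l hr hl ↦ ?_⟩
    obtain hα | ⟨hα, hl'⟩ := Prod.Lex.lt_iff.1 hl
    · have hα : α < β := hα
      have h₁ : LexLE α l β (⊥ : K) := .inl hα
      have hbot : (⊥ : K) < k := bot_lt_iff_ne_bot.2 hk
      have h₂ : LexLE β (⊥ : K) β k := .inr ⟨rfl, bot_le⟩
      have := concatMap_comp h g h₁ h₂
      rw [this, assoc, concatMap_of_le h g h₂ bot_le, hd ⊥ hbot, hs]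
    · obtain rfl : α = β := hα
      have hl' : l < k := hl'
      rw [concatMap_of_le h g hr hl'.le, hd l hl']

instance concatFunctor_isWellOrderContinuous [NoMaxOrder K] :
    (concatFunctor h g).IsWellOrderContinuous where
  nonempty_isColimit := by
    rintro ⟨β, k⟩ hp
    replace hp : Order.IsSuccLimit (toLex (β, k)) := hp
    have hw (s : Cocone ((Set.principalSegIio (toLex (β, k))).monotone.functor ⋙
        concatFunctor h g)) := concat_exists_desc h g (Z := s.pt) hp
          (fun α l hl ↦ s.ι.app ⟨toLex (α, l), hl⟩)
          (fun α l γ m hr hm ↦ s.w (j' := ⟨toLex (α, l), hr.le.trans_lt hm⟩)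
            (j := ⟨toLex (γ, m), hm⟩) (homOfLE hr.le))
    exact ⟨{
      desc s := (hw s).choose
      fac s j := (hw s).choose_spec (ofLex j.1).1 (ofLex j.1).2 (LexLE.of_le j.2.le) j.2
      uniq s m hm := concat_hom_ext h g hp (fun α l hr hl ↦
        (hm ⟨toLex (α, l), hl⟩).trans ((hw s).choose_spec _ _ hr hl).symm) }⟩

section

variable [NoMaxOrder J]

/-- The cocone of a concatenation is a colimit cocone. -/
def isColimitConcat : IsColimit (Cocone.mk Y (concatIncl h g)) :=
  have hw (s : Cocone (concatFunctor h g)) (α : J) (l : K) (β : J) (m : K)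
      (hr : LexLE α l β m) :
      concatMap h g hr ≫ (show (g β).F.obj m ⟶ s.pt from s.ι.app (toLex (β, m))) =
        (show (g α).F.obj l ⟶ s.pt from s.ι.app (toLex (α, l))) :=
    s.w (j' := toLex (α, l)) (j := toLex (β, m)) (homOfLE hr.le)
  -- The bottoms of the blocks are cofinal because `J` has no maximal element, so a cocone is
  -- determined by its values there.
  { desc s := h.isColimit.desc (Cocone.mk s.pt
      { app α := (g α).isoBot.inv ≫ (show (g α).F.obj ⊥ ⟶ s.pt from s.ι.app (toLex (α, ⊥)))
        naturality α β φ := (concat_glue h g (leOfHom φ) _ _ (hw s _ _ _ _)).trans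
          (comp_id _).symm })
    fac s p := by
      obtain ⟨α, k⟩ := p
      have h₁ : LexLE α k (Order.succ α) (⊥ : K) := .inl (Order.lt_succ α)
      have := hw s α k (Order.succ α) ⊥ h₁
      rw [concatMap_succ h g h₁ (Order.lt_succ α), assoc] at this
      refine Eq.trans ?_ this
      refine (assoc _ _ _).trans ?_
      congr 1
      exact h.isColimit.fac _ (Order.succ α)
    uniq s m hm := by
      apply h.isColimit.hom_ext
      intro α
      rw [h.isColimit.fac]
      refine Eq.trans ?_ ((g α).isoBot.inv ≫= hm (toLex (α, ⊥)))
      change _ = (g α).isoBot.inv ≫ ((g α).incl.app ⊥ ≫ h.incl.app (Order.succ α)) ≫ m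
      rw [assoc, concat_isoBot_inv_incl_assoc, ← assoc]
      congr 1
      simp }

variable [NoMaxOrder K]

/-- As `K` has no maximal element, successors never leave a block, so every successor step of a
concatenation is a step of some `g α`. -/
instance lexSuccOrder : SuccOrder (J ×ₗ K) :=
  SuccOrder.ofSuccLeIff (fun p ↦ toLex ((ofLex p).1, Order.succ (ofLex p).2)) (by
    intro p q
    rw [Prod.Lex.lt_iff, Prod.Lex.le_iff]
    simp only [ofLex_toLex, Order.succ_le_iff])

/-- The concatenation of transfinite compositions. -/
def concat {W : MorphismProperty C} (h : TransfiniteCompositionOfShape J f)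
    (g : ∀ α : J, W.TransfiniteCompositionOfShape K (h.F.map (homOfLE (Order.le_succ α)))) :
    W.TransfiniteCompositionOfShape (J ×ₗ K) f :=
  let g' (α) := (g α).toTransfiniteCompositionOfShape
  { F := concatFunctor h g'
    isoBot := (g ⊥).isoBot ≪≫ h.isoBot
    incl := concatIncl h g'
    isColimit := isColimitConcat h g'
    fac := by
      have := (g' ⊥).fac
      have h₂ := h.fac
      change (h.isoBot.inv ≫ (g' ⊥).isoBot.inv) ≫ (g' ⊥).incl.app ⊥ ≫ h.incl.app _ = f
      rw [assoc, reassoc_of% this]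
      refine Eq.trans ?_ h₂
      congr 1
      simp
    map_mem p hp := by
      obtain ⟨α, k⟩ := p
      have hr : LexLE α k α (Order.succ k) := .inr ⟨rfl, Order.le_succ k⟩
      have := (g α).map_mem k (not_isMax k)
      rw [← concatMap_of_le h g' hr (Order.le_succ k)] at this
      exact this }

end

end Concatenation

end ModelEnrich

namespace ModelEnrich

/-! ### Attaching cells one at a time -/

section Cells

variable {C : Type u} [Category.{v} C]

/-- The map `f : X ⟶ Y` is obtained by attaching the cells `t i : A i ⟶ B i` along the maps
`a i : A i ⟶ X`. -/
structure IsCellAttachment {ι : Type w'} {A B : ι → C} (t : ∀ i, A i ⟶ B i) {X Y : C}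
    (a : ∀ i, A i ⟶ X) (f : X ⟶ Y) (b : ∀ i, B i ⟶ Y) : Prop where
  w (i : ι) : a i ≫ f = t i ≫ b i
  exists_desc {Z : C} (x : X ⟶ Z) (y : ∀ i, B i ⟶ Z) (h : ∀ i, a i ≫ x = t i ≫ y i) :
    ∃ d : Y ⟶ Z, f ≫ d = x ∧ ∀ i, b i ≫ d = y i
  hom_ext {Z : C} {d d' : Y ⟶ Z} (h : f ≫ d = f ≫ d') (h' : ∀ i, b i ≫ d = b i ≫ d') : d = d'

lemma exists_isCellAttachment [HasPushouts C] {ι : Type w'} [HasCoproductsOfShape ι C]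
    {A B : ι → C} (t : ∀ i, A i ⟶ B i) {X : C} (a : ∀ i, A i ⟶ X) :
    ∃ (Y : C) (f : X ⟶ Y) (b : ∀ i, B i ⟶ Y), IsCellAttachment t a f b :=
  ⟨pushout (Sigma.desc a) (Limits.Sigma.map t), pushout.inl _ _,
    fun i ↦ Sigma.ι B i ≫ pushout.inr _ _,
    { w i := by
        have := Sigma.ι A i ≫= pushout.condition (f := Sigma.desc a) (g := Limits.Sigma.map t)
        simpa using this
      exists_desc x y h := ⟨pushout.desc x (Sigma.desc y)
        (Limits.Sigma.hom_ext _ _ (fun i ↦ by simpa using h i)), pushout.inl_desc _ _ _,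
        fun i ↦ by rw [assoc, pushout.inr_desc, Sigma.ι_desc]⟩
      hom_ext h h' := pushout.hom_ext h (Limits.Sigma.hom_ext _ _ (fun i ↦ by simpa using h' i)) }⟩

/-- Pushouts of colimits of discrete diagrams of maps are cell attachments. -/
lemma exists_isCellAttachment_of_isPushout (T : MorphismProperty C) {ι : Type w'} {X Y A' B' : C}
    {f : X ⟶ Y} {a' : A' ⟶ X} {t' : A' ⟶ B'} {b' : B' ⟶ Y} (sq : IsPushout a' t' f b')
    (ht : T.colimitsOfShape (Discrete ι) t') :
    ∃ (A B : ι → C) (t : ∀ i, A i ⟶ B i) (_ : ∀ i, T (t i)) (a : ∀ i, A i ⟶ X)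
      (b : ∀ i, B i ⟶ Y), IsCellAttachment t a f b := by
  obtain ⟨X₁, X₂, c₁, c₂, h₁, h₂, φ, hφ⟩ := ht
  have e (i : ι) : c₁.ι.app ⟨i⟩ ≫ h₁.desc (Cocone.mk _ (φ ≫ c₂.ι)) = φ.app ⟨i⟩ ≫ c₂.ι.app ⟨i⟩ :=
    h₁.fac _ _
  refine ⟨fun i ↦ X₁.obj ⟨i⟩, fun i ↦ X₂.obj ⟨i⟩, fun i ↦ φ.app ⟨i⟩, fun i ↦ hφ _,
    fun i ↦ c₁.ι.app ⟨i⟩ ≫ a', fun i ↦ c₂.ι.app ⟨i⟩ ≫ b', ?_, ?_, ?_⟩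
  · intro i
    rw [assoc, sq.w, reassoc_of% (e i)]
  · intro Z x y h
    have hw : a' ≫ x = h₁.desc (Cocone.mk _ (φ ≫ c₂.ι)) ≫
        h₂.desc (Cocone.mk Z (Discrete.natTrans (fun i ↦ y i.as))) := by
      refine h₁.hom_ext (fun ⟨i⟩ ↦ ?_)
      rw [reassoc_of% (e i), h₂.fac]
      simpa using h i
    refine ⟨sq.desc x (h₂.desc (Cocone.mk Z (Discrete.natTrans (fun i ↦ y i.as)))) hw,
      sq.inl_desc _ _ hw, ?_⟩
    · intro i
      rw [assoc, sq.inr_desc, h₂.fac]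
      rfl
  · intro Z d d' h h'
    refine sq.hom_ext h (h₂.hom_ext (fun ⟨i⟩ ↦ ?_))
    simpa using h' i

variable {ι : Type w'} {A B : ι → C} {t : ∀ i, A i ⟶ B i} {X Y : C} {a : ∀ i, A i ⟶ X}
  {f : X ⟶ Y} {b : ∀ i, B i ⟶ Y}
  {K : Type w} [LinearOrder K] [SuccOrder K] [OrderBot K] [WellFoundedLT K] [NoMaxOrder K]

/-- Attaching the cells indexed by a type which embeds in a well-ordered type `K` without maximal
element is a transfinite composition of shape `K` of attachments of single cells. -/
lemma IsCellAttachment.transfiniteCompositionsOfShape [HasPushouts C] [HasCoproducts.{w'} C]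
    (T : MorphismProperty C) (hT : MorphismProperty.isomorphisms C ≤ T.pushouts)
    (ht : ∀ i, T (t i)) (h : IsCellAttachment t a f b) (e : ι ↪ K) :
    T.pushouts.transfiniteCompositionsOfShape K f := by
  -- Stage k is X with exactly the cells of index e i < k attached.
  have hex (k : K) := exists_isCellAttachment (ι := { i : ι // e i < k }) (fun i ↦ t i.1)
    (fun i ↦ a i.1)
  choose F g c hc using hex
  have hmap (k l : K) (hkl : k ≤ l) : ∃ d : F k ⟶ F l, g k ≫ d = g l ∧
      ∀ i : { i : ι // e i < k }, c k i ≫ d = c l ⟨i.1, i.2.trans_le hkl⟩ :=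
    (hc k).exists_desc _ _ (fun i ↦ (hc l).w ⟨i.1, i.2.trans_le hkl⟩)
  choose d hd hd' using hmap
  have hincl (k : K) : ∃ d : F k ⟶ Y, g k ≫ d = f ∧ ∀ i, c k i ≫ d = b i.1 :=
    (hc k).exists_desc _ _ (fun i ↦ h.w i.1)
  choose p hp hp' using hincl
  let Φ : K ⥤ C :=
    { obj := F
      map φ := d _ _ (leOfHom φ)
      map_id k := (hc k).hom_ext (by rw [hd, comp_id]) (fun i ↦ by rw [hd', comp_id])
      map_comp φ ψ := (hc _).hom_ext (by rw [reassoc_of% (hd _ _ (leOfHom φ)), hd, hd])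
        (fun i ↦ by rw [reassoc_of% (hd' _ _ (leOfHom φ)), hd', hd']) }
  have hglue {Z : C} (m : K → Prop) (s : ∀ k, m k → (F k ⟶ Z))
      (hs : ∀ k l (hkl : k ≤ l) (hk : m k) (hl : m l), d k l hkl ≫ s l hl = s k hk)
      (k l : K) (hk : m k) (hl : m l) : g k ≫ s k hk = g l ≫ s l hl := by
    obtain hkl | hkl := le_total k l
    · rw [← hs k l hkl hk hl, reassoc_of% (hd k l hkl)]
    · rw [← hs l k hkl hl hk, reassoc_of% (hd l k hkl)]
  have hglue' {Z : C} (m : K → Prop) (s : ∀ k, m k → (F k ⟶ Z))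
      (hs : ∀ k l (hkl : k ≤ l) (hk : m k) (hl : m l), d k l hkl ≫ s l hl = s k hk)
      (k l : K) (hk : m k) (hl : m l) (i : ι) (hik : e i < k) (hil : e i < l) :
      c k ⟨i, hik⟩ ≫ s k hk = c l ⟨i, hil⟩ ≫ s l hl := by
    obtain hkl | hkl := le_total k l
    · rw [← hs k l hkl hk hl, reassoc_of% (hd' k l hkl ⟨i, hik⟩)]
    · rw [← hs l k hkl hl hk, reassoc_of% (hd' l k hkl ⟨i, hil⟩)]
  -- No cell has index below ⊥, so the initial stage is X up to isomorphism.
  have hbot : IsIso (g ⊥) := by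
    obtain ⟨r, hr, -⟩ := (hc ⊥).exists_desc (𝟙 X) (fun i ↦ (not_lt_bot i.2).elim)
      (fun i ↦ (not_lt_bot i.2).elim)
    exact ⟨r, hr, (hc ⊥).hom_ext (by rw [reassoc_of% hr, comp_id])
      (fun i ↦ (not_lt_bot i.2).elim)⟩
  -- At a limit m each cell i with e i < m is already present at stage succ (e i) < m; the given map
  -- is read off there, and `hglue`, `hglue'` make the choice of stage irrelevant.
  have hdesc (m : K) (hm : Order.IsSuccLimit m) {Z : C} (s : ∀ k, k < m → (F k ⟶ Z))
      (hs : ∀ k l (hkl : k ≤ l) (hk : k < m) (hl : l < m), d k l hkl ≫ s l hl = s k hk) :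
      ∃ q : F m ⟶ Z, ∀ k (hk : k < m), d k m hk.le ≫ q = s k hk := by
    have hbm : ⊥ < m := bot_lt_iff_ne_bot.2 (fun hmb ↦ hm.1 (hmb ▸ isMin_bot))
    obtain ⟨q, hq, hq'⟩ := (hc m).exists_desc (g ⊥ ≫ s ⊥ hbm)
      (fun i ↦ c (Order.succ (e i.1)) ⟨i.1, Order.lt_succ _⟩ ≫
        s (Order.succ (e i.1)) (hm.succ_lt i.2)) (fun i ↦ by
          rw [hglue _ s hs ⊥ (Order.succ (e i.1)) hbm (hm.succ_lt i.2), ← assoc, ← assoc]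
          exact congrArg (· ≫ _) ((hc _).w ⟨i.1, Order.lt_succ _⟩))
    refine ⟨q, fun k hk ↦ (hc k).hom_ext ?_ (fun i ↦ ?_)⟩
    · rw [reassoc_of% (hd k m hk.le), hq]
      exact hglue _ s hs ⊥ k hbm hk
    · rw [reassoc_of% (hd' k m hk.le), hq']
      exact hglue' _ s hs _ k (hm.succ_lt (i.2.trans hk)) hk i.1 _ i.2
  have hext (m : K) (hm : Order.IsSuccLimit m) {Z : C} (q q' : F m ⟶ Z)
      (hq : ∀ k (hk : k < m), d k m hk.le ≫ q = d k m hk.le ≫ q') : q = q' := by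
    have hbm : ⊥ < m := bot_lt_iff_ne_bot.2 (fun hmb ↦ hm.1 (hmb ▸ isMin_bot))
    refine (hc m).hom_ext ?_ (fun i ↦ ?_)
    · rw [← hd ⊥ m hbm.le, assoc, assoc, hq ⊥ hbm]
    · rw [← hd' (Order.succ (e i.1)) m (hm.succ_lt i.2).le ⟨i.1, Order.lt_succ _⟩, assoc, assoc,
        hq _ (hm.succ_lt i.2)]
  have hcont (m : K) (hm : Order.IsSuccLimit m) :
      Nonempty (IsColimit ((Set.principalSegIio m).cocone Φ)) := by
    have key (s : Cocone ((Set.principalSegIio m).monotone.functor ⋙ Φ)) :=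
      hdesc m hm (Z := s.pt) (fun k hk ↦ s.ι.app ⟨k, hk⟩)
        (fun k l hkl hk hl ↦ s.w (j' := ⟨k, hk⟩) (j := ⟨l, hl⟩) (homOfLE hkl))
    exact ⟨{
      desc s := (key s).choose
      fac s k := (key s).choose_spec k.1 k.2
      uniq s q hq := hext m hm _ _
        (fun k hk ↦ (hq ⟨k, hk⟩).trans ((key s).choose_spec k hk).symm) }⟩
  have hdescY {Z : C} (s : ∀ k, (F k ⟶ Z))
      (hs : ∀ k l (hkl : k ≤ l), d k l hkl ≫ s l = s k) :
      ∃ q : Y ⟶ Z, ∀ k, p k ≫ q = s k := by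
    obtain ⟨q, hq, hq'⟩ := h.exists_desc (g ⊥ ≫ s ⊥)
      (fun i ↦ c (Order.succ (e i)) ⟨i, Order.lt_succ _⟩ ≫ s (Order.succ (e i))) (fun i ↦ by
        rw [hglue (fun _ ↦ True) (fun k _ ↦ s k) (fun k l hkl _ _ ↦ hs k l hkl) ⊥
          (Order.succ (e i)) trivial trivial, ← assoc, ← assoc]
        exact congrArg (· ≫ _) ((hc _).w ⟨i, Order.lt_succ _⟩))
    refine ⟨q, fun k ↦ (hc k).hom_ext ?_ (fun i ↦ ?_)⟩
    · rw [reassoc_of% (hp k), hq]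
      exact hglue (fun _ ↦ True) (fun k _ ↦ s k) (fun k l hkl _ _ ↦ hs k l hkl) ⊥ k trivial trivial
    · rw [reassoc_of% (hp' k), hq']
      exact hglue' (fun _ ↦ True) (fun k _ ↦ s k) (fun k l hkl _ _ ↦ hs k l hkl) _ k trivial
        trivial i.1 _ i.2
  have hextY {Z : C} (q q' : Y ⟶ Z) (hq : ∀ k, p k ≫ q = p k ≫ q') : q = q' := by
    refine h.hom_ext ?_ (fun i ↦ ?_)
    · rw [← hp ⊥, assoc, assoc, hq ⊥]
    · rw [← hp' (Order.succ (e i)) ⟨i, Order.lt_succ _⟩, assoc, assoc, hq]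
  have key (s : Cocone Φ) := hdescY (Z := s.pt) (fun k ↦ s.ι.app k)
    (fun k l hkl ↦ s.w (j' := k) (j := l) (homOfLE hkl))
  have hpd (k l : K) (hkl : k ≤ l) : d k l hkl ≫ p l = p k :=
    (hc k).hom_ext (by rw [reassoc_of% (hd k l hkl), hp, hp])
      (fun i ↦ by rw [reassoc_of% (hd' k l hkl), hp', hp'])
  refine ⟨{
    F := Φ
    isoBot := (asIso (g ⊥)).symm
    isWellOrderContinuous := ⟨hcont⟩
    incl :=
      { app := p
        naturality k l φ := (hpd k l (leOfHom φ)).trans (comp_id _).symm }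
    isColimit :=
      { desc s := (key s).choose
        fac s k := (key s).choose_spec k
        uniq s q hq := hextY _ _ (fun k ↦ (hq k).trans ((key s).choose_spec k).symm) }
    fac := hp ⊥
    map_mem k _ := ?_ }⟩
  change T.pushouts (d k (Order.succ k) (Order.le_succ k))
  -- From k to succ k either one cell is attached, namely the one of index k (unique by injectivity
  -- of e), or nothing changes.
  by_cases hk : ∃ i, e i = k
  · obtain ⟨i, rfl⟩ := hk
    have hw : (a i ≫ g (e i)) ≫ d (e i) (Order.succ (e i)) (Order.le_succ _) =
        t i ≫ c (Order.succ (e i)) ⟨i, Order.lt_succ _⟩ := by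
      rw [assoc, hd]
      exact (hc _).w ⟨i, Order.lt_succ _⟩
    have hi (j : { j : ι // e j < Order.succ (e i) }) : e j.1 < e i ∨ j.1 = i := by
      obtain hj | hj := (Order.le_of_lt_succ j.2).lt_or_eq
      · exact .inl hj
      · exact .inr (e.injective hj)
    have hi' {Z : C} (x : F (e i) ⟶ Z) (z : B i ⟶ Z) (hxz : (a i ≫ g (e i)) ≫ x = t i ≫ z) :
        ∃ q : F (Order.succ (e i)) ⟶ Z, d (e i) (Order.succ (e i)) (Order.le_succ _) ≫ q = x ∧
          c (Order.succ (e i)) ⟨i, Order.lt_succ _⟩ ≫ q = z := by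
      -- The map is dictated by x on the old cells and by z on the cell i. It is specified by
      -- properties because the case j = i transports z along an equality of indices.
      have hy (j : { j : ι // e j < Order.succ (e i) }) : ∃ y : B j.1 ⟶ Z,
          (a j.1 ≫ g (e i) ≫ x = t j.1 ≫ y) ∧ (∀ hj : e j.1 < e i, y = c (e i) ⟨j.1, hj⟩ ≫ x) ∧
          (∀ hj : i = j.1, hj ▸ z = y) := by
        obtain hj | hj := hi j
        · refine ⟨c (e i) ⟨j.1, hj⟩ ≫ x, ?_, fun _ ↦ rfl, fun hij ↦ ?_⟩
          · rw [← assoc, ← assoc]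
            exact congrArg (· ≫ _) ((hc _).w ⟨j.1, hj⟩)
          · exact (hj.ne (congrArg e hij.symm)).elim
        · obtain ⟨j, hj'⟩ := j
          obtain rfl : j = i := hj
          exact ⟨z, by rw [← hxz, assoc], fun hj ↦ (lt_irrefl _ hj).elim, fun _ ↦ rfl⟩
      choose y hy₁ hy₂ hy₃ using hy
      obtain ⟨q, hq, hq'⟩ := (hc (Order.succ (e i))).exists_desc (g (e i) ≫ x) y hy₁
      refine ⟨q, (hc (e i)).hom_ext ?_ (fun j ↦ ?_), ?_⟩
      · rw [reassoc_of% (hd (e i) _ (Order.le_succ _)), hq]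
      · rw [reassoc_of% (hd' (e i) _ (Order.le_succ _)), hq', hy₂ _ j.2]
      · rw [hq']
        exact (hy₃ ⟨i, Order.lt_succ _⟩ rfl).symm
    have key' (s : PushoutCocone (a i ≫ g (e i)) (t i)) := hi' s.inl s.inr s.condition
    refine T.pushouts_mk (IsPushout.of_isColimit' ⟨hw⟩
      (PushoutCocone.IsColimit.mk hw (fun s ↦ (key' s).choose)
        (fun s ↦ (key' s).choose_spec.1) (fun s ↦ (key' s).choose_spec.2)
        (fun s m hm hm' ↦ (hc _).hom_ext ?_ (fun j ↦ ?_)))) (ht i)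
    · rw [← hd (e i) _ (Order.le_succ _), assoc, assoc, hm, (key' s).choose_spec.1]
    · obtain hj | hj := hi j
      · rw [← hd' (e i) _ (Order.le_succ _) ⟨j.1, hj⟩, assoc, assoc, hm, (key' s).choose_spec.1]
      · obtain ⟨j, hj'⟩ := j
        obtain rfl : j = i := hj
        exact hm'.trans (key' s).choose_spec.2.symm
  -- No cell has index k, so both stages carry the same cells and the transition map is invertible.
  · refine hT _ ?_
    have hk' (i : { i : ι // e i < Order.succ k }) : e i.1 < k := by
      obtain hi | hi := (Order.le_of_lt_succ i.2).lt_or_eq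
      · exact hi
      · exact (hk ⟨_, hi⟩).elim
    obtain ⟨r, hr, hr'⟩ := (hc (Order.succ k)).exists_desc (g k) (fun i ↦ c k ⟨i.1, hk' i⟩)
      (fun i ↦ (hc k).w ⟨i.1, hk' i⟩)
    exact ⟨r, (hc k).hom_ext (by rw [reassoc_of% (hd k _ (Order.le_succ k)), hr, comp_id])
      (fun i ↦ by rw [reassoc_of% (hd' k _ (Order.le_succ k)), hr', comp_id]),
      (hc _).hom_ext (by rw [reassoc_of% hr, hd, comp_id])
        (fun i ↦ by rw [reassoc_of% (hr' i), hd', comp_id])⟩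

open Cardinal in
/-- Transfinite compositions of pushouts of coproducts of maps in `T` are transfinite compositions
of pushouts of maps in `T`. -/
lemma transfiniteCompositionsOfShape_pushouts_coproducts_le [HasPushouts C] [HasCoproducts.{w} C]
    (T : MorphismProperty C) (hT : MorphismProperty.isomorphisms C ≤ T.pushouts)
    (J : Type w) [LinearOrder J] [SuccOrder J] [OrderBot J] [WellFoundedLT J] [NoMaxOrder J] :
    (MorphismProperty.coproducts.{w} T).pushouts.transfiniteCompositionsOfShape J ≤
      MorphismProperty.transfiniteCompositions.{w} T.pushouts := by
  rintro X Y f ⟨h⟩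
  have hex (α : J) : ∃ (ι : Type w) (A B : ι → C) (t : ∀ i, A i ⟶ B i) (_ : ∀ i, T (t i))
      (a : ∀ i, A i ⟶ h.F.obj α) (b : ∀ i, B i ⟶ h.F.obj (Order.succ α)),
        IsCellAttachment t a (h.F.map (homOfLE (Order.le_succ α))) b := by
    obtain ⟨A', B', t', a', b', ht', sq⟩ := h.map_mem α (not_isMax α)
    obtain ⟨ι, ht'⟩ := (MorphismProperty.coproducts_iff _ _).1 ht'
    exact ⟨ι, exists_isCellAttachment_of_isPushout T sq ht'⟩
  choose ι A B t ht a b hcell using hex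
  -- A single `K` has to receive the cells of every step, since a lexicographic product has one
  -- shape for all blocks. The bound ℵ₀ makes c.ord a limit ordinal, hence without maximal element.
  let c : Cardinal.{w} := max ℵ₀ (Cardinal.mk (Σ α, ι α))
  let K : Type w := c.ord.ToType
  have : NoMaxOrder K := Cardinal.noMaxOrder (le_max_left _ _)
  have : Nonempty K := by
    rw [← Cardinal.mk_ne_zero_iff, Cardinal.mk_ord_toType]
    exact (Cardinal.aleph0_pos.trans_le (le_max_left _ _)).ne'
  let : OrderBot K := WellFoundedLT.toOrderBot K
  let : SuccOrder K := SuccOrder.ofLinearWellFoundedLT K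
  have e (α : J) : Nonempty (ι α ↪ K) := by
    rw [← Cardinal.le_def, Cardinal.mk_ord_toType]
    refine le_trans ?_ (le_max_right _ _)
    exact Cardinal.mk_le_of_injective (sigma_mk_injective (i := α))
  have hstep (α : J) : T.pushouts.transfiniteCompositionsOfShape K
      (h.F.map (homOfLE (Order.le_succ α))) :=
    (hcell α).transfiniteCompositionsOfShape T hT (ht α) (e α).some
  exact MorphismProperty.transfiniteCompositionsOfShape_le_transfiniteCompositions _ (J ×ₗ K) _
    ⟨concat h.toTransfiniteCompositionOfShape (fun α ↦ (hstep α).some)⟩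

end Cells

end ModelEnrich

namespace ModelEnrich

/-! ### Categories enriched in `V` and bimodules over them -/

section Bimodules

variable (V : Type u) [Category.{v} V] [MonoidalCategory V]

/-- A `V`-category with type of objects `A`. -/
structure VCat (A : Type w) where
  hom : A → A → V
  comp (a b c : A) : hom b c ⊗ hom a b ⟶ hom a c
  unit (a : A) : 𝟙_ V ⟶ hom a a
  comp_assoc (a b c d : A) :
    comp b c d ▷ hom a b ≫ comp a b d = (α_ _ _ _).hom ≫ hom c d ◁ comp a b c ≫ comp a c d
  unit_comp (a b : A) : unit b ▷ hom a b ≫ comp a b b = (λ_ _).hom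
  comp_unit (a b : A) : hom a b ◁ unit a ≫ comp a a b = (ρ_ _).hom

attribute [simp] VCat.unit_comp VCat.comp_unit

/-- The `V`-category with a single object, whose endomorphism object is the unit. -/
def VCat.point : VCat V PUnit.{w + 1} where
  hom _ _ := 𝟙_ V
  comp _ _ _ := (λ_ _).hom
  unit _ := 𝟙 _
  comp_assoc _ _ _ _ := by simp [unitors_equal]
  unit_comp _ _ := by simp
  comp_unit _ _ := by simp [unitors_equal]

variable {V} {A : Type w} {B : Type w'}

/-- The category of bimodules over two `V`-categories. -/
structure BiMod (σ : VCat V B) (τ : VCat V A) where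
  obj : A → B → V
  lact (a : A) (b c : B) : σ.hom b c ⊗ obj a b ⟶ obj a c
  ract (a b : A) (c : B) : obj b c ⊗ τ.hom a b ⟶ obj a c
  lact_assoc (a : A) (b c d : B) :
    σ.comp b c d ▷ obj a b ≫ lact a b d = (α_ _ _ _).hom ≫ σ.hom c d ◁ lact a b c ≫ lact a c d
  unit_lact (a : A) (b : B) : σ.unit b ▷ obj a b ≫ lact a b b = (λ_ _).hom
  ract_assoc (a b c : A) (d : B) :
    ract b c d ▷ τ.hom a b ≫ ract a b d = (α_ _ _ _).hom ≫ obj c d ◁ τ.comp a b c ≫ ract a c d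
  ract_unit (a : A) (b : B) : obj a b ◁ τ.unit a ≫ ract a a b = (ρ_ _).hom
  lact_ract (a b : A) (c d : B) :
    lact b c d ▷ τ.hom a b ≫ ract a b d = (α_ _ _ _).hom ≫ σ.hom c d ◁ ract a b c ≫ lact a c d

namespace BiMod

variable {σ : VCat V B} {τ : VCat V A}

attribute [simp] unit_lact ract_unit

section

variable (X : BiMod σ τ) {Z : V}

lemma lact_assoc_assoc (a : A) (b c d : B) (h : X.obj a d ⟶ Z) :
    σ.comp b c d ▷ X.obj a b ≫ X.lact a b d ≫ h =
      (α_ _ _ _).hom ≫ σ.hom c d ◁ X.lact a b c ≫ X.lact a c d ≫ h := by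
  rw [← assoc, X.lact_assoc, assoc, assoc]

@[simp]
lemma unit_lact_assoc (a : A) (b : B) (h : X.obj a b ⟶ Z) :
    σ.unit b ▷ X.obj a b ≫ X.lact a b b ≫ h = (λ_ _).hom ≫ h := by
  rw [← assoc, X.unit_lact]

lemma ract_assoc_assoc (a b c : A) (d : B) (h : X.obj a d ⟶ Z) :
    X.ract b c d ▷ τ.hom a b ≫ X.ract a b d ≫ h =
      (α_ _ _ _).hom ≫ X.obj c d ◁ τ.comp a b c ≫ X.ract a c d ≫ h := by
  rw [← assoc, X.ract_assoc, assoc, assoc]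

@[simp]
lemma ract_unit_assoc (a : A) (b : B) (h : X.obj a b ⟶ Z) :
    X.obj a b ◁ τ.unit a ≫ X.ract a a b ≫ h = (ρ_ _).hom ≫ h := by
  rw [← assoc, X.ract_unit]

lemma lact_ract_assoc (a b : A) (c d : B) (h : X.obj a d ⟶ Z) :
    X.lact b c d ▷ τ.hom a b ≫ X.ract a b d ≫ h =
      (α_ _ _ _).hom ≫ σ.hom c d ◁ X.ract a b c ≫ X.lact a c d ≫ h := by
  rw [← assoc, X.lact_ract, assoc, assoc]

end

/-- Morphisms of bimodules. -/
@[ext]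
structure Hom (X Y : BiMod σ τ) where
  app (a : A) (b : B) : X.obj a b ⟶ Y.obj a b
  lact_app (a : A) (b c : B) : X.lact a b c ≫ app a c = σ.hom b c ◁ app a b ≫ Y.lact a b c
  ract_app (a b : A) (c : B) : X.ract a b c ≫ app a c = app b c ▷ τ.hom a b ≫ Y.ract a b c

lemma Hom.lact_app_assoc {X Y : BiMod σ τ} (f : Hom X Y) (a : A) (b c : B) {Z : V}
    (h : Y.obj a c ⟶ Z) :
    X.lact a b c ≫ f.app a c ≫ h = σ.hom b c ◁ f.app a b ≫ Y.lact a b c ≫ h := by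
  rw [← assoc, f.lact_app, assoc]

lemma Hom.ract_app_assoc {X Y : BiMod σ τ} (f : Hom X Y) (a b : A) (c : B) {Z : V}
    (h : Y.obj a c ⟶ Z) :
    X.ract a b c ≫ f.app a c ≫ h = f.app b c ▷ τ.hom a b ≫ Y.ract a b c ≫ h := by
  rw [← assoc, f.ract_app, assoc]

instance : Category (BiMod σ τ) where
  Hom := Hom
  id X := { app _ _ := 𝟙 _, lact_app _ _ _ := by simp, ract_app _ _ _ := by simp }
  comp f g :=
    { app a b := f.app a b ≫ g.app a b
      lact_app a b c := by simp [f.lact_app_assoc, g.lact_app]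
      ract_app a b c := by simp [f.ract_app_assoc, g.ract_app] }

@[simp]
lemma id_app (X : BiMod σ τ) (a : A) (b : B) : Hom.app (𝟙 X) a b = 𝟙 _ := rfl

@[simp]
lemma comp_app {X Y Z : BiMod σ τ} (f : X ⟶ Y) (g : Y ⟶ Z) (a : A) (b : B) :
    (f ≫ g).app a b = f.app a b ≫ g.app a b := rfl

@[ext]
lemma hom_ext {X Y : BiMod σ τ} {f g : X ⟶ Y} (h : ∀ a b, f.app a b = g.app a b) : f = g :=
  Hom.ext (by ext a b; exact h a b)

variable (σ τ) in
/-- Evaluation of bimodules. -/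
def eval (a : A) (b : B) : BiMod σ τ ⥤ V where
  obj X := X.obj a b
  map f := f.app a b

/-! ### Levelwise colimits of bimodules. -/

section Colimits

variable {J : Type u₁} [Category.{v₁} J] [HasColimitsOfShape J V]
  [∀ X : V, PreservesColimitsOfShape J (tensorLeft X)]
  [∀ X : V, PreservesColimitsOfShape J (tensorRight X)]

variable (F : J ⥤ BiMod σ τ)

/-- The levelwise colimit of a diagram of bimodules. -/
noncomputable def colimObj (a : A) (b : B) : V := colimit (F ⋙ eval σ τ a b)

/-- The coprojections to the levelwise colimit. -/
noncomputable def colimι (a : A) (b : B) (j : J) : (F.obj j).obj a b ⟶ colimObj F a b :=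
  colimit.ι (F ⋙ eval σ τ a b) j

lemma map_app_colimι {i j : J} (φ : i ⟶ j) (a : A) (b : B) :
    (F.map φ).app a b ≫ colimι F a b j = colimι F a b i :=
  colimit.w (F ⋙ eval σ τ a b) φ

variable {F}

lemma colimObj_hom_ext {a : A} {b : B} {Z : V} {f g : colimObj F a b ⟶ Z}
    (h : ∀ j, colimι F a b j ≫ f = colimι F a b j ≫ g) : f = g :=
  colimit.hom_ext h

/-- Maps out of the levelwise colimit. -/
noncomputable def colimDesc {a : A} {b : B} {Z : V} (f : ∀ j, (F.obj j).obj a b ⟶ Z)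
    (hf : ∀ ⦃i j : J⦄ (φ : i ⟶ j), (F.map φ).app a b ≫ f j = f i) : colimObj F a b ⟶ Z :=
  colimit.desc (F ⋙ eval σ τ a b)
    (Cocone.mk Z { app := f, naturality _ _ φ := (hf φ).trans (comp_id _).symm })

lemma colimι_desc {a : A} {b : B} {Z : V} (f : ∀ j, (F.obj j).obj a b ⟶ Z)
    (hf : ∀ ⦃i j : J⦄ (φ : i ⟶ j), (F.map φ).app a b ≫ f j = f i) (j : J) :
    colimι F a b j ≫ colimDesc f hf = f j :=
  colimit.ι_desc _ j

-- Tensoring preserves the colimit, so whiskered coprojections remain jointly epic. This lemma and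
-- its three variants reduce each bimodule axiom for the colimit to the same axiom at a stage j.
omit [∀ X : V, PreservesColimitsOfShape J (tensorRight X)] in
lemma whiskerLeft_colimObj_hom_ext {a : A} {b : B} {S Z : V} {f g : S ⊗ colimObj F a b ⟶ Z}
    (h : ∀ j, S ◁ colimι F a b j ≫ f = S ◁ colimι F a b j ≫ g) : f = g :=
  (isColimitOfPreserves (tensorLeft S) (colimit.isColimit (F ⋙ eval σ τ a b))).hom_ext h

omit [∀ X : V, PreservesColimitsOfShape J (tensorLeft X)] in
lemma colimObj_whiskerRight_hom_ext {a : A} {b : B} {S Z : V} {f g : colimObj F a b ⊗ S ⟶ Z}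
    (h : ∀ j, colimι F a b j ▷ S ≫ f = colimι F a b j ▷ S ≫ g) : f = g :=
  (isColimitOfPreserves (tensorRight S) (colimit.isColimit (F ⋙ eval σ τ a b))).hom_ext h

lemma whiskerLeft_colimObj_whiskerRight_hom_ext {a : A} {b : B} {S T Z : V}
    {f g : (S ⊗ colimObj F a b) ⊗ T ⟶ Z}
    (h : ∀ j, (S ◁ colimι F a b j) ▷ T ≫ f = (S ◁ colimι F a b j) ▷ T ≫ g) : f = g :=
  (isColimitOfPreserves (tensorRight T)
    (isColimitOfPreserves (tensorLeft S) (colimit.isColimit (F ⋙ eval σ τ a b)))).hom_ext h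

omit [∀ X : V, PreservesColimitsOfShape J (tensorLeft X)] in
lemma colimObj_whiskerRight_whiskerRight_hom_ext {a : A} {b : B} {S T Z : V}
    {f g : (colimObj F a b ⊗ S) ⊗ T ⟶ Z}
    (h : ∀ j, (colimι F a b j ▷ S) ▷ T ≫ f = (colimι F a b j ▷ S) ▷ T ≫ g) : f = g :=
  (isColimitOfPreserves (tensorRight T)
    (isColimitOfPreserves (tensorRight S) (colimit.isColimit (F ⋙ eval σ τ a b)))).hom_ext h

variable (F)

/-- The left action on the levelwise colimit. -/
noncomputable def colimLact (a : A) (b c : B) : σ.hom b c ⊗ colimObj F a b ⟶ colimObj F a c :=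
  (isColimitOfPreserves (tensorLeft (σ.hom b c)) (colimit.isColimit (F ⋙ eval σ τ a b))).desc
    (Cocone.mk (colimObj F a c)
      { app j := (F.obj j).lact a b c ≫ colimι F a c j
        naturality i j φ := by
          refine Eq.trans ?_ (comp_id _).symm
          change σ.hom b c ◁ (F.map φ).app a b ≫ (F.obj j).lact a b c ≫ colimι F a c j =
            (F.obj i).lact a b c ≫ colimι F a c i
          rw [← (F.map φ).lact_app_assoc a b c, map_app_colimι] })

/-- The right action on the levelwise colimit. -/
noncomputable def colimRact (a b : A) (c : B) : colimObj F b c ⊗ τ.hom a b ⟶ colimObj F a c :=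
  (isColimitOfPreserves (tensorRight (τ.hom a b)) (colimit.isColimit (F ⋙ eval σ τ b c))).desc
    (Cocone.mk (colimObj F a c)
      { app j := (F.obj j).ract a b c ≫ colimι F a c j
        naturality i j φ := by
          refine Eq.trans ?_ (comp_id _).symm
          change (F.map φ).app b c ▷ τ.hom a b ≫ (F.obj j).ract a b c ≫ colimι F a c j =
            (F.obj i).ract a b c ≫ colimι F a c i
          rw [← (F.map φ).ract_app_assoc a b c, map_app_colimι] })

lemma colimι_lact (a : A) (b c : B) (j : J) :
    σ.hom b c ◁ colimι F a b j ≫ colimLact F a b c = (F.obj j).lact a b c ≫ colimι F a c j :=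
  (isColimitOfPreserves (tensorLeft _) (colimit.isColimit (F ⋙ eval σ τ a b))).fac _ j

lemma colimι_ract (a b : A) (c : B) (j : J) :
    colimι F b c j ▷ τ.hom a b ≫ colimRact F a b c = (F.obj j).ract a b c ≫ colimι F a c j :=
  (isColimitOfPreserves (tensorRight _) (colimit.isColimit (F ⋙ eval σ τ b c))).fac _ j

/-- The colimit of a diagram of bimodules. -/
noncomputable def colimitObj : BiMod σ τ where
  obj := colimObj F
  lact := colimLact F
  ract := colimRact F
  lact_assoc a b c d := whiskerLeft_colimObj_hom_ext (fun j ↦ by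
    rw [whisker_exchange_assoc, colimι_lact, associator_naturality_right_assoc,
      ← whiskerLeft_comp_assoc, colimι_lact, whiskerLeft_comp_assoc, colimι_lact,
      (F.obj j).lact_assoc_assoc])
  unit_lact a b := by
    rw [← cancel_epi (λ_ _).inv]
    refine colimObj_hom_ext (fun j ↦ ?_)
    rw [leftUnitor_inv_naturality_assoc, whisker_exchange_assoc, colimι_lact,
      Iso.inv_hom_id, comp_id, (F.obj j).unit_lact_assoc, Iso.inv_hom_id_assoc]
  ract_assoc a b c d := colimObj_whiskerRight_whiskerRight_hom_ext (fun j ↦ by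
    rw [associator_naturality_left_assoc, ← whisker_exchange_assoc, colimι_ract,
      ← comp_whiskerRight_assoc, colimι_ract, comp_whiskerRight_assoc, colimι_ract,
      (F.obj j).ract_assoc_assoc])
  ract_unit a b := by
    rw [← cancel_epi (ρ_ _).inv]
    refine colimObj_hom_ext (fun j ↦ ?_)
    rw [rightUnitor_inv_naturality_assoc, ← whisker_exchange_assoc, colimι_ract,
      Iso.inv_hom_id, comp_id, (F.obj j).ract_unit_assoc, Iso.inv_hom_id_assoc]
  lact_ract a b c d := whiskerLeft_colimObj_whiskerRight_hom_ext (fun j ↦ by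
    rw [← comp_whiskerRight_assoc, colimι_lact, associator_naturality_middle_assoc,
      ← whiskerLeft_comp_assoc, colimι_ract, whiskerLeft_comp_assoc, colimι_lact,
      comp_whiskerRight_assoc, colimι_ract, (F.obj j).lact_ract_assoc])

/-- The colimit cocone of a diagram of bimodules. -/
noncomputable def colimitCocone : Cocone F where
  pt := colimitObj F
  ι :=
    { app j :=
        { app a b := colimι F a b j
          lact_app a b c := (colimι_lact F a b c j).symm
          ract_app a b c := (colimι_ract F a b c j).symm }
      naturality i j φ := by
        ext a b
        exact (map_app_colimι F φ a b).trans (comp_id _).symm }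

/-- The colimit cocone of a diagram of bimodules is a colimit. -/
noncomputable def isColimitColimitCocone : IsColimit (colimitCocone F) where
  desc s :=
    { app a b := colimDesc (fun j ↦ (s.ι.app j).app a b)
        (fun i j φ ↦ congrArg (fun ψ ↦ Hom.app ψ a b) (s.w φ))
      lact_app a b c := whiskerLeft_colimObj_hom_ext (fun j ↦ by
        change _ ≫ colimLact F a b c ≫ _ = _
        rw [reassoc_of% (colimι_lact F), colimι_desc]
        refine Eq.trans ?_ (whiskerLeft_comp_assoc _ _ _ _)
        rw [colimι_desc]
        exact (s.ι.app j).lact_app a b c)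
      ract_app a b c := colimObj_whiskerRight_hom_ext (fun j ↦ by
        change _ ≫ colimRact F a b c ≫ _ = _
        rw [reassoc_of% (colimι_ract F), colimι_desc]
        refine Eq.trans ?_ (comp_whiskerRight_assoc _ _ _ _)
        rw [colimι_desc]
        exact (s.ι.app j).ract_app a b c) }
  fac s j := by
    refine hom_ext fun a b ↦ ?_
    exact colimι_desc (F := F) (Z := s.pt.obj a b) (fun j ↦ (s.ι.app j).app a b)
      (fun i j φ ↦ congrArg (fun ψ ↦ Hom.app ψ a b) (s.w φ)) j
  uniq s m hm := by
    ext a b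
    refine colimObj_hom_ext (fun j ↦ ?_)
    rw [colimι_desc]
    exact congrArg (fun φ ↦ Hom.app φ a b) (hm j)

instance : HasColimitsOfShape J (BiMod σ τ) where
  has_colimit F := ⟨⟨colimitCocone F, isColimitColimitCocone F⟩⟩

instance (a : A) (b : B) : PreservesColimitsOfShape J (eval σ τ a b) where
  preservesColimit {F} := preservesColimit_of_preserves_colimit_cocone (isColimitColimitCocone F)
    (IsColimit.ofIsoColimit (colimit.isColimit (F ⋙ eval σ τ a b))
      (Cocone.ext (Iso.refl _) (fun _ ↦ comp_id _)))

end Colimits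

/-! ### Free bimodules and their adjunction with evaluation. -/

section Free

variable (σ τ) (c : A) (d : B)

/-- The free bimodule generated by an object of `V` placed at `(c, d)`. -/
def freeObj (X : V) : BiMod σ τ where
  obj a b := σ.hom d b ⊗ (X ⊗ τ.hom a c)
  lact a b b' := (α_ _ _ _).inv ≫ σ.comp d b b' ▷ _
  ract a a' b := (α_ _ _ _).hom ≫ _ ◁ ((α_ _ _ _).hom ≫ X ◁ τ.comp a a' c)
  lact_assoc a b b' b'' := by
    have := σ.comp_assoc d b b' b''
    calc _ = 𝟙 _ ⊗≫ (σ.comp b b' b'' ▷ σ.hom d b ≫ σ.comp d b b'') ▷ (X ⊗ τ.hom a c) := by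
          monoidal
      _ = 𝟙 _ ⊗≫ ((α_ _ _ _).hom ≫ σ.hom b' b'' ◁ σ.comp d b b' ≫ σ.comp d b' b'') ▷
            (X ⊗ τ.hom a c) := by rw [this]
      _ = _ := by monoidal
  unit_lact a b := by
    calc _ = 𝟙 _ ⊗≫ (σ.unit b ▷ σ.hom d b ≫ σ.comp d b b) ▷ (X ⊗ τ.hom a c) := by monoidal
      _ = 𝟙 _ ⊗≫ (λ_ _).hom ▷ (X ⊗ τ.hom a c) := by rw [σ.unit_comp]
      _ = _ := by monoidal
  ract_assoc a a' a'' b := by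
    have := τ.comp_assoc a a' a'' c
    calc _ = 𝟙 _ ⊗≫ σ.hom d b ◁ X ◁ (τ.comp a' a'' c ▷ τ.hom a a' ≫ τ.comp a a' c) := by
          monoidal
      _ = 𝟙 _ ⊗≫ σ.hom d b ◁ X ◁
            ((α_ _ _ _).hom ≫ τ.hom a'' c ◁ τ.comp a a' a'' ≫ τ.comp a a'' c) := by rw [this]
      _ = _ := by monoidal
  ract_unit a b := by
    calc _ = 𝟙 _ ⊗≫ σ.hom d b ◁ X ◁ (τ.hom a c ◁ τ.unit a ≫ τ.comp a a c) := by monoidal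
      _ = 𝟙 _ ⊗≫ σ.hom d b ◁ X ◁ (ρ_ _).hom := by rw [τ.comp_unit]
      _ = _ := by monoidal
  lact_ract a a' b b' := by
    calc _ = 𝟙 _ ⊗≫ (σ.comp d b b' ▷ ((X ⊗ τ.hom a' c) ⊗ τ.hom a a') ≫
            _ ◁ ((α_ _ _ _).hom ≫ X ◁ τ.comp a a' c)) := by monoidal
      _ = 𝟙 _ ⊗≫ (_ ◁ ((α_ _ _ _).hom ≫ X ◁ τ.comp a a' c) ≫ σ.comp d b b' ▷ _) := by
          rw [whisker_exchange]
      _ = _ := by monoidal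

variable {X Y : V}

/-- The left action on a free bimodule. -/
def freeLact (X : V) (a : A) (b b' : B) :
    σ.hom b b' ⊗ (σ.hom d b ⊗ (X ⊗ τ.hom a c)) ⟶ σ.hom d b' ⊗ (X ⊗ τ.hom a c) :=
  (α_ _ _ _).inv ≫ σ.comp d b b' ▷ _

/-- The right action on a free bimodule. -/
def freeRact (X : V) (a a' : A) (b : B) :
    (σ.hom d b ⊗ (X ⊗ τ.hom a' c)) ⊗ τ.hom a a' ⟶ σ.hom d b ⊗ (X ⊗ τ.hom a c) :=
  (α_ _ _ _).hom ≫ _ ◁ ((α_ _ _ _).hom ≫ X ◁ τ.comp a a' c)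

lemma freeLact_naturality (f : X ⟶ Y) (a : A) (b b' : B) :
    freeLact σ τ c d X a b b' ≫ σ.hom d b' ◁ (f ▷ τ.hom a c) =
      σ.hom b b' ◁ (σ.hom d b ◁ (f ▷ τ.hom a c)) ≫ freeLact σ τ c d Y a b b' := by
  rw [freeLact, freeLact, assoc, ← whisker_exchange, tensor_whiskerLeft]
  simp only [assoc, Iso.inv_hom_id_assoc]

lemma freeRact_naturality (f : X ⟶ Y) (a a' : A) (b : B) :
    freeRact σ τ c d X a a' b ≫ σ.hom d b ◁ (f ▷ τ.hom a c) =
      (σ.hom d b ◁ (f ▷ τ.hom a' c)) ▷ τ.hom a a' ≫ freeRact σ τ c d Y a a' b := by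
  rw [freeRact, freeRact]
  calc _ = 𝟙 _ ⊗≫ σ.hom d b ◁ (_ ◁ τ.comp a a' c ≫ f ▷ τ.hom a c) := by monoidal
    _ = 𝟙 _ ⊗≫ σ.hom d b ◁ (f ▷ (τ.hom a' c ⊗ τ.hom a a') ≫ _ ◁ τ.comp a a' c) := by
      rw [whisker_exchange]
    _ = _ := by monoidal

/-- The free bimodule functor. -/
def free : V ⥤ BiMod σ τ where
  obj := freeObj σ τ c d
  map f :=
    { app a b := σ.hom d b ◁ (f ▷ τ.hom a c)
      lact_app := freeLact_naturality σ τ c d f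
      ract_app := freeRact_naturality σ τ c d f }
  map_id X := hom_ext fun a b ↦ by
    change σ.hom d b ◁ (𝟙 X ▷ τ.hom a c) = 𝟙 _
    simp
  map_comp f g := hom_ext fun a b ↦ by
    change σ.hom d b ◁ ((f ≫ g) ▷ τ.hom a c) =
      σ.hom d b ◁ (f ▷ τ.hom a c) ≫ σ.hom d b ◁ (g ▷ τ.hom a c)
    simp

/-- The unit of the adjunction between free bimodules and evaluation. -/
def freeUnit (X : V) : X ⟶ σ.hom d d ⊗ (X ⊗ τ.hom c c) :=
  (λ_ X).inv ≫ σ.unit d ▷ X ≫ σ.hom d d ◁ ((ρ_ X).inv ≫ X ◁ τ.unit c)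

/-- Together with `freeUnit_lact` this says that the image of X generates the free bimodule: acting
first by τ and then by σ recovers everything. It yields uniqueness of the extension of a map out of
X. -/
lemma freeUnit_ract (X : V) (a : A) :
    freeUnit σ τ c d X ▷ τ.hom a c ≫ freeRact σ τ c d X a c d =
      (λ_ _).inv ≫ σ.unit d ▷ (X ⊗ τ.hom a c) := by
  rw [freeRact, freeUnit]
  calc _ = 𝟙 _ ⊗≫ (σ.unit d ▷ (X ⊗ τ.hom a c) ≫ σ.hom d d ◁ ((ρ_ X).inv ▷ τ.hom a c)) ⊗≫
          σ.hom d d ◁ X ◁ (τ.unit c ▷ τ.hom a c ≫ τ.comp a c c) := by monoidal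
    _ = 𝟙 _ ⊗≫ (σ.unit d ▷ (X ⊗ τ.hom a c) ≫ σ.hom d d ◁ ((ρ_ X).inv ▷ τ.hom a c)) ⊗≫
          σ.hom d d ◁ X ◁ (λ_ _).hom := by rw [τ.unit_comp]
    _ = _ := by monoidal

lemma freeUnit_lact (X : V) (a : A) (b : B) :
    σ.hom d b ◁ ((λ_ _).inv ≫ σ.unit d ▷ (X ⊗ τ.hom a c)) ≫ freeLact σ τ c d X a d b =
      𝟙 _ := by
  rw [freeLact]
  calc _ = 𝟙 _ ⊗≫ (σ.hom d b ◁ σ.unit d ≫ σ.comp d d b) ▷ (X ⊗ τ.hom a c) := by monoidal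
    _ = 𝟙 _ ⊗≫ (ρ_ _).hom ▷ (X ⊗ τ.hom a c) := by rw [σ.comp_unit]
    _ = _ := by monoidal

lemma freeUnit_naturality (g : X ⟶ Y) :
    freeUnit σ τ c d X ≫ σ.hom d d ◁ (g ▷ τ.hom c c) = g ≫ freeUnit σ τ c d Y := by
  dsimp [freeUnit]
  simp only [assoc, ← whiskerLeft_comp]
  rw [whisker_exchange, ← rightUnitor_inv_naturality_assoc, whiskerLeft_comp,
    ← whisker_exchange_assoc, ← leftUnitor_inv_naturality_assoc]

lemma freeUnit_act (Y : BiMod σ τ) :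
    freeUnit σ τ c d (Y.obj c d) ≫ σ.hom d d ◁ Y.ract c c d ≫ Y.lact c d d = 𝟙 _ := by
  dsimp [freeUnit]
  simp only [assoc, ← whiskerLeft_comp_assoc, ract_unit, Iso.inv_hom_id, whiskerLeft_id, id_comp,
    unit_lact]

variable {c d}

/-- The components of the map of bimodules out of a free bimodule determined by a map in `V`. -/
def freeDescApp {M : BiMod σ τ} (g : X ⟶ M.obj c d) (a : A) (b : B) :
    σ.hom d b ⊗ (X ⊗ τ.hom a c) ⟶ M.obj a b :=
  σ.hom d b ◁ (g ▷ _ ≫ M.ract a c d) ≫ M.lact a d b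

lemma freeLact_freeDescApp {M : BiMod σ τ} (g : X ⟶ M.obj c d) (a : A) (b b' : B) :
    freeLact σ τ c d X a b b' ≫ freeDescApp σ τ g a b' =
      σ.hom b b' ◁ freeDescApp σ τ g a b ≫ M.lact a b b' := by
  rw [freeDescApp, freeDescApp, freeLact, assoc, ← whisker_exchange_assoc, M.lact_assoc,
    tensor_whiskerLeft]
  simp only [assoc, Iso.inv_hom_id_assoc, whiskerLeft_comp]

lemma freeRact_freeDescApp {M : BiMod σ τ} (g : X ⟶ M.obj c d) (a a' : A) (b : B) :
    freeRact σ τ c d X a a' b ≫ freeDescApp σ τ g a b =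
      freeDescApp σ τ g a' b ▷ τ.hom a a' ≫ M.ract a a' b := by
  rw [freeDescApp, freeDescApp, freeRact]
  simp only [comp_whiskerRight, assoc, M.lact_ract, whisker_assoc, Iso.inv_hom_id_assoc]
  simp only [← whiskerLeft_comp_assoc, assoc, M.ract_assoc, associator_naturality_left_assoc,
    whisker_exchange_assoc]

lemma freeDescApp_freeUnit {M : BiMod σ τ}
    (f : ∀ a b, σ.hom d b ⊗ (X ⊗ τ.hom a c) ⟶ M.obj a b)
    (hl : ∀ a b b', freeLact σ τ c d X a b b' ≫ f a b' = σ.hom b b' ◁ f a b ≫ M.lact a b b')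
    (hr : ∀ a a' b, freeRact σ τ c d X a a' b ≫ f a b = f a' b ▷ τ.hom a a' ≫ M.ract a a' b)
    (a : A) (b : B) :
    freeDescApp σ τ (freeUnit σ τ c d X ≫ f c d) a b = f a b := by
  rw [freeDescApp, comp_whiskerRight, assoc, ← hr, ← assoc, freeUnit_ract, whiskerLeft_comp,
    assoc, ← hl, ← assoc, freeUnit_lact, id_comp]

lemma freeUnit_freeDescApp {M : BiMod σ τ} (g : X ⟶ M.obj c d) :
    freeUnit σ τ c d X ≫ freeDescApp σ τ g c d = g := by
  rw [freeDescApp, whiskerLeft_comp, assoc, ← assoc, freeUnit_naturality, assoc, freeUnit_act,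
    comp_id]

variable (c d)

/-- The free bimodule functor is left adjoint to evaluation. -/
def freeAdj : free σ τ c d ⊣ eval σ τ c d :=
  Adjunction.mkOfHomEquiv
    { homEquiv X M :=
        { toFun f := freeUnit σ τ c d X ≫ f.app c d
          invFun g :=
            { app := freeDescApp σ τ g
              lact_app := freeLact_freeDescApp σ τ g
              ract_app := freeRact_freeDescApp σ τ g }
          left_inv f := hom_ext (freeDescApp_freeUnit σ τ f.app f.lact_app f.ract_app)
          right_inv g := freeUnit_freeDescApp σ τ g }
      homEquiv_naturality_left_symm {X' X M} f g := by
        refine hom_ext fun a b ↦ ?_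
        change freeDescApp σ τ (M := M) (f ≫ g) a b =
          σ.hom d b ◁ (f ▷ _) ≫ freeDescApp σ τ (M := M) g a b
        simp only [freeDescApp]
        erw [comp_whiskerRight]
        rw [assoc, whiskerLeft_comp_assoc]
      homEquiv_naturality_right f g := (assoc _ _ _).symm }

end Free

end BiMod

end Bimodules

end ModelEnrich

namespace ModelEnrich

/-! ### The small object argument for bimodules -/

section Preserves

variable {C : Type u₁} [Category.{v₁} C] {D : Type u₂} [Category.{v₂} D] (G : C ⥤ D)
  {W : MorphismProperty C} {T : MorphismProperty D}

/-- A functor preserving pushouts and coproducts carries cell attachments to cell attachments; it is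
used for evaluation of bimodules at a pair of objects. -/
lemma pushouts_coproducts_le_inverseImage [PreservesColimitsOfSize.{0, 0} G]
    [PreservesColimitsOfSize.{w, w} G]
    (h : W ≤ T.inverseImage G) :
    (MorphismProperty.coproducts.{w} W).pushouts ≤
      (MorphismProperty.coproducts.{w} T).pushouts.inverseImage G := by
  rintro X Y f ⟨A, B, t, a, b, ht, sq⟩
  refine ⟨G.obj A, G.obj B, G.map t, G.map a, G.map b, ?_, sq.map G⟩
  obtain ⟨J, ht⟩ := (MorphismProperty.coproducts_iff _ _).1 ht
  refine MorphismProperty.colimitsOfShape_le_coproducts _ J _ ?_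
  obtain ⟨X₁, X₂, c₁, c₂, h₁, h₂, f, hf⟩ := ht
  refine .mk' (X₁ ⋙ G) (X₂ ⋙ G) (G.mapCocone c₁) (G.mapCocone c₂) (isColimitOfPreserves G h₁)
    (isColimitOfPreserves G h₂) (Functor.whiskerRight f G) (fun j ↦ h _ (hf j)) _ (fun j ↦ ?_)
  change G.map (c₁.ι.app j) ≫ G.map _ = G.map (f.app j) ≫ G.map (c₂.ι.app j)
  rw [← G.map_comp, ← G.map_comp, h₁.fac]
  rfl

end Preserves

namespace BiMod

variable {V : Type u} [Category.{v} V] [MonoidalCategory V] {A : Type w} {B : Type w'}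
  {σ : VCat V B} {τ : VCat V A}

variable (σ τ) in
/-- Maps of bimodules that belong levelwise to a class of maps of `V`. -/
def levelwise (P : MorphismProperty V) : MorphismProperty (BiMod σ τ) :=
  fun _ _ f ↦ ∀ a b, P (f.app a b)

variable (σ τ) in
/-- The maps between free bimodules induced by a class of maps of `V`. -/
def freeMaps (P : MorphismProperty V) : MorphismProperty (BiMod σ τ) :=
  MorphismProperty.ofHoms (fun i : (A × B) × P.toSet ↦ (free σ τ i.1.1 i.1.2).map i.2.1.hom)

instance [Small.{v} A] [Small.{v} B] (P : MorphismProperty V)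
    [MorphismProperty.IsSmall.{v} P] : MorphismProperty.IsSmall.{v} (freeMaps σ τ P) := by
  unfold freeMaps
  infer_instance

/-- Lifting against a free map at (a, b) is, by adjunction, lifting in V against the evaluation at
(a, b). Thus levelwise fibrations are detected by the free maps on generating trivial cofibrations.
-/
lemma rlp_freeMaps (P : MorphismProperty V) :
    (freeMaps σ τ P).rlp = levelwise σ τ P.rlp := by
  ext X Y f
  constructor
  · intro hf a b S T i hi
    exact ((freeAdj σ τ a b).hasLiftingProperty_iff i f).1 (hf _ (MorphismProperty.ofHoms.mk
      (f := fun i : (A × B) × P.toSet ↦ (free σ τ i.1.1 i.1.2).map i.2.1.hom)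
      ((a, b), ⟨Arrow.mk i, hi⟩)))
  · rintro hf _ _ _ ⟨⟨⟨a, b⟩, ⟨i, hi⟩⟩⟩
    exact ((freeAdj σ τ a b).hasLiftingProperty_iff i.hom f).2 (hf a b _ hi)

instance [Small.{v} A] [Small.{v} B] : LocallySmall.{v} (BiMod σ τ) where
  hom_small X Y := small_of_injective (β := ∀ (a : A) (b : B), X.obj a b ⟶ Y.obj a b)
    (f := fun f ↦ Hom.app f) (fun f g h ↦ hom_ext fun a b ↦ congrFun (congrFun h a) b)

section SmallObject

variable [HasColimitsOfSize.{v, v} V]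
  [∀ X : V, PreservesColimitsOfSize.{v, v} (tensorLeft X)]
  [∀ X : V, PreservesColimitsOfSize.{v, v} (tensorRight X)]

instance : HasColimitsOfSize.{v, v} (BiMod σ τ) where

instance (a : A) (b : B) : PreservesColimitsOfSize.{v, v} (eval σ τ a b) where

variable [Small.{v} A] [Small.{v} B]

/-- Evaluation preserves colimits, so its left adjoint preserves presentability of objects; domains
of free maps are thus as small as the domains of the maps in `P`. -/
lemma hasSmallObjectArgument_freeMaps [IsLocallyPresentable.{v} V] (P : MorphismProperty V)
    [MorphismProperty.IsSmall.{v} P] :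
    MorphismProperty.HasSmallObjectArgument.{v} (freeMaps σ τ P) := by
  have hp (i : P.toSet) : IsPresentable.{v} i.1.left := inferInstance
  choose κ' hκ' hκ'' using fun i : P.toSet ↦ (hp i).exists_cardinal
  -- One regular cardinal exceeding the presentability ranks of all domains, which form a small
  -- family.
  obtain ⟨κ, hκ, h⟩ := HasCardinalLT.exists_regular_cardinal_forall.{v}
    (fun i : P.toSet ↦ (κ' i).ord.ToType)
  have : Fact κ.IsRegular := ⟨hκ⟩
  have : Nonempty κ.ord.ToType := by simpa using hκ.ne_zero
  have := WellFoundedLT.toOrderBot κ.ord.ToType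
  have : HasPushouts (BiMod σ τ) := 
    have := hasColimitsOfSizeShrink.{0, 0, v, v} (BiMod σ τ)
    inferInstance
  refine ⟨κ, inferInstance, inferInstance, { preservesColimit := ?_ }⟩
  rintro _ _ X Y _ ⟨⟨⟨a, b⟩, i⟩⟩ f hf
  have hi : κ' i ≤ κ := le_of_lt (by simpa [hasCardinalLT_iff_cardinal_mk_lt] using h i)
  have h₁ : IsCardinalPresentable i.1.left κ :=
    have := hκ'' i
    isCardinalPresentable_of_le _ hi
  have h₂ : IsCardinalPresentable ((free σ τ a b).obj i.1.left) κ :=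
    (freeAdj σ τ a b).isCardinalPresentable_leftAdjoint_obj κ _
  have := preservesColimitsOfShape_of_isCardinalPresentable
    ((free σ τ a b).obj i.1.left) κ κ.ord.ToType
  exact inferInstanceAs (PreservesColimit hf.F
    (coyoneda.obj (op ((free σ τ a b).obj i.1.left))))

variable (σ τ) in
lemma hasFunctorialFactorization_levelwise [IsLocallyPresentable.{v} V] (P : MorphismProperty V)
    [MorphismProperty.IsSmall.{v} P] :
    (levelwise σ τ P.rlp).llp.HasFunctorialFactorization (levelwise σ τ P.rlp) := by
  have := hasSmallObjectArgument_freeMaps (σ := σ) (τ := τ) P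
  rw [← rlp_freeMaps]
  infer_instance

end SmallObject

/-! ### The monoid axiom and levelwise weak equivalences. -/

section MonoidAxiom

variable {V : Type u} [Category.{v} V] [MonoidalCategory V] [ModelCategory V]

/-- An isomorphism is isomorphic, as an arrow, to 𝟙 X ⊗ S, and identities are trivial cofibrations.
This covers the stages of a cell-by-cell composition at which nothing is attached. -/
lemma isomorphisms_le_pushouts_tensorTrivialCofibrations :
    MorphismProperty.isomorphisms V ≤ (tensorTrivialCofibrations V).isoClosure.pushouts := by
  intro X Y e (he : IsIso e)
  refine (MorphismProperty.arrow_mk_iso_iff _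
    (show Arrow.mk (𝟙 X ▷ 𝟙_ V) ≅ Arrow.mk e from
      Arrow.isoMk (ρ_ X) (ρ_ X ≪≫ asIso e) (by simp))).1 ?_
  exact MorphismProperty.le_pushouts _ _ (MorphismProperty.le_isoClosure _ _
    (.mk (𝟙 X) inferInstance inferInstance _))

variable [SymmetricCategory V] [MonoidalClosed V] [HasColimitsOfSize.{v, v} V]

instance (X : V) : PreservesColimitsOfSize.{v₁, u₁} (tensorRight X) :=
  preservesColimits_of_natIso (BraidedCategory.tensorLeftIsoTensorRight X)

variable {A : Type w} {B : Type w'} {σ : VCat V B} {τ : VCat V A} [Small.{v} A] [Small.{v} B]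

omit [MonoidalClosed V] [HasColimitsOfSize.{v, v} V] [ModelCategory V] in
lemma whiskerLeft_whiskerRight_braiding {X Y : V} (j : X ⟶ Y) (S T : V) :
    ((α_ X S T).inv ≫ (β_ (X ⊗ S) T).hom) ≫ T ◁ (j ▷ S) =
      j ▷ (S ⊗ T) ≫ (α_ Y S T).inv ≫ (β_ (Y ⊗ S) T).hom := by
  rw [assoc, ← BraidedCategory.braiding_naturality_left, ← associator_inv_naturality_left_assoc]

-- At (a, b) the free map on j is σ(d, b) ⊗ (j ⊗ τ(a, c)), which the symmetry identifies with j ⊗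
-- (τ(a, c) ⊗ σ(d, b)); hence the closure under isomorphisms.
omit [MonoidalClosed V] [HasColimitsOfSize.{v, v} V] [Small.{v} A] [Small.{v} B] in
lemma freeMaps_le_inverseImage (J : MorphismProperty V) (hJ : J ≤ trivialCofibrations V)
    (a : A) (b : B) :
    freeMaps σ τ J ≤
      (tensorTrivialCofibrations V).isoClosure.inverseImage (eval σ τ a b) := by
  rintro _ _ _ ⟨⟨⟨c, d⟩, ⟨j, hj⟩⟩⟩
  have hj' := (mem_trivialCofibrations_iff j.hom).1 (hJ _ hj)
  exact ⟨_, _, _, .mk j.hom hj'.1 hj'.2 (τ.hom a c ⊗ σ.hom d b),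
    ⟨Arrow.isoMk (f := Arrow.mk (j.hom ▷ (τ.hom a c ⊗ σ.hom d b)))
      (g := Arrow.mk (σ.hom d b ◁ (j.hom ▷ τ.hom a c)))
      ((α_ _ _ _).symm ≪≫ β_ _ _) ((α_ _ _ _).symm ≪≫ β_ _ _)
      (whiskerLeft_whiskerRight_braiding j.hom _ _)⟩⟩

/-- By the small object argument such a map is a retract of a transfinite composition of pushouts of
coproducts of free maps. Evaluation preserves all of this, and the monoid axiom applies to the
result. -/
lemma llp_levelwise_le_levelwise_weakEquivalences [IsLocallyPresentable.{v} V]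
    (hmonoid : MonoidAxiom V) (J : MorphismProperty V) [MorphismProperty.IsSmall.{v} J]
    (hJ : J ≤ trivialCofibrations V) :
    (levelwise σ τ J.rlp).llp ≤ levelwise σ τ (weakEquivalences V) := by
  have := hasSmallObjectArgument_freeMaps (σ := σ) (τ := τ) J
  have := MorphismProperty.isCardinalForSmallObjectArgument_smallObjectκ (freeMaps σ τ J)
  rw [← rlp_freeMaps, MorphismProperty.llp_rlp_of_hasSmallObjectArgument']
  intro X Y f hf a b
  obtain ⟨X', Y', f', hr, hf'⟩ := hf
  have hr' : RetractArrow (f.app a b) (f'.app a b) := hr.map (eval σ τ a b)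
  refine (weakEquivalences V).of_retract hr' ?_
  apply hmonoid
  have h₁ : MorphismProperty.transfiniteCompositions.{v}
      (tensorTrivialCofibrations V).isoClosure.pushouts (f'.app a b) := by
    have := Cardinal.noMaxOrder (c := (freeMaps σ τ J).smallObjectκ)
      (MorphismProperty.smallObjectκ_isRegular (freeMaps σ τ J)).out.aleph0_le
    -- Here the coproducts of the small object argument are traded for single cells, the form the
    -- monoid axiom requires.
    refine transfiniteCompositionsOfShape_pushouts_coproducts_le _
      isomorphisms_le_pushouts_tensorTrivialCofibrations
      (freeMaps σ τ J).smallObjectκ.ord.ToType _ ?_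
    have : PreservesWellOrderContinuousOfShape (freeMaps σ τ J).smallObjectκ.ord.ToType
      (eval σ τ a b) := { }
    have := preservesColimitsOfSize_shrink.{0, v, 0, v} (eval σ τ a b)
    have h₀ : (MorphismProperty.coproducts.{v} (freeMaps σ τ J)).pushouts ≤
        (MorphismProperty.coproducts.{v}
          (tensorTrivialCofibrations V).isoClosure).pushouts.inverseImage (eval σ τ a b) :=
      pushouts_coproducts_le_inverseImage.{_, _, _, _, v} (eval σ τ a b)
        (freeMaps_le_inverseImage J hJ a b)
    have hle := MorphismProperty.transfiniteCompositionsOfShape_monotone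
      (freeMaps σ τ J).smallObjectκ.ord.ToType h₀
    exact MorphismProperty.transfiniteCompositionsOfShape_map_of_preserves _ (eval σ τ a b) f'
      (hle _ hf')
  refine MorphismProperty.transfiniteCompositions_monotone
    (MorphismProperty.pushouts_le_iff.2 ((MorphismProperty.isoClosure_le_iff _ _).2
      (MorphismProperty.le_pushouts _))) _ h₁

omit [SymmetricCategory V] [MonoidalClosed V] [HasColimitsOfSize.{v, v} V] [MonoidalCategory V] in
lemma hasColimitsOfSize_of_isCombinatorial (hcomb : IsCombinatorial V) :
    HasColimitsOfSize.{v, v} V := by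
  have := hcomb.isLocallyPresentable
  obtain ⟨κ, _, _⟩ := IsLocallyPresentable.exists_cardinal V
  infer_instance

variable (σ τ) in
lemma hasFunctorialFactorization_fibrations (hcomb : IsCombinatorial V) :
    (levelwise σ τ (fibrations V)).llp.HasFunctorialFactorization
      (levelwise σ τ (fibrations V)) := by
  have := hcomb.isLocallyPresentable
  obtain ⟨J, _, hJ⟩ := hcomb.exists_generatingTrivialCofibrations
  rw [hJ]
  exact hasFunctorialFactorization_levelwise σ τ J

lemma llp_levelwise_fibrations_le (hcomb : IsCombinatorial V) (hmonoid : MonoidAxiom V) :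
    (levelwise σ τ (fibrations V)).llp ≤ levelwise σ τ (weakEquivalences V) := by
  have := hcomb.isLocallyPresentable
  obtain ⟨J, _, hJ⟩ := hcomb.exists_generatingTrivialCofibrations
  rw [hJ]
  refine llp_levelwise_le_levelwise_weakEquivalences hmonoid J ?_
  -- The generators lift against everything in `J.rlp`, which is the class of fibrations, so they
  -- are trivial cofibrations.
  rw [← fibrations_llp, hJ]
  exact J.le_llp_rlp

end MonoidAxiom

end BiMod

end ModelEnrich

namespace ModelEnrich

/-! ### Right modules over a `V`-category -/

section Modules

variable {V : Type u} [Category.{v} V] [MonoidalCategory V] {A : Type w}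

/-- The category of right modules over a `V`-category. -/
abbrev RMod (τ : VCat V A) := BiMod (VCat.point.{v, u, 0} V) τ

namespace RMod

variable {τ : VCat V A}

/-- The value of a module. -/
abbrev ob (X : RMod τ) (a : A) : V := X.obj a PUnit.unit

/-- The action on a module. -/
abbrev act (X : RMod τ) (a b : A) : X.ob b ⊗ τ.hom a b ⟶ X.ob a := X.ract a b PUnit.unit

/-- The components of a map of modules. -/
abbrev ap {X Y : RMod τ} (f : X ⟶ Y) (a : A) : X.ob a ⟶ Y.ob a := f.app a PUnit.unit

lemma act_assoc (X : RMod τ) (a b c : A) :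
    X.act b c ▷ τ.hom a b ≫ X.act a b =
      (α_ (X.ob c) (τ.hom b c) (τ.hom a b)).hom ≫ X.ob c ◁ τ.comp a b c ≫ X.act a c :=
  X.ract_assoc a b c _

lemma act_unit (X : RMod τ) (a : A) : X.ob a ◁ τ.unit a ≫ X.act a a = (ρ_ (X.ob a)).hom :=
  X.ract_unit a _

lemma act_ap {X Y : RMod τ} (f : X ⟶ Y) (a b : A) :
    X.act a b ≫ ap f a = ap f b ▷ τ.hom a b ≫ Y.act a b :=
  f.ract_app a b _

@[simp]
lemma id_ap (X : RMod τ) (a : A) : ap (𝟙 X) a = 𝟙 (X.ob a) := rfl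

@[simp]
lemma comp_ap {X Y Z : RMod τ} (f : X ⟶ Y) (g : Y ⟶ Z) (a : A) :
    ap (f ≫ g) a = ap f a ≫ ap g a := rfl

/-- Constructor for modules. -/
def ofAct (obj : A → V) (act : ∀ a b, obj b ⊗ τ.hom a b ⟶ obj a)
    (act_assoc : ∀ a b c, act b c ▷ τ.hom a b ≫ act a b =
      (α_ (obj c) (τ.hom b c) (τ.hom a b)).hom ≫ obj c ◁ τ.comp a b c ≫ act a c)
    (act_unit : ∀ a, obj a ◁ τ.unit a ≫ act a a = (ρ_ (obj a)).hom) : RMod τ where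
  obj a _ := obj a
  lact a _ _ := (λ_ (obj a)).hom
  ract a b _ := act a b
  lact_assoc a b c d := by
    change (λ_ (𝟙_ V)).hom ▷ obj a ≫ (λ_ (obj a)).hom =
      (α_ (𝟙_ V) (𝟙_ V) (obj a)).hom ≫ 𝟙_ V ◁ (λ_ (obj a)).hom ≫ (λ_ (obj a)).hom
    monoidal
  unit_lact a b := by
    change 𝟙 (𝟙_ V) ▷ obj a ≫ (λ_ (obj a)).hom = (λ_ (obj a)).hom
    simp
  ract_assoc a b c d := act_assoc a b c
  ract_unit a b := act_unit a
  lact_ract a b c d := by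
    change (λ_ (obj b)).hom ▷ τ.hom a b ≫ act a b =
      (α_ (𝟙_ V) (obj b) (τ.hom a b)).hom ≫ 𝟙_ V ◁ act a b ≫ (λ_ (obj a)).hom
    simp

/-- The unit of the one-object category is the identity of S, so unitality leaves no freedom for the
left action, and a bimodule over the point is just a right module. -/
lemma lact_eq (X : RMod τ) (a : A) (b c : PUnit) :
    X.lact a b c = (λ_ (X.ob a)).hom := by
  have h : 𝟙 (𝟙_ V) ▷ X.ob a ≫ X.lact a PUnit.unit PUnit.unit = (λ_ (X.ob a)).hom :=
    X.unit_lact a PUnit.unit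
  rw [id_whiskerRight] at h
  exact (id_comp _).symm.trans h

/-- Constructor for maps of modules. -/
def homMk {X Y : RMod τ} (app : ∀ a, X.ob a ⟶ Y.ob a)
    (h : ∀ a b, X.act a b ≫ app a = app b ▷ τ.hom a b ≫ Y.act a b) : X ⟶ Y where
  app a _ := app a
  lact_app a b c := by
    rw [lact_eq, lact_eq]
    exact (leftUnitor_naturality (app a)).symm
  ract_app a b _ := h a b

lemma ext_ap {X Y : RMod τ} {f g : X ⟶ Y} (h : ∀ a, ap f a = ap g a) : f = g :=
  BiMod.hom_ext fun a _ ↦ h a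

/-! #### Linear families of maps -/

/-- A family of maps `v ⊗ X(a) ⟶ Y(a)` is linear if it is compatible with the actions. -/
def IsLinear {v : V} {X Y : RMod τ} (f : ∀ a, v ⊗ X.ob a ⟶ Y.ob a) : Prop :=
  ∀ a b, (α_ v (X.ob b) (τ.hom a b)).hom ≫ v ◁ X.act a b ≫ f a = f b ▷ τ.hom a b ≫ Y.act a b

namespace IsLinear

variable {v w : V} {X Y Z : RMod τ} {f : ∀ a, v ⊗ X.ob a ⟶ Y.ob a}

lemma whiskerRight_comp (hf : IsLinear f) (g : w ⟶ v) :
    IsLinear (fun a ↦ g ▷ X.ob a ≫ f a) := fun a b ↦ by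
  dsimp only
  rw [comp_whiskerRight, assoc, ← hf a b, whisker_exchange_assoc,
    associator_naturality_left_assoc]

lemma comp_ap (hf : IsLinear f) (φ : Y ⟶ Z) : IsLinear (fun a ↦ f a ≫ ap φ a) := fun a b ↦ by
  dsimp only
  rw [comp_whiskerRight, assoc, ← act_ap, ← reassoc_of% hf a b]

lemma whiskerLeft_ap_comp (hf : IsLinear f) (φ : Z ⟶ X) :
    IsLinear (fun a ↦ v ◁ ap φ a ≫ f a) := fun a b ↦ by
  dsimp only
  rw [comp_whiskerRight, assoc, ← hf a b, ← whiskerLeft_comp_assoc, act_ap, whiskerLeft_comp_assoc,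
    associator_naturality_middle_assoc]

lemma comp (hf : IsLinear f) {g : ∀ a, w ⊗ Y.ob a ⟶ Z.ob a} (hg : IsLinear g) :
    IsLinear (fun a ↦ (α_ w v (X.ob a)).hom ≫ w ◁ f a ≫ g a) := fun a b ↦ by
  have h₁ := hf a b
  have h₂ := hg a b
  dsimp only
  calc _ = 𝟙 _ ⊗≫ w ◁ ((α_ v (X.ob b) (τ.hom a b)).hom ≫ v ◁ X.act a b ≫ f a) ≫ g a := by
        monoidal
    _ = 𝟙 _ ⊗≫ (w ◁ f b) ▷ τ.hom a b ⊗≫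
          ((α_ w (Y.ob b) (τ.hom a b)).hom ≫ w ◁ Y.act a b ≫ g a) := by
        rw [h₁]
        monoidal
    _ = _ := by
        rw [h₂]
        monoidal

lemma leftUnitor (X : RMod τ) : IsLinear (fun a ↦ (λ_ (X.ob a)).hom) := fun a b ↦ by
  dsimp only
  monoidal

end IsLinear

/-! ### Objects of V representing linear families. -/

section HomObj

variable [BraidedCategory V] [MonoidalClosed V]

/-- Currying of the first variable. -/
def curryLeft {v X Y : V} (f : v ⊗ X ⟶ Y) : v ⟶ (ihom X).obj Y :=
  MonoidalClosed.curry ((β_ X v).hom ≫ f)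

/-- The evaluation map, with the internal hom on the left. -/
def evLeft (X Y : V) : (ihom X).obj Y ⊗ X ⟶ Y :=
  (β_ X _).inv ≫ (ihom.ev X).app Y

lemma whiskerRight_evLeft {v X Y : V} (g : v ⟶ (ihom X).obj Y) :
    g ▷ X ≫ evLeft X Y = (β_ X v).inv ≫ MonoidalClosed.uncurry g := by
  rw [evLeft, MonoidalClosed.uncurry_eq, BraidedCategory.braiding_inv_naturality_left_assoc]

lemma curryLeft_evLeft {v X Y : V} (f : v ⊗ X ⟶ Y) : curryLeft f ▷ X ≫ evLeft X Y = f := by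
  rw [whiskerRight_evLeft, curryLeft, MonoidalClosed.uncurry_curry, Iso.inv_hom_id_assoc]

lemma hom_ext_evLeft {v X Y : V} {g g' : v ⟶ (ihom X).obj Y}
    (h : g ▷ X ≫ evLeft X Y = g' ▷ X ≫ evLeft X Y) : g = g' := by
  rw [whiskerRight_evLeft, whiskerRight_evLeft, cancel_epi] at h
  exact MonoidalClosed.uncurry_injective h

variable [HasLimits V] [Small.{v} A]

omit [BraidedCategory V] [MonoidalClosed V] [MonoidalCategory V] in
lemma exists_product {ι : Type w} [Small.{v} ι] (X : ι → V) :
    ∃ (P : V) (π : ∀ i, P ⟶ X i),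
      (∀ (v : V) (f : ∀ i, v ⟶ X i), ∃ g : v ⟶ P, ∀ i, g ≫ π i = f i) ∧
      ∀ (v : V) (g g' : v ⟶ P), (∀ i, g ≫ π i = g' ≫ π i) → g = g' := by
  have := hasProductsOfShape_of_small.{v} V ι
  exact ⟨∏ᶜ X, Pi.π X, fun v f ↦ ⟨Pi.lift f, fun i ↦ Pi.lift_π f i⟩,
    fun v g g' h ↦ Pi.hom_ext g g' h⟩

-- The product of the internal homs represents arbitrary families; linearity is imposed afterwards
-- by an equalizer.
omit [Small.{v} A] in
lemma exists_homFamily {ι : Type w} [Small.{v} ι] (X Y : ι → V) :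
    ∃ (H : V) (e : ∀ i, H ⊗ X i ⟶ Y i),
      (∀ (v : V) (f : ∀ i, v ⊗ X i ⟶ Y i), ∃ g : v ⟶ H, ∀ i, g ▷ X i ≫ e i = f i) ∧
      ∀ (v : V) (g g' : v ⟶ H), (∀ i, g ▷ X i ≫ e i = g' ▷ X i ≫ e i) → g = g' := by
  obtain ⟨P, π, h₁, h₂⟩ := exists_product fun i ↦ (ihom (X i)).obj (Y i)
  refine ⟨P, fun i ↦ π i ▷ X i ≫ evLeft _ _, fun v f ↦ ?_, fun v g g' h ↦ ?_⟩
  · obtain ⟨g, hg⟩ := h₁ v fun i ↦ curryLeft (f i)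
    exact ⟨g, fun i ↦ by rw [← comp_whiskerRight_assoc, hg, curryLeft_evLeft]⟩
  · refine h₂ v g g' fun i ↦ hom_ext_evLeft ?_
    simpa only [comp_whiskerRight, assoc] using h i

/-- The linear maps between two modules are represented by an object of `V`. -/
lemma exists_homObj (X Y : RMod τ) :
    ∃ (H : V) (e : ∀ a, H ⊗ X.ob a ⟶ Y.ob a), IsLinear e ∧
      (∀ (v : V) (f : ∀ a, v ⊗ X.ob a ⟶ Y.ob a), IsLinear f →
        ∃ g : v ⟶ H, ∀ a, g ▷ X.ob a ≫ e a = f a) ∧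
      ∀ (v : V) (g g' : v ⟶ H),
        (∀ a, g ▷ X.ob a ≫ e a = g' ▷ X.ob a ≫ e a) → g = g' := by
  obtain ⟨P, e, h₁, h₂⟩ := exists_homFamily (fun a ↦ X.ob a) (fun a ↦ Y.ob a)
  obtain ⟨Q, d, h₃, h₄⟩ := exists_homFamily
    (fun p : A × A ↦ X.ob p.2 ⊗ τ.hom p.1 p.2) (fun p ↦ Y.ob p.1)
  -- The maps l and r send a family to its two composites X(b) ⊗ τ(a, b) → Y(a), acting before or
  -- after applying it; the equalizer consists of the linear families.
  obtain ⟨l, hl⟩ := h₃ P fun p ↦ P ◁ X.act p.1 p.2 ≫ e p.1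
  obtain ⟨r, hr⟩ := h₃ P fun p ↦ (α_ _ _ _).inv ≫ e p.2 ▷ τ.hom p.1 p.2 ≫ Y.act p.1 p.2
  have key {v : V} (g : v ⟶ P) : g ≫ l = g ≫ r ↔ IsLinear fun a ↦ g ▷ X.ob a ≫ e a := by
    have h₅ (p : A × A) : (g ≫ l) ▷ (X.ob p.2 ⊗ τ.hom p.1 p.2) ≫ d p =
        v ◁ X.act p.1 p.2 ≫ g ▷ X.ob p.1 ≫ e p.1 := by
      rw [comp_whiskerRight, assoc, hl, whisker_exchange_assoc]
    have h₆ (p : A × A) : (g ≫ r) ▷ (X.ob p.2 ⊗ τ.hom p.1 p.2) ≫ d p =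
        (α_ _ _ _).inv ≫ (g ▷ X.ob p.2 ≫ e p.2) ▷ τ.hom p.1 p.2 ≫ Y.act p.1 p.2 := by
      rw [comp_whiskerRight, assoc, hr, comp_whiskerRight, assoc,
        associator_inv_naturality_left_assoc]
    constructor
    · intro h a b
      rw [← h₅ (a, b), h, h₆ (a, b), Iso.hom_inv_id_assoc]
    · intro h
      refine h₄ _ _ _ fun p ↦ ?_
      rw [h₅, h₆, ← h p.1 p.2, Iso.inv_hom_id_assoc]
  refine ⟨equalizer l r, fun a ↦ equalizer.ι l r ▷ X.ob a ≫ e a,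
    (key _).1 (equalizer.condition l r), fun v f hf ↦ ?_, fun v g g' h ↦ ?_⟩
  · obtain ⟨g, hg⟩ := h₁ v f
    refine ⟨equalizer.lift g ((key g).2 ?_), fun a ↦ ?_⟩
    · simpa only [hg] using hf
    · rw [← comp_whiskerRight_assoc, equalizer.lift_ι, hg]
  · refine equalizer.hom_ext (h₂ _ _ _ fun a ↦ ?_)
    simpa only [comp_whiskerRight, assoc] using h a

/-- The object of linear maps between two modules. -/
noncomputable def HomObj (X Y : RMod τ) : V := (exists_homObj X Y).choose

/-- The evaluation on the object of linear maps. -/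
noncomputable def ev (X Y : RMod τ) (a : A) : HomObj X Y ⊗ X.ob a ⟶ Y.ob a :=
  (exists_homObj X Y).choose_spec.choose a

lemma isLinear_ev (X Y : RMod τ) : IsLinear (ev X Y) :=
  (exists_homObj X Y).choose_spec.choose_spec.1

/-- The map to the object of linear maps determined by a linear family. -/
noncomputable def lift {v : V} {X Y : RMod τ} (f : ∀ a, v ⊗ X.ob a ⟶ Y.ob a) (hf : IsLinear f) :
    v ⟶ HomObj X Y :=
  ((exists_homObj X Y).choose_spec.choose_spec.2.1 v f hf).choose

lemma lift_ev {v : V} {X Y : RMod τ} (f : ∀ a, v ⊗ X.ob a ⟶ Y.ob a) (hf : IsLinear f) (a : A) :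
    lift f hf ▷ X.ob a ≫ ev X Y a = f a :=
  ((exists_homObj X Y).choose_spec.choose_spec.2.1 v f hf).choose_spec a

lemma hom_ext_ev {v : V} {X Y : RMod τ} {g g' : v ⟶ HomObj X Y}
    (h : ∀ a, g ▷ X.ob a ≫ ev X Y a = g' ▷ X.ob a ≫ ev X Y a) : g = g' :=
  (exists_homObj X Y).choose_spec.choose_spec.2.2 v g g' h

end HomObj

end RMod

end Modules

end ModelEnrich

namespace ModelEnrich

namespace RMod

/-! ### The enrichment of the category of modules. -/

section HomEnrichment

variable {V : Type u} [Category.{v} V] [MonoidalCategory V] [BraidedCategory V]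
  [MonoidalClosed V] [HasLimits V] {A : Type w} [Small.{v} A] {τ : VCat V A}

/-- Precomposition on objects of linear maps. -/
noncomputable def homMapLeft {X' X : RMod τ} (φ : X' ⟶ X) (Y : RMod τ) :
    HomObj X Y ⟶ HomObj X' Y :=
  lift _ ((isLinear_ev X Y).whiskerLeft_ap_comp φ)

/-- Postcomposition on objects of linear maps. -/
noncomputable def homMapRight (X : RMod τ) {Y Y' : RMod τ} (ψ : Y ⟶ Y') :
    HomObj X Y ⟶ HomObj X Y' :=
  lift _ ((isLinear_ev X Y).comp_ap ψ)

/-- Composition of objects of linear maps. -/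
noncomputable def homComp (X Y Z : RMod τ) : HomObj Y Z ⊗ HomObj X Y ⟶ HomObj X Z :=
  lift _ ((isLinear_ev X Y).comp (isLinear_ev Y Z))

/-- The unit of the object of linear endomorphisms. -/
noncomputable def homUnit (X : RMod τ) : 𝟙_ V ⟶ HomObj X X :=
  lift _ (IsLinear.leftUnitor X)

lemma homMapLeft_ev {X' X : RMod τ} (φ : X' ⟶ X) (Y : RMod τ) (a : A) :
    homMapLeft φ Y ▷ X'.ob a ≫ ev X' Y a = HomObj X Y ◁ ap φ a ≫ ev X Y a :=
  lift_ev _ _ a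

lemma homMapRight_ev (X : RMod τ) {Y Y' : RMod τ} (ψ : Y ⟶ Y') (a : A) :
    homMapRight X ψ ▷ X.ob a ≫ ev X Y' a = ev X Y a ≫ ap ψ a :=
  lift_ev _ _ a

lemma homComp_ev (X Y Z : RMod τ) (a : A) :
    homComp X Y Z ▷ X.ob a ≫ ev X Z a =
      (α_ _ _ _).hom ≫ HomObj Y Z ◁ ev X Y a ≫ ev Y Z a :=
  lift_ev _ _ a

lemma homUnit_ev (X : RMod τ) (a : A) :
    homUnit X ▷ X.ob a ≫ ev X X a = (λ_ (X.ob a)).hom :=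
  lift_ev _ _ a

variable (τ) in
/-- The enrichment of the category of modules by `V`. -/
noncomputable def homEnrichment : Enrichment (RMod τ) V where
  hom :=
    { obj X :=
        { obj Y := HomObj X.unop Y
          map ψ := homMapRight X.unop ψ
          map_id Y := hom_ext_ev fun a ↦ by rw [homMapRight_ev]; simp
          map_comp ψ ψ' := hom_ext_ev fun a ↦ by
            rw [homMapRight_ev, comp_whiskerRight, assoc, homMapRight_ev,
              ← assoc, homMapRight_ev, assoc, comp_ap] }
      map φ :=
        { app Y := homMapLeft φ.unop Y
          naturality Y Y' ψ := hom_ext_ev fun a ↦ by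
            dsimp only
            rw [comp_whiskerRight, comp_whiskerRight, assoc, assoc, homMapLeft_ev, homMapRight_ev,
              ← whisker_exchange_assoc, homMapRight_ev, ← assoc (homMapLeft _ _ ▷ _),
              homMapLeft_ev, assoc] }
      map_id X := by
        refine NatTrans.ext (funext fun Y ↦ hom_ext_ev fun a ↦ ?_)
        rw [homMapLeft_ev, unop_id, id_ap, NatTrans.id_app]
        simp
      map_comp φ φ' := by
        refine NatTrans.ext (funext fun Y ↦ hom_ext_ev fun a ↦ ?_)
        rw [homMapLeft_ev, NatTrans.comp_app, comp_whiskerRight, assoc, homMapLeft_ev,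
          ← whisker_exchange_assoc, homMapLeft_ev, unop_comp, comp_ap, whiskerLeft_comp_assoc] }
  comp X Y Z := homComp X Y Z
  unit X := homUnit X
  comp_natural_left {X X'} f Y Z := hom_ext_ev fun a ↦ by
    change (HomObj Y Z ◁ homMapLeft f Y ≫ homComp X Y Z) ▷ X.ob a ≫ ev X Z a =
      (homComp X' Y Z ≫ homMapLeft f Z) ▷ X.ob a ≫ ev X Z a
    rw [comp_whiskerRight, comp_whiskerRight, assoc, assoc, homComp_ev, homMapLeft_ev,
      ← whisker_exchange_assoc, homComp_ev, associator_naturality_middle_assoc,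
      ← whiskerLeft_comp_assoc, homMapLeft_ev, associator_naturality_right_assoc,
      whiskerLeft_comp_assoc]
  comp_natural_right X Y {Z Z'} g := hom_ext_ev fun a ↦ by
    change (homMapRight Y g ▷ HomObj X Y ≫ homComp X Y Z') ▷ X.ob a ≫ ev X Z' a =
      (homComp X Y Z ≫ homMapRight X g) ▷ X.ob a ≫ ev X Z' a
    rw [comp_whiskerRight, comp_whiskerRight, assoc, assoc, homComp_ev, homMapRight_ev,
      associator_naturality_left_assoc, ← whisker_exchange_assoc, homMapRight_ev,
      ← assoc (homComp _ _ _ ▷ _), homComp_ev, assoc, assoc]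
  comp_assoc X Y Z W := hom_ext_ev fun a ↦ by
    change (homComp Y Z W ▷ HomObj X Y ≫ homComp X Y W) ▷ X.ob a ≫ ev X W a =
      ((α_ _ _ _).hom ≫ HomObj Z W ◁ homComp X Y Z ≫ homComp X Z W) ▷ X.ob a ≫ ev X W a
    simp only [comp_whiskerRight, assoc, homComp_ev, associator_naturality_left_assoc,
      associator_naturality_middle_assoc, ← whiskerLeft_comp_assoc]
    rw [← whisker_exchange_assoc, homComp_ev]
    simp only [whiskerLeft_comp, assoc]
    monoidal
  unit_comp X Y := hom_ext_ev fun a ↦ by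
    change (homUnit Y ▷ HomObj X Y ≫ homComp X Y Y) ▷ X.ob a ≫ ev X Y a =
      (λ_ (HomObj X Y)).hom ▷ X.ob a ≫ ev X Y a
    rw [comp_whiskerRight, assoc, homComp_ev, associator_naturality_left_assoc,
      ← whisker_exchange_assoc, homUnit_ev]
    simp
  comp_unit X Y := hom_ext_ev fun a ↦ by
    change (HomObj X Y ◁ homUnit X ≫ homComp X X Y) ▷ X.ob a ≫ ev X Y a =
      (ρ_ (HomObj X Y)).hom ▷ X.ob a ≫ ev X Y a
    rw [comp_whiskerRight, assoc, homComp_ev, associator_naturality_middle_assoc,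
      ← whiskerLeft_comp_assoc, homUnit_ev]
    simp
  unit_natural {X Y} f := hom_ext_ev fun a ↦ by
    change (homUnit X ≫ homMapRight X f) ▷ X.ob a ≫ ev X Y a =
      (homUnit Y ≫ homMapLeft f Y) ▷ X.ob a ≫ ev X Y a
    rw [comp_whiskerRight, comp_whiskerRight, assoc, assoc, homMapRight_ev, homMapLeft_ev,
      ← whisker_exchange_assoc, homUnit_ev, ← assoc, homUnit_ev, leftUnitor_naturality]

end HomEnrichment

/-! #### Representable modules -/

section Representable

variable {V : Type u} [Category.{v} V] [MonoidalCategory V] {A : Type w} {τ : VCat V A}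

variable (τ) in
/-- The module represented by an object. -/
def repr (b : A) : RMod τ :=
  ofAct (fun a ↦ τ.hom a b) (fun a a' ↦ τ.comp a a' b) (fun a a' a'' ↦ τ.comp_assoc a a' a'' b)
    (fun a ↦ τ.comp_unit a b)

/-- The map out of `v ⊗ repr b` corresponding to a map out of `v`. -/
def reprFamily {v : V} {b : A} {X : RMod τ} (x : v ⟶ X.ob b) (a : A) :
    v ⊗ τ.hom a b ⟶ X.ob a :=
  x ▷ τ.hom a b ≫ X.act a b

lemma isLinear_reprFamily {v : V} {b : A} {X : RMod τ} (x : v ⟶ X.ob b) :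
    IsLinear (X := repr τ b) (reprFamily x) := fun a a' ↦ by
  change (α_ v (τ.hom a' b) (τ.hom a a')).hom ≫ v ◁ τ.comp a a' b ≫ x ▷ τ.hom a b ≫ X.act a b =
    (x ▷ τ.hom a' b ≫ X.act a' b) ▷ τ.hom a a' ≫ X.act a a'
  rw [whisker_exchange_assoc, ← associator_naturality_left_assoc, comp_whiskerRight, assoc,
    act_assoc]

lemma reprFamily_unit {v : V} {b : A} {X : RMod τ} (x : v ⟶ X.ob b) :
    (ρ_ v).inv ≫ v ◁ τ.unit b ≫ reprFamily x b = x := by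
  rw [reprFamily, whisker_exchange_assoc, act_unit, rightUnitor_naturality, Iso.inv_hom_id_assoc]

/-- The uniqueness half of the Yoneda lemma: linearity determines the family by its value on the
unit of τ(b, b). -/
lemma eq_reprFamily {v : V} {b : A} {X : RMod τ} {f : ∀ a, v ⊗ τ.hom a b ⟶ X.ob a}
    (hf : IsLinear (X := repr τ b) f) (a : A) :
    f a = reprFamily ((ρ_ v).inv ≫ v ◁ τ.unit b ≫ f b) a := by
  have h : (α_ v (τ.hom b b) (τ.hom a b)).hom ≫ v ◁ τ.comp a b b ≫ f a =
    f b ▷ τ.hom a b ≫ X.act a b := hf a b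
  rw [reprFamily, comp_whiskerRight, comp_whiskerRight, assoc, assoc, ← h,
    associator_naturality_middle_assoc, ← whiskerLeft_comp_assoc, τ.unit_comp]
  simp

end Representable

end RMod

end ModelEnrich

namespace ModelEnrich

/-! ### Lifting properties for modules -/

section PushoutProduct

variable {V : Type u} [Category.{v} V] [MonoidalCategory V] [ModelCategory V]
  [IsMonoidalModelCategory V]

/-- Lifting against a pushout-product of a cofibration and a trivial cofibration, expressed in
elementary terms. -/
lemma exists_lift_pushoutProduct {K L S T X Y : V} (i : K ⟶ L) [Cofibration i] (j : S ⟶ T)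
    [Cofibration j] [WeakEquivalence j] (p : X ⟶ Y) [Fibration p]
    (m : L ⊗ S ⟶ X) (k : K ⊗ T ⟶ X) (l : L ⊗ T ⟶ Y)
    (h₁ : i ▷ S ≫ m = K ◁ j ≫ k) (h₂ : m ≫ p = L ◁ j ≫ l) (h₃ : k ≫ p = i ▷ T ≫ l) :
    ∃ h : L ⊗ T ⟶ X, L ◁ j ≫ h = m ∧ i ▷ T ≫ h = k ∧ h ≫ p = l := by
  let po := Functor.PushoutObjObj.ofHasPushout (curriedTensor V) i j
  have : Cofibration po.ι := IsMonoidalModelCategory.cofibration_pushoutProduct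
    (Arrow.mk i) (Arrow.mk j) ‹_› ‹_›
  have : WeakEquivalence po.ι := IsMonoidalModelCategory.weakEquivalence_pushoutProduct
    (Arrow.mk i) (Arrow.mk j) ‹_› ‹_› (Or.inr ‹_›)
  have sq : CommSq (po.isPushout.desc m k h₁) po.ι p l := ⟨by
    apply po.isPushout.hom_ext
    · rw [po.isPushout.inl_desc_assoc, po.inl_ι_assoc]
      exact h₂
    · rw [po.isPushout.inr_desc_assoc, po.inr_ι_assoc]
      exact h₃⟩
  refine ⟨sq.lift, ?_, ?_, sq.fac_right⟩
  · have := po.inl ≫= sq.fac_left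
    rwa [po.isPushout.inl_desc, po.inl_ι_assoc] at this
  · have := po.inr ≫= sq.fac_left
    rwa [po.isPushout.inr_desc, po.inr_ι_assoc] at this

/-- The pullback-corner map of a cofibration and a fibration is a fibration; here the internal homs
are given by their universal properties. -/
lemma fibration_corner {K L X Y KX KY LX LY W : V} (i : K ⟶ L) [Cofibration i]
    (p : X ⟶ Y) [Fibration p]
    {eKX : K ⊗ KX ⟶ X} {eKY : K ⊗ KY ⟶ Y} {eLX : L ⊗ LX ⟶ X} {eLY : L ⊗ LY ⟶ Y}
    (hKX : ∀ Z, Function.Bijective (fun g : Z ⟶ KX ↦ K ◁ g ≫ eKX))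
    (hLX : ∀ Z, Function.Bijective (fun g : Z ⟶ LX ↦ L ◁ g ≫ eLX))
    (hLY : ∀ Z, Function.Bijective (fun g : Z ⟶ LY ↦ L ◁ g ≫ eLY))
    {f₁ : KX ⟶ KY} {f₂ : LY ⟶ KY} (hf₁ : K ◁ f₁ ≫ eKY = eKX ≫ p)
    (hf₂ : K ◁ f₂ ≫ eKY = i ▷ LY ≫ eLY) {fst : W ⟶ KX} {snd : W ⟶ LY}
    (hW : IsPullback fst snd f₁ f₂) (q : LX ⟶ W)
    (hq₁ : K ◁ (q ≫ fst) ≫ eKX = i ▷ LX ≫ eLX) (hq₂ : L ◁ (q ≫ snd) ≫ eLY = eLX ≫ p) :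
    Fibration q := by
  rw [fibration_iff, ← trivialCofibrations_rlp]
  intro S T j hj
  obtain ⟨_, _⟩ := (mem_trivialCofibrations_iff j).1 hj
  constructor
  intro s t sq
  -- Transposed along the universal properties of the internal homs, a square from j to q is a
  -- square from the pushout-product of i and j to p.
  obtain ⟨h, h₁, h₂, h₃⟩ := exists_lift_pushoutProduct i j p (L ◁ s ≫ eLX)
    (K ◁ (t ≫ fst) ≫ eKX) (L ◁ (t ≫ snd) ≫ eLY)
    (by
      rw [← whisker_exchange_assoc, ← hq₁, ← whiskerLeft_comp_assoc, ← whiskerLeft_comp_assoc,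
        ← assoc s, sq.w, assoc])
    (by
      rw [assoc, ← hq₂, ← whiskerLeft_comp_assoc, ← whiskerLeft_comp_assoc, ← assoc s, sq.w,
        assoc])
    (by
      rw [assoc, ← hf₁, ← whiskerLeft_comp_assoc, assoc, hW.w, ← assoc, whiskerLeft_comp_assoc,
        hf₂, whisker_exchange_assoc])
  obtain ⟨d, hd⟩ := (hLX T).2 h
  dsimp only at hd
  refine ⟨⟨⟨d, (hLX S).1 ?_, hW.hom_ext ((hKX T).1 ?_) ((hLY T).1 ?_)⟩⟩⟩
  · dsimp only
    rw [whiskerLeft_comp_assoc, hd, h₁]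
  · dsimp only
    rw [assoc, whiskerLeft_comp_assoc, hq₁, whisker_exchange_assoc, hd, h₂]
  · dsimp only
    rw [assoc, whiskerLeft_comp_assoc, hq₂, reassoc_of% hd, h₃]

end PushoutProduct

/-! ### Levelwise pullbacks and the terminal bimodule. -/

namespace BiMod

variable {V : Type u} [Category.{v} V] [MonoidalCategory V] {A : Type w} {B : Type w'}
  {σ : VCat V B} {τ : VCat V A}

lemma exists_pullback [HasPullbacks V] {X Y Z : BiMod σ τ} (f : X ⟶ Z) (g : Y ⟶ Z) :
    ∃ (P : BiMod σ τ) (fst : P ⟶ X) (snd : P ⟶ Y),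
      ∀ a b, IsPullback (fst.app a b) (snd.app a b) (f.app a b) (g.app a b) := by
  have h₀ (a : A) (b : B) : ∃ (P : V) (fst : P ⟶ X.obj a b) (snd : P ⟶ Y.obj a b),
      IsPullback fst snd (f.app a b) (g.app a b) := ⟨_, _, _, IsPullback.of_hasPullback _ _⟩
  choose P fst snd h using h₀
  have hl (a : A) (b c : B) : ∃ l : σ.hom b c ⊗ P a b ⟶ P a c,
      l ≫ fst a c = σ.hom b c ◁ fst a b ≫ X.lact a b c ∧
      l ≫ snd a c = σ.hom b c ◁ snd a b ≫ Y.lact a b c := by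
    refine ⟨(h a c).lift _ _ ?_, (h a c).lift_fst _ _ _, (h a c).lift_snd _ _ _⟩
    rw [assoc, assoc, f.lact_app, g.lact_app, ← whiskerLeft_comp_assoc, ← whiskerLeft_comp_assoc,
      (h a b).w]
  have hr (a b : A) (c : B) : ∃ r : P b c ⊗ τ.hom a b ⟶ P a c,
      r ≫ fst a c = fst b c ▷ τ.hom a b ≫ X.ract a b c ∧
      r ≫ snd a c = snd b c ▷ τ.hom a b ≫ Y.ract a b c := by
    refine ⟨(h a c).lift _ _ ?_, (h a c).lift_fst _ _ _, (h a c).lift_snd _ _ _⟩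
    rw [assoc, assoc, f.ract_app, g.ract_app, ← comp_whiskerRight_assoc,
      ← comp_whiskerRight_assoc, (h b c).w]
  choose l hl₁ hl₂ using hl
  choose r hr₁ hr₂ using hr
  let Q : BiMod σ τ :=
    { obj := P
      lact := l
      ract := r
      lact_assoc a b c d := (h a d).hom_ext
        (by
          simp only [assoc, hl₁, ← whiskerLeft_comp_assoc, ← whisker_exchange_assoc]
          simp only [whiskerLeft_comp, assoc, X.lact_assoc,
            associator_naturality_right_assoc])
        (by
          simp only [assoc, hl₂, ← whiskerLeft_comp_assoc, ← whisker_exchange_assoc]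
          simp only [whiskerLeft_comp, assoc, Y.lact_assoc,
            associator_naturality_right_assoc])
      unit_lact a b := (h a b).hom_ext
        (by simp [hl₁, ← whisker_exchange_assoc])
        (by simp [hl₂, ← whisker_exchange_assoc])
      ract_assoc a b c d := (h a d).hom_ext
        (by
          simp only [assoc, hr₁, ← comp_whiskerRight_assoc, whisker_exchange_assoc]
          simp only [comp_whiskerRight, assoc, X.ract_assoc,
            associator_naturality_left_assoc])
        (by
          simp only [assoc, hr₂, ← comp_whiskerRight_assoc, whisker_exchange_assoc]
          simp only [comp_whiskerRight, assoc, Y.ract_assoc,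
            associator_naturality_left_assoc])
      ract_unit a b := (h a b).hom_ext
        (by simp [hr₁, whisker_exchange_assoc])
        (by simp [hr₂, whisker_exchange_assoc])
      lact_ract a b c d := (h a d).hom_ext
        (by
          simp only [assoc, hr₁, hl₁, ← comp_whiskerRight_assoc, ← whiskerLeft_comp_assoc]
          simp only [whiskerLeft_comp, comp_whiskerRight, assoc, X.lact_ract,
            associator_naturality_middle_assoc])
        (by
          simp only [assoc, hr₂, hl₂, ← comp_whiskerRight_assoc, ← whiskerLeft_comp_assoc]
          simp only [whiskerLeft_comp, comp_whiskerRight, assoc, Y.lact_ract,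
            associator_naturality_middle_assoc]) }
  exact ⟨Q, { app := fst, lact_app := hl₁, ract_app := hr₁ },
    { app := snd, lact_app := hl₂, ract_app := hr₂ }, h⟩

lemma exists_lift_of_isPullback {P X Y Z T : BiMod σ τ} {fst : P ⟶ X} {snd : P ⟶ Y} {f : X ⟶ Z}
    {g : Y ⟶ Z} (h : ∀ a b, IsPullback (fst.app a b) (snd.app a b) (f.app a b) (g.app a b))
    (s : T ⟶ X) (t : T ⟶ Y) (w : s ≫ f = t ≫ g) : ∃ l : T ⟶ P, l ≫ fst = s ∧ l ≫ snd = t := by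
  have w' (a : A) (b : B) : s.app a b ≫ f.app a b = t.app a b ≫ g.app a b :=
    congrArg (fun φ ↦ Hom.app φ a b) w
  let l (a : A) (b : B) := (h a b).lift _ _ (w' a b)
  have h₁ (a : A) (b : B) : l a b ≫ fst.app a b = s.app a b := (h a b).lift_fst _ _ _
  have h₂ (a : A) (b : B) : l a b ≫ snd.app a b = t.app a b := (h a b).lift_snd _ _ _
  refine ⟨{ app := l, lact_app a b c := (h a c).hom_ext ?_ ?_,
            ract_app a b c := (h a c).hom_ext ?_ ?_ }, hom_ext h₁, hom_ext h₂⟩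
  · rw [assoc, assoc, h₁, fst.lact_app, s.lact_app, ← whiskerLeft_comp_assoc, h₁]
  · rw [assoc, assoc, h₂, snd.lact_app, t.lact_app, ← whiskerLeft_comp_assoc, h₂]
  · rw [assoc, assoc, h₁, fst.ract_app, s.ract_app, ← comp_whiskerRight_assoc, h₁]
  · rw [assoc, assoc, h₂, snd.ract_app, t.ract_app, ← comp_whiskerRight_assoc, h₂]

variable (σ τ) in
/-- The terminal bimodule. -/
noncomputable def terminalObj [HasTerminal V] : BiMod σ τ where
  obj _ _ := ⊤_ V
  lact _ _ _ := terminal.from _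
  ract _ _ _ := terminal.from _
  lact_assoc _ _ _ _ := Subsingleton.elim _ _
  unit_lact _ _ := Subsingleton.elim _ _
  ract_assoc _ _ _ _ := Subsingleton.elim _ _
  ract_unit _ _ := Subsingleton.elim _ _
  lact_ract _ _ _ _ := Subsingleton.elim _ _

/-- The map to the terminal bimodule. -/
noncomputable def toTerminal [HasTerminal V] (X : BiMod σ τ) : X ⟶ terminalObj σ τ where
  app _ _ := terminal.from _
  lact_app _ _ _ := terminal.hom_ext _ _
  ract_app _ _ _ := terminal.hom_ext _ _

end BiMod

end ModelEnrich

namespace ModelEnrich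

namespace RMod

/-! #### Cotensors -/

section Cotensor

variable {V : Type u} [Category.{v} V] [MonoidalCategory V] {A : Type w} {τ : VCat V A}

/-- A cotensor of a module by an object of `V`. -/
structure Cotensor (v : V) (X : RMod τ) where
  pt : RMod τ
  e (a : A) : v ⊗ pt.ob a ⟶ X.ob a
  isLinear_e : IsLinear e
  bijective (a : A) (Z : V) : Function.Bijective (fun g : Z ⟶ pt.ob a ↦ v ◁ g ≫ e a)

/-- The internal hom is taken levelwise and the action is the transpose of evaluating and then
acting. Axioms are tested after evaluation, which is injective on maps. -/
instance [MonoidalClosed V] (v : V) (X : RMod τ) : Nonempty (Cotensor v X) := by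
  have h (a : A) : ∃ (H : V) (e : v ⊗ H ⟶ X.ob a),
      ∀ Z, Function.Bijective (fun g : Z ⟶ H ↦ v ◁ g ≫ e) := by
    refine ⟨(ihom v).obj (X.ob a), (ihom.ev v).app _, fun Z ↦ ?_⟩
    have : (fun g : Z ⟶ (ihom v).obj (X.ob a) ↦ v ◁ g ≫ (ihom.ev v).app _) =
        ((ihom.adjunction v).homEquiv Z (X.ob a)).symm := by
      funext g
      rw [MonoidalClosed.homEquiv_symm_apply_eq, MonoidalClosed.uncurry_eq]
    rw [this]
    exact Equiv.bijective _
  choose H e he using h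
  have hact (a b : A) : ∃ r : H b ⊗ τ.hom a b ⟶ H a,
      v ◁ r ≫ e a = (α_ _ _ _).inv ≫ e b ▷ τ.hom a b ≫ X.act a b := (he a _).2 _
  choose r hr using hact
  refine ⟨⟨ofAct H r (fun a b c ↦ (he a _).1 ?_) (fun a ↦ (he a _).1 ?_), e, fun a b ↦ ?_, he⟩⟩
  · dsimp only
    rw [whiskerLeft_comp_assoc, hr]
    calc _ = 𝟙 _ ⊗≫ (v ◁ r b c ≫ e b) ▷ τ.hom a b ≫ X.act a b := by monoidal
      _ = 𝟙 _ ⊗≫ (e c ▷ τ.hom b c) ▷ τ.hom a b ≫ X.act b c ▷ τ.hom a b ≫ X.act a b := by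
        rw [hr]
        monoidal
      _ = 𝟙 _ ⊗≫ (e c ▷ (τ.hom b c ⊗ τ.hom a b) ≫ X.ob c ◁ τ.comp a b c) ≫ X.act a c := by
        rw [act_assoc]
        monoidal
      _ = 𝟙 _ ⊗≫ v ◁ H c ◁ τ.comp a b c ≫ (α_ _ _ _).inv ≫ e c ▷ τ.hom a c ≫ X.act a c := by
        rw [← whisker_exchange]
        monoidal
      _ = _ := by
        rw [← hr]
        monoidal
  · dsimp only
    rw [whiskerLeft_comp_assoc, hr]
    calc _ = 𝟙 _ ⊗≫ ((v ⊗ H a) ◁ τ.unit a ≫ e a ▷ τ.hom a a) ≫ X.act a a := by monoidal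
      _ = 𝟙 _ ⊗≫ e a ▷ 𝟙_ V ≫ X.ob a ◁ τ.unit a ≫ X.act a a := by
        rw [whisker_exchange]
        monoidal
      _ = _ := by
        rw [act_unit]
        monoidal
  · change (α_ _ _ _).hom ≫ v ◁ r a b ≫ e a = e b ▷ τ.hom a b ≫ X.act a b
    rw [hr, Iso.hom_inv_id_assoc]

namespace Cotensor

variable {v : V} {X : RMod τ}

/-- The levelwise transposes of a linear family commute with the actions, again by injectivity of
transposition, so module maps to the cotensor correspond to linear families. -/
lemma exists_hom (C : Cotensor v X) {N : RMod τ} {f : ∀ a, v ⊗ N.ob a ⟶ X.ob a}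
    (hf : IsLinear f) : ∃ g : N ⟶ C.pt, ∀ a, v ◁ ap g a ≫ C.e a = f a := by
  choose g hg using fun a ↦ (C.bijective a _).2 (f a)
  dsimp only at hg
  refine ⟨homMk g fun a b ↦ (C.bijective a _).1 ?_, hg⟩
  dsimp only
  rw [whiskerLeft_comp_assoc, hg, whiskerLeft_comp_assoc, ← cancel_epi (α_ _ _ _).hom,
    hf a b, ← associator_naturality_middle_assoc, C.isLinear_e a b, ← comp_whiskerRight_assoc, hg]

lemma hom_ext (C : Cotensor v X) {N : RMod τ} {g g' : N ⟶ C.pt}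
    (h : ∀ a, v ◁ ap g a ≫ C.e a = v ◁ ap g' a ≫ C.e a) : g = g' :=
  ext_ap fun a ↦ (C.bijective a _).1 (h a)

end Cotensor

end Cotensor

/-! #### Lifting properties -/

section Lifting

variable {V : Type u} [Category.{v} V] [MonoidalCategory V] [MonoidalClosed V] [ModelCategory V]
  [IsMonoidalModelCategory V] {A : Type w} {τ : VCat V A}

-- The enriched lifting property. The three families form a square of modules from f to the corner
-- map X^L → X^K ×_{Y^K} Y^L, which is a levelwise fibration by the pushout-product axiom; f lifts
-- against it and the lift transposes back.
open BiMod in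
lemma exists_corner_lift {N₀ N X Y : RMod τ} (f : N₀ ⟶ N)
    (hf : (levelwise (VCat.point V) τ (fibrations V)).llp f) (p : X ⟶ Y)
    (hp : levelwise (VCat.point V) τ (fibrations V) p) {K L : V} (i : K ⟶ L) [Cofibration i]
    {m : ∀ a, L ⊗ N₀.ob a ⟶ X.ob a} (hm : IsLinear m)
    {k : ∀ a, K ⊗ N.ob a ⟶ X.ob a} (hk : IsLinear k)
    {l : ∀ a, L ⊗ N.ob a ⟶ Y.ob a} (hl : IsLinear l)
    (h₁ : ∀ a, i ▷ N₀.ob a ≫ m a = K ◁ ap f a ≫ k a)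
    (h₂ : ∀ a, m a ≫ ap p a = L ◁ ap f a ≫ l a)
    (h₃ : ∀ a, k a ≫ ap p a = i ▷ N.ob a ≫ l a) :
    ∃ h : ∀ a, L ⊗ N.ob a ⟶ X.ob a, IsLinear h ∧ (∀ a, L ◁ ap f a ≫ h a = m a) ∧
      (∀ a, i ▷ N.ob a ≫ h a = k a) ∧ ∀ a, h a ≫ ap p a = l a := by
  obtain ⟨KX⟩ : Nonempty (Cotensor K X) := inferInstance
  obtain ⟨KY⟩ : Nonempty (Cotensor K Y) := inferInstance
  obtain ⟨LX⟩ : Nonempty (Cotensor L X) := inferInstance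
  obtain ⟨LY⟩ : Nonempty (Cotensor L Y) := inferInstance
  obtain ⟨f₁, hf₁⟩ := KY.exists_hom (KX.isLinear_e.comp_ap p)
  obtain ⟨f₂, hf₂⟩ := KY.exists_hom (LY.isLinear_e.whiskerRight_comp i)
  obtain ⟨g₁, hg₁⟩ := KX.exists_hom (LX.isLinear_e.whiskerRight_comp i)
  obtain ⟨g₂, hg₂⟩ := LY.exists_hom (LX.isLinear_e.comp_ap p)
  obtain ⟨W, fst, snd, hW⟩ := exists_pullback f₁ f₂
  obtain ⟨q, hq₁, hq₂⟩ := exists_lift_of_isPullback hW g₁ g₂ (KY.hom_ext fun a ↦ by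
    rw [comp_ap, whiskerLeft_comp_assoc, hf₁, reassoc_of% hg₁, comp_ap, whiskerLeft_comp_assoc,
      hf₂, whisker_exchange_assoc, hg₂])
  have hq : levelwise (VCat.point V) τ (fibrations V) q := fun a b ↦ by
    have := (fibration_iff _).2 (hp a b)
    exact (fibration_iff _).1 (fibration_corner i (ap p a) (KX.bijective a) (LX.bijective a)
      (LY.bijective a) (hf₁ a) (hf₂ a) (hW a b) (ap q a)
      (by
        change K ◁ ap (q ≫ fst) a ≫ KX.e a = _
        rw [hq₁, hg₁])
      (by
        change L ◁ ap (q ≫ snd) a ≫ LY.e a = _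
        rw [hq₂, hg₂]))
  obtain ⟨m', hm'⟩ := LX.exists_hom hm
  obtain ⟨k', hk'⟩ := KX.exists_hom hk
  obtain ⟨l', hl'⟩ := LY.exists_hom hl
  obtain ⟨t, ht₁, ht₂⟩ := exists_lift_of_isPullback hW k' l' (KY.hom_ext fun a ↦ by
    rw [comp_ap, whiskerLeft_comp_assoc, hf₁, reassoc_of% hk', comp_ap, whiskerLeft_comp_assoc,
      hf₂, whisker_exchange_assoc, hl', h₃])
  have sq : CommSq m' f q t := ⟨hom_ext fun a b ↦ (hW a b).hom_ext
    (by
      change ap ((m' ≫ q) ≫ fst) a = ap ((f ≫ t) ≫ fst) a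
      refine congrArg (fun φ ↦ ap φ a) ?_
      rw [assoc, assoc, hq₁, ht₁]
      refine KX.hom_ext fun a ↦ ?_
      rw [comp_ap, comp_ap, whiskerLeft_comp_assoc, whiskerLeft_comp_assoc, hg₁, hk',
        whisker_exchange_assoc, hm', h₁])
    (by
      change ap ((m' ≫ q) ≫ snd) a = ap ((f ≫ t) ≫ snd) a
      refine congrArg (fun φ ↦ ap φ a) ?_
      rw [assoc, assoc, hq₂, ht₂]
      refine LY.hom_ext fun a ↦ ?_
      rw [comp_ap, comp_ap, whiskerLeft_comp_assoc, whiskerLeft_comp_assoc, hg₂, hl',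
        reassoc_of% hm', h₂])⟩
  have := hf q hq
  refine ⟨fun a ↦ L ◁ ap sq.lift a ≫ LX.e a, LX.isLinear_e.whiskerLeft_ap_comp sq.lift,
    fun a ↦ ?_, fun a ↦ ?_, fun a ↦ ?_⟩
  · rw [← whiskerLeft_comp_assoc, ← comp_ap, sq.fac_left, hm']
  · rw [← whisker_exchange_assoc, ← hg₁, ← whiskerLeft_comp_assoc, ← comp_ap, ← hq₁,
      sq.fac_right_assoc, ht₁, hk']
  · rw [assoc, ← hg₂, ← whiskerLeft_comp_assoc, ← comp_ap, ← hq₂, sq.fac_right_assoc, ht₂, hl']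

variable [BraidedCategory V] [HasLimits V] [Small.{v} A]

open BiMod in
/-- Precomposition with a map with the left lifting property with respect to levelwise fibrations
is a trivial fibration on the objects of maps to a levelwise fibrant module. -/
lemma trivialFibrations_homMapLeft {N₀ N : RMod τ} (f : N₀ ⟶ N)
    (hf : (levelwise (VCat.point V) τ (fibrations V)).llp f) (P : RMod τ)
    (hP : ∀ a, IsFibrant (P.ob a)) : trivialFibrations V (homMapLeft f P) := by
  rw [← cofibrations_rlp]
  intro K L i hi
  have : Cofibration i := (cofibration_iff i).2 hi
  constructor
  intro s t sq
  -- Fibrancy of P makes its map to the terminal module a levelwise fibration, and all conditions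
  -- over the terminal module are vacuous.
  obtain ⟨h, hlin, h₁, h₂, -⟩ := exists_corner_lift f hf (toTerminal P)
    (fun a b ↦ (fibration_iff _).1 (hP a)) i
    ((isLinear_ev N₀ P).whiskerRight_comp t) ((isLinear_ev N P).whiskerRight_comp s)
    (l := fun a ↦ terminal.from _) (fun a b ↦ Subsingleton.elim (α := _ ⟶ ⊤_ V) _ _)
    (fun a ↦ by
      rw [← comp_whiskerRight_assoc, ← sq.w, comp_whiskerRight_assoc, homMapLeft_ev,
        whisker_exchange_assoc])
    (fun a ↦ Subsingleton.elim (α := _ ⟶ ⊤_ V) _ _)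
    (fun a ↦ Subsingleton.elim (α := _ ⟶ ⊤_ V) _ _)
  refine ⟨⟨⟨lift h hlin, hom_ext_ev fun a ↦ ?_, hom_ext_ev fun a ↦ ?_⟩⟩⟩
  · rw [comp_whiskerRight_assoc, lift_ev, h₂]
  · rw [comp_whiskerRight_assoc, homMapLeft_ev, ← whisker_exchange_assoc, lift_ev, h₁]

open BiMod in
/-- Postcomposition with a levelwise trivial fibration is a trivial fibration on the objects of maps
out of a module that is obtained from a representable module by a map with the left lifting
property with respect to levelwise fibrations. -/
lemma trivialFibrations_homMapRight {b : A} {N : RMod τ} (f : repr τ b ⟶ N)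
    (hf : (levelwise (VCat.point V) τ (fibrations V)).llp f) {X Y : RMod τ} (p : X ⟶ Y)
    (hp : ∀ a, trivialFibrations V (ap p a)) : trivialFibrations V (homMapRight N p) := by
  rw [← cofibrations_rlp]
  intro K L i hi
  have : Cofibration i := (cofibration_iff i).2 hi
  obtain ⟨_, _⟩ := (mem_trivialFibrations_iff _).1 (hp b)
  constructor
  intro s t sq
  let kf (a : A) : K ⊗ τ.hom a b ⟶ X.ob a := K ◁ ap f a ≫ s ▷ N.ob a ≫ ev N X a
  let lf (a : A) : L ⊗ τ.hom a b ⟶ Y.ob a := L ◁ ap f a ≫ t ▷ N.ob a ≫ ev N Y a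
  have hst (a : A) : s ▷ N.ob a ≫ ev N X a ≫ ap p a = i ▷ N.ob a ≫ t ▷ N.ob a ≫ ev N Y a := by
    rw [← homMapRight_ev, ← comp_whiskerRight_assoc, sq.w, comp_whiskerRight_assoc]
  have hkf : IsLinear (X := repr τ b) kf :=
    ((isLinear_ev N X).whiskerRight_comp s).whiskerLeft_ap_comp f
  have hlf : IsLinear (X := repr τ b) lf :=
    ((isLinear_ev N Y).whiskerRight_comp t).whiskerLeft_ap_comp f
  have hkl (a : A) : kf a ≫ ap p a = i ▷ τ.hom a b ≫ lf a := by
    have := whisker_exchange_assoc i (ap f a) (t ▷ N.ob a ≫ ev N Y a)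
    exact (assoc _ _ _).trans ((congrArg (K ◁ ap f a ≫ ·) ((assoc _ _ _).trans (hst a))).trans
      this)
  -- Restricted along f to the representable module, the lifting problem becomes by Yoneda one for i
  -- against p at b, a trivial fibration.
  have sq' : CommSq ((ρ_ K).inv ≫ K ◁ τ.unit b ≫ kf b) i (ap p b)
      ((ρ_ L).inv ≫ L ◁ τ.unit b ≫ lf b) := ⟨by
    rw [assoc, assoc, hkl, whisker_exchange_assoc, rightUnitor_inv_naturality_assoc]⟩
  -- The solution over the representable is now extended along f, relative to K and over Y.
  obtain ⟨h, hlin, -, h₂, h₃⟩ := exists_corner_lift f hf p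
    (fun a c ↦ ((mem_trivialFibrations_iff _).1 (hp a)).1.mem) i
    (m := reprFamily sq'.lift) (isLinear_reprFamily sq'.lift)
    ((isLinear_ev N X).whiskerRight_comp s) ((isLinear_ev N Y).whiskerRight_comp t)
    (fun a ↦ by
      refine Eq.trans ?_ (eq_reprFamily hkf a).symm
      change i ▷ τ.hom a b ≫ sq'.lift ▷ τ.hom a b ≫ X.act a b = _
      rw [← comp_whiskerRight_assoc, sq'.fac_left]
      rfl)
    (fun a ↦ by
      refine Eq.trans ?_ (eq_reprFamily hlf a).symm
      change (sq'.lift ▷ τ.hom a b ≫ X.act a b) ≫ ap p a = _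
      rw [assoc, act_ap, ← comp_whiskerRight_assoc, sq'.fac_right]
      rfl)
    (fun a ↦ by rw [assoc, hst])
  refine ⟨⟨⟨lift h hlin, hom_ext_ev fun a ↦ ?_, hom_ext_ev fun a ↦ ?_⟩⟩⟩
  · rw [comp_whiskerRight_assoc, lift_ev, h₂]
  · rw [comp_whiskerRight_assoc, homMapRight_ev, ← assoc, lift_ev, h₃]

end Lifting

/-! #### The Yoneda lemma -/

section Yoneda

variable {V : Type u} [Category.{v} V] [MonoidalCategory V] [MonoidalClosed V]
  [BraidedCategory V] [HasLimits V] {A : Type w} [Small.{v} A] {τ : VCat V A}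

/-- Evaluation of a map out of a representable module at the unit. -/
noncomputable def evalUnit (b : A) (X : RMod τ) : HomObj (repr τ b) X ⟶ X.ob b :=
  (ρ_ _).inv ≫ _ ◁ τ.unit b ≫ (show HomObj (repr τ b) X ⊗ τ.hom b b ⟶ _ from ev (repr τ b) X b)

lemma comp_evalUnit {v : V} {b : A} {X : RMod τ} (g : v ⟶ HomObj (repr τ b) X)
    {f : v ⊗ τ.hom b b ⟶ X.ob b} (hf : g ▷ τ.hom b b ≫ ev (repr τ b) X b = f) :
    g ≫ evalUnit b X = (ρ_ v).inv ≫ v ◁ τ.unit b ≫ f := by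
  subst hf
  rw [evalUnit, rightUnitor_inv_naturality_assoc, ← whisker_exchange_assoc]

instance (b : A) (X : RMod τ) : IsIso (evalUnit b X) := by
  let inv : X.ob b ⟶ HomObj (repr τ b) X :=
    lift (reprFamily (𝟙 _)) (isLinear_reprFamily (𝟙 (X.ob b)))
  let e (a : A) : HomObj (repr τ b) X ⊗ τ.hom a b ⟶ X.ob a := ev (repr τ b) X a
  have h (a : A) : inv ▷ τ.hom a b ≫ e a = reprFamily (𝟙 _) a := lift_ev _ _ a
  refine ⟨inv, hom_ext_ev fun a ↦ ?_, ?_⟩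
  · change (evalUnit b X ≫ inv) ▷ τ.hom a b ≫ e a = 𝟙 (HomObj (repr τ b) X) ▷ τ.hom a b ≫ e a
    rw [comp_whiskerRight_assoc, h, id_whiskerRight, id_comp, reprFamily, id_whiskerRight, id_comp]
    exact (eq_reprFamily (isLinear_ev (repr τ b) X) a).symm
  · rw [comp_evalUnit inv (h b), reprFamily_unit]

end Yoneda

end RMod

end ModelEnrich

namespace ModelEnrich

/-! ### Fiber products of enrichments -/

section FiberProduct

variable {C : Type u₁} [Category.{v₁} C] {V : Type u} [Category.{v} V] [MonoidalCategory V]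

namespace Enrichment

variable (E : Enrichment C V)

lemma elt_comp_mapRight (a : C) {b b' : C} (f : b ⟶ b') :
    E.elt f ▷ E.obj a b ≫ E.comp a b b' = (λ_ _).hom ≫ E.mapRight a f := by
  rw [elt, comp_whiskerRight, assoc, E.comp_natural_right, ← assoc, E.unit_comp]

lemma elt_eq {a b : C} (f : a ⟶ b) : E.elt f = E.unit b ≫ E.mapLeft f b :=
  E.unit_natural f

lemma elt_comp_mapLeft {b b' : C} (f : b ⟶ b') (c : C) :
    E.obj b' c ◁ E.elt f ≫ E.comp b b' c = (ρ_ _).hom ≫ E.mapLeft f c := by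
  rw [elt_eq, whiskerLeft_comp, assoc, E.comp_natural_left, ← assoc, E.comp_unit]

lemma elt_id (a : C) : E.elt (𝟙 a) = E.unit a := by
  rw [elt, mapRight, CategoryTheory.Functor.map_id, comp_id]

lemma elt_comp {a b c : C} (f : a ⟶ b) (g : b ⟶ c) :
    E.elt (f ≫ g) = E.elt f ≫ (λ_ _).inv ≫ E.elt g ▷ E.obj a b ≫ E.comp a b c := by
  rw [elt_comp_mapRight, Iso.inv_hom_id_assoc, elt, elt, assoc, mapRight, mapRight, mapRight,
    ← CategoryTheory.Functor.map_comp]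

/-- Dinaturality in the middle variable: both functorial actions are composition with `E.elt f`, so
this is associativity. -/
lemma mapRight_comp_eq_mapLeft_comp (a : C) {b b' : C} (f : b ⟶ b') (c : C) :
    E.obj b' c ◁ E.mapRight a f ≫ E.comp a b' c = E.mapLeft f c ▷ E.obj a b ≫ E.comp a b c := by
  have h₁ : E.mapRight a f = (λ_ _).inv ≫ E.elt f ▷ E.obj a b ≫ E.comp a b b' := by
    rw [elt_comp_mapRight, Iso.inv_hom_id_assoc]
  have h₂ : E.mapLeft f c = (ρ_ _).inv ≫ E.obj b' c ◁ E.elt f ≫ E.comp b b' c := by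
    rw [elt_comp_mapLeft, Iso.inv_hom_id_assoc]
  rw [h₁, h₂, comp_whiskerRight, comp_whiskerRight, assoc, assoc, E.comp_assoc]
  simp

end Enrichment

/-! ### Enrichment axioms checked through a jointly monic pair of maps. -/

variable (C V) in
/-- The data of an enrichment, without the axioms. -/
structure PreEnrichment where
  obj : C → C → V
  mapLeft {a a' : C} (f : a ⟶ a') (b : C) : obj a' b ⟶ obj a b
  mapRight (a : C) {b b' : C} (g : b ⟶ b') : obj a b ⟶ obj a b'
  comp (a b c : C) : obj b c ⊗ obj a b ⟶ obj a c
  unit (c : C) : 𝟙_ V ⟶ obj c c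

/-- Maps from the data of an enrichment to an enrichment. -/
structure PreEnrichment.HomTo (P : PreEnrichment C V) (σ : Enrichment C V) where
  app (a b : C) : P.obj a b ⟶ σ.obj a b
  mapLeft_app {a a' : C} (f : a ⟶ a') (b : C) :
    P.mapLeft f b ≫ app a b = app a' b ≫ σ.mapLeft f b
  mapRight_app (a : C) {b b' : C} (g : b ⟶ b') :
    P.mapRight a g ≫ app a b' = app a b ≫ σ.mapRight a g
  comp_app (a b c : C) : P.comp a b c ≫ app a c = (app b c ⊗ₘ app a b) ≫ σ.comp a b c
  unit_app (c : C) : P.unit c ≫ app c c = σ.unit c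

namespace PreEnrichment

variable {P : PreEnrichment C V} {σ τ : Enrichment C V}

namespace HomTo

variable (p : P.HomTo σ)

lemma map_id_left (a b : C) : P.mapLeft (𝟙 a) b ≫ p.app a b = 𝟙 _ ≫ p.app a b := by
  rw [p.mapLeft_app, Enrichment.mapLeft, op_id, CategoryTheory.Functor.map_id, NatTrans.id_app,
    comp_id, id_comp]

lemma map_comp_left {a a' a'' : C} (f : a ⟶ a') (f' : a' ⟶ a'') (b : C) :
    P.mapLeft (f ≫ f') b ≫ p.app a b = (P.mapLeft f' b ≫ P.mapLeft f b) ≫ p.app a b := by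
  rw [p.mapLeft_app, assoc, p.mapLeft_app, ← assoc, p.mapLeft_app, Enrichment.mapLeft, op_comp,
    CategoryTheory.Functor.map_comp, NatTrans.comp_app, assoc]

lemma map_id_right (a b : C) : P.mapRight a (𝟙 b) ≫ p.app a b = 𝟙 _ ≫ p.app a b := by
  rw [p.mapRight_app, Enrichment.mapRight, CategoryTheory.Functor.map_id, comp_id, id_comp]

lemma map_comp_right (a : C) {b b' b'' : C} (g : b ⟶ b') (g' : b' ⟶ b'') :
    P.mapRight a (g ≫ g') ≫ p.app a b'' = (P.mapRight a g ≫ P.mapRight a g') ≫ p.app a b'' := by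
  rw [p.mapRight_app, assoc, p.mapRight_app, ← assoc, p.mapRight_app, Enrichment.mapRight,
    CategoryTheory.Functor.map_comp, assoc]

lemma map_naturality {a a' : C} (f : a ⟶ a') {b b' : C} (g : b ⟶ b') :
    (P.mapRight a' g ≫ P.mapLeft f b') ≫ p.app a b' =
      (P.mapLeft f b ≫ P.mapRight a g) ≫ p.app a b' := by
  have h : σ.mapRight a' g ≫ σ.mapLeft f b' = σ.mapLeft f b ≫ σ.mapRight a g :=
    (σ.hom.map f.op).naturality g
  rw [assoc, p.mapLeft_app, reassoc_of% p.mapRight_app, assoc, p.mapRight_app,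
    reassoc_of% p.mapLeft_app, h]

lemma comp_natural_left {a a' : C} (f : a ⟶ a') (b c : C) :
    (P.obj b c ◁ P.mapLeft f b ≫ P.comp a b c) ≫ p.app a c =
      (P.comp a' b c ≫ P.mapLeft f c) ≫ p.app a c := by
  rw [assoc, assoc, p.mapLeft_app, p.comp_app, ← assoc (P.comp a' b c), p.comp_app, assoc,
    ← σ.comp_natural_left, ← assoc (P.obj b c ◁ _), ← assoc (_ ⊗ₘ _), ← id_tensorHom,
    ← id_tensorHom, tensorHom_comp_tensorHom, tensorHom_comp_tensorHom, p.mapLeft_app, id_comp,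
    comp_id]

lemma comp_natural_right (a b : C) {c c' : C} (g : c ⟶ c') :
    (P.mapRight b g ▷ P.obj a b ≫ P.comp a b c') ≫ p.app a c' =
      (P.comp a b c ≫ P.mapRight a g) ≫ p.app a c' := by
  rw [assoc, assoc, p.mapRight_app, p.comp_app, ← assoc (P.comp a b c), p.comp_app, assoc,
    ← σ.comp_natural_right, MonoidalCategory.tensorHom_def', MonoidalCategory.tensorHom_def',
    assoc, assoc, ← whisker_exchange_assoc, ← comp_whiskerRight_assoc, ← comp_whiskerRight_assoc,
    p.mapRight_app]

lemma comp_assoc (a b c d : C) :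
    (P.comp b c d ▷ P.obj a b ≫ P.comp a b d) ≫ p.app a d =
      ((α_ _ _ _).hom ≫ P.obj c d ◁ P.comp a b c ≫ P.comp a c d) ≫ p.app a d := by
  simp only [assoc, p.comp_app]
  have h₁ : P.comp b c d ▷ P.obj a b ≫ (p.app b d ⊗ₘ p.app a b) =
      ((p.app c d ⊗ₘ p.app b c) ⊗ₘ p.app a b) ≫ σ.comp b c d ▷ σ.obj a b := by
    rw [← tensorHom_id, tensorHom_comp_tensorHom, p.comp_app, id_comp, ← tensorHom_id,
      tensorHom_comp_tensorHom, comp_id]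
  have h₂ : P.obj c d ◁ P.comp a b c ≫ (p.app c d ⊗ₘ p.app a c) =
      (p.app c d ⊗ₘ (p.app b c ⊗ₘ p.app a b)) ≫ σ.obj c d ◁ σ.comp a b c := by
    rw [← id_tensorHom, tensorHom_comp_tensorHom, p.comp_app, id_comp, ← id_tensorHom,
      tensorHom_comp_tensorHom, comp_id]
  rw [reassoc_of% h₁, reassoc_of% h₂, σ.comp_assoc, associator_naturality_assoc]

lemma unit_comp (a b : C) :
    (P.unit b ▷ P.obj a b ≫ P.comp a b b) ≫ p.app a b = (λ_ _).hom ≫ p.app a b := by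
  rw [assoc, p.comp_app, MonoidalCategory.tensorHom_def, ← assoc, ← assoc, ← comp_whiskerRight,
    p.unit_app, ← whisker_exchange, assoc, σ.unit_comp, leftUnitor_naturality]

lemma comp_unit (a b : C) :
    (P.obj a b ◁ P.unit a ≫ P.comp a a b) ≫ p.app a b = (ρ_ _).hom ≫ p.app a b := by
  rw [assoc, p.comp_app, MonoidalCategory.tensorHom_def', ← assoc, ← assoc, ← whiskerLeft_comp,
    p.unit_app, whisker_exchange, assoc, σ.comp_unit, rightUnitor_naturality]

lemma unit_natural {a b : C} (f : a ⟶ b) :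
    (P.unit a ≫ P.mapRight a f) ≫ p.app a b = (P.unit b ≫ P.mapLeft f b) ≫ p.app a b := by
  rw [assoc, assoc, p.mapLeft_app, p.mapRight_app, ← assoc, ← assoc, p.unit_app, p.unit_app]
  exact σ.unit_natural f

end HomTo

/-- If two maps to enrichments are jointly monic, then the axioms of an enrichment hold. -/
def toEnrichment (P : PreEnrichment C V) (p : P.HomTo σ) (q : P.HomTo τ)
    (ext : ∀ ⦃a b : C⦄ ⦃Z : V⦄ ⦃f g : Z ⟶ P.obj a b⦄,
      f ≫ p.app a b = g ≫ p.app a b → f ≫ q.app a b = g ≫ q.app a b → f = g) :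
    Enrichment C V where
  hom :=
    { obj a :=
        { obj b := P.obj a.unop b
          map g := P.mapRight a.unop g
          map_id b := ext (p.map_id_right _ b) (q.map_id_right _ b)
          map_comp g g' := ext (p.map_comp_right _ g g') (q.map_comp_right _ g g') }
      map f :=
        { app b := P.mapLeft f.unop b
          naturality _ _ g := ext (p.map_naturality f.unop g) (q.map_naturality f.unop g) }
      map_id a := NatTrans.ext (funext fun b ↦ ext (p.map_id_left a.unop b)
        (q.map_id_left a.unop b))
      map_comp f f' := NatTrans.ext (funext fun b ↦ ext (p.map_comp_left f'.unop f.unop b)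
        (q.map_comp_left f'.unop f.unop b)) }
  comp := P.comp
  unit := P.unit
  comp_natural_left f b c := ext (p.comp_natural_left f b c) (q.comp_natural_left f b c)
  comp_natural_right a b _ _ g := ext (p.comp_natural_right a b g) (q.comp_natural_right a b g)
  comp_assoc a b c d := ext (p.comp_assoc a b c d) (q.comp_assoc a b c d)
  unit_comp a b := ext (p.unit_comp a b) (q.unit_comp a b)
  comp_unit a b := ext (p.comp_unit a b) (q.comp_unit a b)
  unit_natural f := ext (p.unit_natural f) (q.unit_natural f)


end PreEnrichment

namespace Enrichment

/-- The component of a map of enrichments. -/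
abbrev Hom.ap {σ τ : Enrichment C V} (φ : Hom σ τ) (a b : C) : σ.obj a b ⟶ τ.obj a b :=
  (φ.app.app (op a)).app b

lemma Hom.mapLeft_ap {σ τ : Enrichment C V} (φ : Hom σ τ) {a a' : C} (f : a ⟶ a') (b : C) :
    σ.mapLeft f b ≫ φ.ap a b = φ.ap a' b ≫ τ.mapLeft f b :=
  congrArg (fun θ ↦ NatTrans.app θ b) (φ.app.naturality f.op)

lemma Hom.mapRight_ap {σ τ : Enrichment C V} (φ : Hom σ τ) (a : C) {b b' : C} (g : b ⟶ b') :
    σ.mapRight a g ≫ φ.ap a b' = φ.ap a b ≫ τ.mapRight a g :=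
  (φ.app.app (op a)).naturality g

lemma mapLeft_mapRight (E : Enrichment C V) {a a' b b' : C} (f : a ⟶ a') (g : b ⟶ b') :
    E.mapLeft f b ≫ E.mapRight a g = E.mapRight a' g ≫ E.mapLeft f b' :=
  ((E.hom.map f.op).naturality g).symm

lemma mapLeft_comp (E : Enrichment C V) {a a' a'' : C} (f : a ⟶ a') (g : a' ⟶ a'') (b : C) :
    E.mapLeft (f ≫ g) b = E.mapLeft g b ≫ E.mapLeft f b := by
  rw [mapLeft, op_comp, CategoryTheory.Functor.map_comp, NatTrans.comp_app]

lemma mapRight_comp (E : Enrichment C V) (a : C) {b b' b'' : C} (f : b ⟶ b') (g : b' ⟶ b'') :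
    E.mapRight a (f ≫ g) = E.mapRight a f ≫ E.mapRight a g :=
  CategoryTheory.Functor.map_comp _ _ _

/-! ### The enrichment of endomorphisms of a natural transformation. -/

section

variable {D : Type u₂} [Category.{v₂} D] {E : Enrichment D V} {G H : C ⥤ D} (α : G ⟶ H)
  {σ τ : Enrichment C V} (φ : Hom σ (E.pullback H)) (ψ : Hom τ (E.pullback G))

/-- The component of a map to a pullback of enrichments. -/
def Hom.apPull {H : C ⥤ D} (φ : Hom σ (E.pullback H)) (a b : C) :
    σ.obj a b ⟶ E.obj (H.obj a) (H.obj b) :=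
  φ.ap a b

namespace Hom

variable {H : C ⥤ D} (φ : Hom σ (E.pullback H))

lemma mapLeft_apPull {a a' : C} (f : a ⟶ a') (b : C) :
    σ.mapLeft f b ≫ φ.apPull a b = φ.apPull a' b ≫ E.mapLeft (H.map f) (H.obj b) :=
  φ.mapLeft_ap f b

lemma mapRight_apPull (a : C) {b b' : C} (g : b ⟶ b') :
    σ.mapRight a g ≫ φ.apPull a b' = φ.apPull a b ≫ E.mapRight (H.obj a) (H.map g) :=
  φ.mapRight_ap a g

lemma unit_apPull (c : C) : σ.unit c ≫ φ.apPull c c = E.unit (H.obj c) := φ.unit_app c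

lemma comp_apPull (a b c : C) :
    σ.comp a b c ≫ φ.apPull a c =
      (φ.apPull b c ⊗ₘ φ.apPull a b) ≫ E.comp (H.obj a) (H.obj b) (H.obj c) :=
  φ.comp_app a b c

end Hom

/-- The first leg of the fiber product of enrichments. -/
def legLeft (a b : C) : σ.obj a b ⟶ E.obj (G.obj a) (H.obj b) :=
  φ.apPull a b ≫ E.mapLeft (α.app a) (H.obj b)

/-- The second leg of the fiber product of enrichments. -/
def legRight (a b : C) : τ.obj a b ⟶ E.obj (G.obj a) (H.obj b) :=
  ψ.apPull a b ≫ E.mapRight (G.obj a) (α.app b)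

lemma mapLeft_legLeft {a a' : C} (f : a ⟶ a') (b : C) :
    σ.mapLeft f b ≫ legLeft α φ a b = legLeft α φ a' b ≫ E.mapLeft (G.map f) (H.obj b) := by
  rw [legLeft, legLeft, reassoc_of% φ.mapLeft_apPull, assoc, ← mapLeft_comp, ← mapLeft_comp,
    α.naturality]

lemma mapRight_legLeft (a : C) {b b' : C} (g : b ⟶ b') :
    σ.mapRight a g ≫ legLeft α φ a b' = legLeft α φ a b ≫ E.mapRight (G.obj a) (H.map g) := by
  rw [legLeft, legLeft, reassoc_of% φ.mapRight_apPull, assoc, mapLeft_mapRight]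

lemma mapLeft_legRight {a a' : C} (f : a ⟶ a') (b : C) :
    τ.mapLeft f b ≫ legRight α ψ a b = legRight α ψ a' b ≫ E.mapLeft (G.map f) (H.obj b) := by
  rw [legRight, legRight, reassoc_of% ψ.mapLeft_apPull, assoc, mapLeft_mapRight]

lemma mapRight_legRight (a : C) {b b' : C} (g : b ⟶ b') :
    τ.mapRight a g ≫ legRight α ψ a b' = legRight α ψ a b ≫ E.mapRight (G.obj a) (H.map g) := by
  rw [legRight, legRight, reassoc_of% ψ.mapRight_apPull, assoc, ← mapRight_comp, ← mapRight_comp,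
    α.naturality]

lemma unit_legLeft_eq (c : C) : σ.unit c ≫ legLeft α φ c c = τ.unit c ≫ legRight α ψ c c := by
  rw [legLeft, legRight, reassoc_of% φ.unit_apPull, reassoc_of% ψ.unit_apPull]
  exact (E.unit_natural (α.app c)).symm

lemma comp_legLeft (a b c : C) :
    σ.comp a b c ≫ legLeft α φ a c =
      (φ.apPull b c ⊗ₘ legLeft α φ a b) ≫ E.comp (G.obj a) (H.obj b) (H.obj c) := by
  rw [legLeft, reassoc_of% φ.comp_apPull, legLeft, ← E.comp_natural_left, ← assoc, ← id_tensorHom,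
    tensorHom_comp_tensorHom, comp_id]

lemma comp_legRight (a b c : C) :
    τ.comp a b c ≫ legRight α ψ a c =
      (legRight α ψ b c ⊗ₘ ψ.apPull a b) ≫ E.comp (G.obj a) (G.obj b) (H.obj c) := by
  rw [legRight, reassoc_of% ψ.comp_apPull, legRight, ← E.comp_natural_right, ← assoc,
    ← tensorHom_id, tensorHom_comp_tensorHom, comp_id]

/-- For generalized elements s of σ and t of τ, being compatible means s α = α t. Then s' s α = s' α
t = α t' t, the middle move being dinaturality of composition; so compatible pairs compose. -/
lemma comp_legLeft_eq {a b c : C} {X Y : V} {x : X ⟶ σ.obj b c} {x' : X ⟶ τ.obj b c}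
    (hx : x ≫ legLeft α φ b c = x' ≫ legRight α ψ b c) {y : Y ⟶ σ.obj a b} {y' : Y ⟶ τ.obj a b}
    (hy : y ≫ legLeft α φ a b = y' ≫ legRight α ψ a b) :
    (x ⊗ₘ y) ≫ σ.comp a b c ≫ legLeft α φ a c =
      (x' ⊗ₘ y') ≫ τ.comp a b c ≫ legRight α ψ a c := by
  have h := E.mapRight_comp_eq_mapLeft_comp (G.obj a) (α.app b) (H.obj c)
  rw [comp_legLeft, comp_legRight, ← assoc, ← assoc, tensorHom_comp_tensorHom,
    tensorHom_comp_tensorHom, hy, ← hx, legLeft, legRight]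
  calc _ = (x ≫ φ.apPull b c ⊗ₘ y' ≫ ψ.apPull a b) ≫ _ ◁ E.mapRight (G.obj a) (α.app b) ≫
        E.comp (G.obj a) (H.obj b) (H.obj c) := by
        rw [← id_tensorHom, tensorHom_comp_tensorHom_assoc, comp_id, assoc]
    _ = _ := by
        rw [h, ← assoc, ← tensorHom_id, tensorHom_comp_tensorHom, comp_id, assoc]

/-- The fiber product of two enrichments over an enrichment of another category. -/
lemma exists_fiberProduct [HasPullbacks V] :
    ∃ (P : Enrichment C V) (p : Hom P σ) (q : Hom P τ),
      ∀ a b, IsPullback (p.ap a b) (q.ap a b) (legLeft α φ a b) (legRight α ψ a b) := by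
  have h₀ (a b : C) : ∃ (P : V) (fst : P ⟶ σ.obj a b) (snd : P ⟶ τ.obj a b),
      IsPullback fst snd (legLeft α φ a b) (legRight α ψ a b) :=
    ⟨_, _, _, IsPullback.of_hasPullback _ _⟩
  choose P fst snd h using h₀
  have hl {Z : V} {a b : C} (x : Z ⟶ σ.obj a b) (y : Z ⟶ τ.obj a b)
      (hxy : x ≫ legLeft α φ a b = y ≫ legRight α ψ a b) :
      ∃ l : Z ⟶ P a b, l ≫ fst a b = x ∧ l ≫ snd a b = y :=
    ⟨(h a b).lift x y hxy, (h a b).lift_fst _ _ _, (h a b).lift_snd _ _ _⟩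
  have hL {a a' : C} (f : a ⟶ a') (b : C) : ∃ l : P a' b ⟶ P a b,
      l ≫ fst a b = fst a' b ≫ σ.mapLeft f b ∧ l ≫ snd a b = snd a' b ≫ τ.mapLeft f b :=
    hl _ _ (by rw [assoc, assoc, mapLeft_legLeft, mapLeft_legRight, (h _ _).w_assoc])
  have hR (a : C) {b b' : C} (g : b ⟶ b') : ∃ l : P a b ⟶ P a b',
      l ≫ fst a b' = fst a b ≫ σ.mapRight a g ∧ l ≫ snd a b' = snd a b ≫ τ.mapRight a g :=
    hl _ _ (by rw [assoc, assoc, mapRight_legLeft, mapRight_legRight, (h _ _).w_assoc])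
  have hC (a b c : C) : ∃ l : P b c ⊗ P a b ⟶ P a c,
      l ≫ fst a c = (fst b c ⊗ₘ fst a b) ≫ σ.comp a b c ∧
      l ≫ snd a c = (snd b c ⊗ₘ snd a b) ≫ τ.comp a b c :=
    hl _ _ (by
      rw [assoc, assoc]
      exact comp_legLeft_eq α φ ψ (h b c).w (h a b).w)
  have hU (c : C) : ∃ l : 𝟙_ V ⟶ P c c,
      l ≫ fst c c = σ.unit c ∧ l ≫ snd c c = τ.unit c := hl _ _ (unit_legLeft_eq α φ ψ c)
  choose L hL₁ hL₂ using @hL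
  choose R hR₁ hR₂ using @hR
  choose c hC₁ hC₂ using hC
  choose e hU₁ hU₂ using hU
  let Q : PreEnrichment C V := { obj := P, mapLeft := L, mapRight := R, comp := c, unit := e }
  let p : Q.HomTo σ :=
    { app := fst, mapLeft_app := hL₁, mapRight_app := hR₁, comp_app := hC₁, unit_app := hU₁ }
  let q : Q.HomTo τ :=
    { app := snd, mapLeft_app := hL₂, mapRight_app := hR₂, comp_app := hC₂, unit_app := hU₂ }
  refine ⟨Q.toEnrichment p q (fun a b Z f g h₁ h₂ ↦ (h a b).hom_ext h₁ h₂),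
    { app :=
        { app a := { app b := fst a.unop b, naturality _ _ g := hR₁ _ g }
          naturality _ _ f := NatTrans.ext (funext fun b ↦ hL₁ f.unop b) }
      unit_app := hU₁
      comp_app := hC₁ },
    { app :=
        { app a := { app b := snd a.unop b, naturality _ _ g := hR₂ _ g }
          naturality _ _ f := NatTrans.ext (funext fun b ↦ hL₂ f.unop b) }
      unit_app := hU₂
      comp_app := hC₂ }, h⟩

end

end Enrichment

end FiberProduct

end ModelEnrich

namespace ModelEnrich

/-! ### Bimodules over enrichments and the modules they consist of -/

section Slices

variable {C : Type u₁} [Category.{v₁} C] {V : Type u} [Category.{v} V] [MonoidalCategory V]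

/-- The `V`-category underlying an enrichment. -/
def Enrichment.toVCat (E : Enrichment C V) : VCat V C where
  hom a b := E.obj a b
  comp a b c := E.comp a b c
  unit a := E.unit a
  comp_assoc a b c d := E.comp_assoc a b c d
  unit_comp a b := E.unit_comp a b
  comp_unit a b := E.comp_unit a b

variable {σ τ : Enrichment C V}

/-- A bimodule over enrichments as a bimodule over the underlying `V`-categories. -/
def Bimodule.toBiMod (P : Bimodule σ τ) : BiMod σ.toVCat τ.toVCat where
  obj := P.obj
  lact := P.lact
  ract := P.ract
  lact_assoc := P.lact_assoc
  unit_lact := P.unit_lact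
  ract_assoc := P.ract_assoc
  ract_unit := P.ract_unit
  lact_ract := P.lact_ract

variable (τ) in
/-- An enrichment as a bimodule over itself. -/
def Enrichment.regular : BiMod τ.toVCat τ.toVCat where
  obj := τ.obj
  lact := τ.comp
  ract := τ.comp
  lact_assoc := τ.comp_assoc
  unit_lact := τ.unit_comp
  ract_assoc := τ.comp_assoc
  ract_unit := τ.comp_unit
  lact_ract := τ.comp_assoc

namespace BiMod

variable (X : BiMod σ.toVCat τ.toVCat)

/-- The left action of an enrichment on a bimodule. -/
def left (a b c : C) : σ.obj b c ⊗ X.obj a b ⟶ X.obj a c := X.lact a b c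

/-- The right action of an enrichment on a bimodule. -/
def right (a b c : C) : X.obj b c ⊗ τ.obj a b ⟶ X.obj a c := X.ract a b c

lemma left_assoc (a b c d : C) : σ.comp b c d ▷ X.obj a b ≫ X.left a b d =
    (α_ _ _ _).hom ≫ σ.obj c d ◁ X.left a b c ≫ X.left a c d := X.lact_assoc a b c d

lemma unit_left (a b : C) : σ.unit b ▷ X.obj a b ≫ X.left a b b = (λ_ _).hom := X.unit_lact a b

lemma right_assoc (a b c d : C) : X.right b c d ▷ τ.obj a b ≫ X.right a b d =
    (α_ _ _ _).hom ≫ X.obj c d ◁ τ.comp a b c ≫ X.right a c d := X.ract_assoc a b c d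

lemma right_unit (a b : C) : X.obj a b ◁ τ.unit a ≫ X.right a a b = (ρ_ _).hom := X.ract_unit a b

lemma left_right (a b c d : C) : X.left b c d ▷ τ.obj a b ≫ X.right a b d =
    (α_ _ _ _).hom ≫ σ.obj c d ◁ X.right a b c ≫ X.left a c d := X.lact_ract a b c d

/-- The map of a bimodule induced by a morphism in the second variable. -/
def push (a : C) {b c : C} (f : b ⟶ c) : X.obj a b ⟶ X.obj a c :=
  (λ_ _).inv ≫ σ.elt f ▷ X.obj a b ≫ X.left a b c

/-- The map of a bimodule induced by a morphism in the first variable. -/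
def pull {a b : C} (f : a ⟶ b) (c : C) : X.obj b c ⟶ X.obj a c :=
  (ρ_ _).inv ≫ X.obj b c ◁ τ.elt f ≫ X.right a b c

lemma push_id (a b : C) : X.push a (𝟙 b) = 𝟙 _ := by
  rw [push, Enrichment.elt_id, unit_left, Iso.inv_hom_id]

lemma push_comp (a : C) {b c d : C} (f : b ⟶ c) (g : c ⟶ d) :
    X.push a (f ≫ g) = X.push a f ≫ X.push a g := by
  simp only [push, Enrichment.elt_comp, comp_whiskerRight, assoc, left_assoc,
    associator_naturality_left_assoc, ← whisker_exchange_assoc]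
  monoidal

lemma right_push (a b : C) {c d : C} (f : c ⟶ d) :
    X.right a b c ≫ X.push a f = X.push b f ▷ τ.obj a b ≫ X.right a b d := by
  simp only [push, comp_whiskerRight, assoc, left_right, associator_naturality_left_assoc,
    ← whisker_exchange_assoc]
  monoidal

lemma whiskerLeft_push_left (a : C) {b c : C} (f : b ⟶ c) (d : C) :
    σ.obj c d ◁ X.push a f ≫ X.left a c d = σ.mapLeft f d ▷ X.obj a b ≫ X.left a b d := by
  have h : σ.mapLeft f d = (ρ_ _).inv ≫ σ.obj c d ◁ σ.elt f ≫ σ.comp b c d := by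
    rw [Enrichment.elt_comp_mapLeft, Iso.inv_hom_id_assoc]
  rw [h]
  simp only [push, comp_whiskerRight, assoc, left_assoc, whiskerLeft_comp]
  monoidal

lemma left_push_eq (a b : C) {c d : C} (f : c ⟶ d) :
    X.left a b c ≫ X.push a f = σ.mapRight b f ▷ X.obj a b ≫ X.left a b d := by
  have h : σ.mapRight b f = (λ_ _).inv ≫ σ.elt f ▷ σ.obj b c ≫ σ.comp b c d := by
    rw [Enrichment.elt_comp_mapRight, Iso.inv_hom_id_assoc]
  rw [h]
  simp only [push, comp_whiskerRight, assoc, left_assoc, associator_naturality_left_assoc,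
    ← whisker_exchange_assoc]
  monoidal

/-- The modules `X(-, b)`, for a bimodule `X`. -/
def slice : C ⥤ RMod τ.toVCat where
  obj b := RMod.ofAct (fun a ↦ X.obj a b) (fun a a' ↦ X.right a a' b)
    (fun a a' a'' ↦ X.right_assoc a a' a'' b) (fun a ↦ X.right_unit a b)
  map {b c} f := RMod.homMk (fun a ↦ X.push a f) (fun a a' ↦ X.right_push a a' f)
  map_id b := RMod.ext_ap fun a ↦ X.push_id a b
  map_comp f g := RMod.ext_ap fun a ↦ X.push_comp a f g

variable (pt : ∀ c, 𝟙_ V ⟶ X.obj c c)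

/-- The components of the map from the representable modules given by a point of a bimodule. -/
def ofPointsApp (a b : C) : τ.obj a b ⟶ X.obj a b :=
  (λ_ (τ.obj a b)).inv ≫ pt b ▷ τ.obj a b ≫ X.right a b b

lemma comp_ofPointsApp (a b c : C) :
    τ.comp a b c ≫ X.ofPointsApp pt a c = X.ofPointsApp pt b c ▷ τ.obj a b ≫ X.right a b c := by
  simp only [ofPointsApp, comp_whiskerRight, assoc, right_assoc]
  calc _ = 𝟙 _ ⊗≫ (𝟙_ V ◁ τ.comp a b c ≫ pt c ▷ τ.obj a c) ≫ X.right a c c := by monoidal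
    _ = _ := by
      rw [whisker_exchange]
      monoidal

/-- Pointedness says that `τ.elt f` is sent to the push-forward of the point along f; the right
action spreads this over all of τ(a, b). -/
lemma mapRight_ofPointsApp (h : ∀ {a b : C} (f : a ⟶ b), pt a ≫ X.push a f = pt b ≫ X.pull f b)
    (a : C) {b c : C} (f : b ⟶ c) :
    τ.mapRight a f ≫ X.ofPointsApp pt a c = X.ofPointsApp pt a b ≫ X.push a f := by
  have h₁ : τ.mapRight a f = (λ_ _).inv ≫ τ.elt f ▷ τ.obj a b ≫ τ.comp a b c := by
    rw [Enrichment.elt_comp_mapRight, Iso.inv_hom_id_assoc]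
  have h₂ : τ.elt f ≫ X.ofPointsApp pt b c = pt b ≫ X.push b f := by
    rw [h, pull, ofPointsApp, rightUnitor_inv_naturality_assoc, ← whisker_exchange_assoc,
      leftUnitor_inv_naturality_assoc, unitors_inv_equal]
  rw [h₁, assoc, assoc, comp_ofPointsApp, ← comp_whiskerRight_assoc, h₂, ofPointsApp, assoc, assoc,
    right_push, ← comp_whiskerRight_assoc]

/-- A point of a bimodule induces a map from the representable modules. -/
def ofPoints (h : ∀ {a b : C} (f : a ⟶ b), pt a ≫ X.push a f = pt b ≫ X.pull f b) :
    τ.regular.slice ⟶ X.slice where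
  app b := RMod.homMk (fun a ↦ X.ofPointsApp pt a b) (fun a a' ↦ X.comp_ofPointsApp pt a a' b)
  naturality b c f := RMod.ext_ap fun a ↦ by
    refine Eq.trans ?_ (X.mapRight_ofPointsApp pt h a f)
    refine congrArg (· ≫ X.ofPointsApp pt a c) ?_
    change (λ_ _).inv ≫ τ.elt f ▷ τ.obj a b ≫ τ.comp a b c = τ.mapRight a f
    rw [Enrichment.elt_comp_mapRight, Iso.inv_hom_id_assoc]

end BiMod

end Slices

/-! ### The left action as a map to the enrichment of modules. -/

section Actions

variable {C : Type u₁} [Category.{v₁} C] {V : Type u} [Category.{v} V] [MonoidalCategory V]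
  [BraidedCategory V] [MonoidalClosed V] [HasLimits V] [Small.{v} C] {σ τ : Enrichment C V}

namespace BiMod

variable (X : BiMod σ.toVCat τ.toVCat)

/-- Commutation of the two actions is exactly what lets σ act by maps of right τ-modules. -/
lemma isLinear_left (a b : C) :
    RMod.IsLinear (X := X.slice.obj a) (Y := X.slice.obj b) (fun c ↦ X.left c a b) := fun c d ↦
  (X.left_right c d a b).symm

/-- Evaluation on the linear maps between the slices of a bimodule. -/
noncomputable def sliceEv (a b c : C) :
    RMod.HomObj (X.slice.obj a) (X.slice.obj b) ⊗ X.obj c a ⟶ X.obj c b :=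
  RMod.ev (X.slice.obj a) (X.slice.obj b) c

variable {X} in
lemma hom_ext_sliceEv {v : V} {a b : C} {g g' : v ⟶ RMod.HomObj (X.slice.obj a) (X.slice.obj b)}
    (h : ∀ c, g ▷ X.obj c a ≫ X.sliceEv a b c = g' ▷ X.obj c a ≫ X.sliceEv a b c) : g = g' :=
  RMod.hom_ext_ev h

/-- The map from an enrichment to the linear maps between the slices of a bimodule. -/
noncomputable def actHomApp (a b : C) :
    σ.obj a b ⟶ RMod.HomObj (X.slice.obj a) (X.slice.obj b) :=
  RMod.lift _ (X.isLinear_left a b)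

lemma actHomApp_ev (a b c : C) : X.actHomApp a b ▷ X.obj c a ≫ X.sliceEv a b c = X.left c a b :=
  RMod.lift_ev _ (X.isLinear_left a b) c

lemma mapLeft_actHomApp {a a' : C} (f : a ⟶ a') (b : C) :
    σ.mapLeft f b ≫ X.actHomApp a b =
      X.actHomApp a' b ≫ RMod.homMapLeft (X.slice.map f) (X.slice.obj b) :=
  hom_ext_sliceEv fun c ↦ by
    have h : RMod.homMapLeft (X.slice.map f) (X.slice.obj b) ▷ X.obj c a ≫ X.sliceEv a b c =
        _ ◁ X.push c f ≫ X.sliceEv a' b c :=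
      RMod.homMapLeft_ev (X.slice.map f) (X.slice.obj b) c
    rw [comp_whiskerRight_assoc, actHomApp_ev, comp_whiskerRight_assoc, h,
      ← whisker_exchange_assoc, actHomApp_ev, whiskerLeft_push_left]

lemma mapRight_actHomApp (a : C) {b b' : C} (f : b ⟶ b') :
    σ.mapRight a f ≫ X.actHomApp a b' =
      X.actHomApp a b ≫ RMod.homMapRight (X.slice.obj a) (X.slice.map f) :=
  hom_ext_sliceEv fun c ↦ by
    have h : RMod.homMapRight (X.slice.obj a) (X.slice.map f) ▷ X.obj c a ≫ X.sliceEv a b' c =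
        X.sliceEv a b c ≫ X.push c f :=
      RMod.homMapRight_ev (X.slice.obj a) (X.slice.map f) c
    rw [comp_whiskerRight_assoc, actHomApp_ev, comp_whiskerRight_assoc, h,
      ← assoc, actHomApp_ev, left_push_eq]

lemma unit_actHomApp (a : C) : σ.unit a ≫ X.actHomApp a a = RMod.homUnit (X.slice.obj a) :=
  hom_ext_sliceEv fun c ↦ by
    have h : RMod.homUnit (X.slice.obj a) ▷ X.obj c a ≫ X.sliceEv a a c = (λ_ _).hom :=
      RMod.homUnit_ev (X.slice.obj a) c
    rw [comp_whiskerRight_assoc, actHomApp_ev, unit_left, h]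

lemma comp_actHomApp (a b c : C) : σ.comp a b c ≫ X.actHomApp a c =
    (X.actHomApp b c ⊗ₘ X.actHomApp a b) ≫
      RMod.homComp (X.slice.obj a) (X.slice.obj b) (X.slice.obj c) :=
  hom_ext_sliceEv fun d ↦ by
    have h : RMod.homComp (X.slice.obj a) (X.slice.obj b) (X.slice.obj c) ▷ X.obj d a ≫
        X.sliceEv a c d = (α_ _ _ _).hom ≫ _ ◁ X.sliceEv a b d ≫ X.sliceEv b c d :=
      RMod.homComp_ev (X.slice.obj a) (X.slice.obj b) (X.slice.obj c) d
    rw [comp_whiskerRight_assoc, actHomApp_ev, comp_whiskerRight_assoc, h, left_assoc,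
      MonoidalCategory.tensorHom_def, comp_whiskerRight_assoc, associator_naturality_middle_assoc,
      ← whiskerLeft_comp_assoc, actHomApp_ev, associator_naturality_left_assoc,
      ← whisker_exchange_assoc, actHomApp_ev]

/-- The action of an enrichment on the slices of a bimodule. -/
noncomputable def actHom :
    Enrichment.Hom σ ((RMod.homEnrichment τ.toVCat).pullback X.slice) where
  app :=
    { app a :=
        { app b := X.actHomApp a.unop b
          naturality _ _ f := X.mapRight_actHomApp a.unop f }
      naturality _ _ f := NatTrans.ext (funext fun b ↦ X.mapLeft_actHomApp f.unop b) }
  unit_app c := X.unit_actHomApp c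
  comp_app a b c := X.comp_actHomApp a b c

end BiMod

end Actions

end ModelEnrich

namespace ModelEnrich

/-! ### Pointed bimodules give zig-zags of weak equivalences -/

section Zigzags

variable {C : Type u₁} [Category.{v₁} C] {V : Type u} [Category.{v} V] [MonoidalCategory V]

namespace Enrichment

/-- The identity of an enrichment. -/
def Hom.id (σ : Enrichment C V) : Hom σ σ where
  app := 𝟙 _
  unit_app _ := comp_id _
  comp_app a b c := by
    change σ.comp a b c ≫ 𝟙 _ = (𝟙 _ ⊗ₘ 𝟙 _) ≫ σ.comp a b c
    simp

section

variable {D : Type u₂} [Category.{v₂} D] {E : Enrichment D V} {G H : C ⥤ D} (α : G ⟶ H)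

lemma legLeft_id (a b : C) :
    legLeft α (Hom.id (E.pullback H)) a b = E.mapLeft (α.app a) (H.obj b) :=
  id_comp _

lemma legRight_id (a b : C) :
    legRight α (Hom.id (E.pullback G)) a b = E.mapRight (G.obj a) (α.app b) :=
  id_comp _

end

/-- The maps of enrichments that are weak equivalences at all pairs of objects. -/
def Hom.IsWeakEquivalence [CategoryWithWeakEquivalences V] {σ τ : Enrichment C V}
    (φ : Hom σ τ) : Prop :=
  ∀ a b, WeakEquivalence (φ.ap a b)

end Enrichment

namespace BiMod

variable {σ τ : Enrichment C V}

lemma unit_ofPointsApp (X : BiMod σ.toVCat τ.toVCat) (pt : ∀ c, 𝟙_ V ⟶ X.obj c c) (a : C) :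
    τ.unit a ≫ X.ofPointsApp pt a a = pt a := by
  rw [ofPointsApp, leftUnitor_inv_naturality_assoc, whisker_exchange_assoc, right_unit,
    rightUnitor_naturality, ← unitors_equal, Iso.inv_hom_id_assoc]

section

variable {P X : BiMod σ.toVCat τ.toVCat} (j : P ⟶ X)

lemma left_app (a b c : C) : P.left a b c ≫ j.app a c = σ.obj b c ◁ j.app a b ≫ X.left a b c :=
  j.lact_app a b c

lemma right_app (a b c : C) : P.right a b c ≫ j.app a c = j.app b c ▷ τ.obj a b ≫ X.right a b c :=
  j.ract_app a b c

lemma push_app (a : C) {b c : C} (f : b ⟶ c) :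
    P.push a f ≫ j.app a c = j.app a b ≫ X.push a f := by
  rw [push, push, assoc, assoc, left_app, ← whisker_exchange_assoc,
    leftUnitor_inv_naturality_assoc]

lemma pull_app {a b : C} (f : a ⟶ b) (c : C) :
    P.pull f c ≫ j.app a c = j.app b c ≫ X.pull f c := by
  rw [pull, pull, assoc, assoc, right_app, whisker_exchange_assoc,
    rightUnitor_inv_naturality_assoc]

end

end BiMod

/-! ### Fibrant replacement, functorial factorization and the zig-zag. -/

section

variable [SymmetricCategory V] [MonoidalClosed V] [HasLimits V] [ModelCategory V]
  [Small.{v} C] {σ τ : Enrichment C V}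

-- Factor the map to the terminal bimodule. Its first factor k is a levelwise weak equivalence by
-- the monoid axiom, and both comparison maps of the new bimodule are the old ones followed by k.
open BiMod in
lemma PointedBimodule.exists_fibrant_replacement (hcomb : IsCombinatorial V)
    (hmonoid : MonoidAxiom V) (P : PointedBimodule σ τ)
    (h₁ : ∀ a b, WeakEquivalence (P.leftComparison a b))
    (h₂ : ∀ a b, WeakEquivalence (P.rightComparison a b)) :
    ∃ (X : BiMod σ.toVCat τ.toVCat) (pt : ∀ c, 𝟙_ V ⟶ X.obj c c),
      (∀ {a b : C} (f : a ⟶ b), pt a ≫ X.push a f = pt b ≫ X.pull f b) ∧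
      (∀ a b, IsFibrant (X.obj a b)) ∧
      (∀ a b, WeakEquivalence (σ.obj a b ◁ pt a ≫ X.left a a b)) ∧
      ∀ a b, WeakEquivalence (X.ofPointsApp pt a b) := by
  have := hasColimitsOfSize_of_isCombinatorial hcomb
  have := hasFunctorialFactorization_fibrations σ.toVCat τ.toVCat hcomb
  let d := MorphismProperty.factorizationData (levelwise σ.toVCat τ.toVCat (fibrations V)).llp
    (levelwise σ.toVCat τ.toVCat (fibrations V)) (toTerminal P.toBiMod)
  obtain ⟨k, hk, hkl, hkr, hk₁, hk₂⟩ : ∃ k : ∀ a b, P.obj a b ⟶ d.Z.obj a b,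
      (∀ a b, WeakEquivalence (k a b)) ∧
      (∀ a b c, P.lact a b c ≫ k a c = σ.obj b c ◁ k a b ≫ d.Z.left a b c) ∧
      (∀ a b c, P.ract a b c ≫ k a c = k b c ▷ τ.obj a b ≫ d.Z.right a b c) ∧
      (∀ {a b : C} (f : a ⟶ b), P.mapRight a f ≫ k a b = k a a ≫ d.Z.push a f) ∧
      ∀ {a b : C} (f : a ⟶ b), P.mapLeft f b ≫ k a b = k b b ≫ d.Z.pull f b :=
    ⟨d.i.app, fun a b ↦ (weakEquivalence_iff _).2
      (llp_levelwise_fibrations_le hcomb hmonoid _ d.hi a b), left_app d.i, right_app d.i,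
      fun {a _} f ↦ push_app d.i a f, fun {_ b} f ↦ pull_app d.i f b⟩
  refine ⟨d.Z, fun c ↦ P.pt c ≫ k c c, fun {a b} f ↦ ?_, fun a b ↦ ?_, fun a b ↦ ?_,
    fun a b ↦ ?_⟩
  · rw [assoc, assoc, ← hk₁, ← hk₂, ← assoc, P.pt_natural, assoc]
  · rw [isFibrant_iff_of_isTerminal (d.p.app a b) terminalIsTerminal]
    exact (fibration_iff _).2 (d.hp a b)
  · have := h₁ a b
    have h : σ.obj a b ◁ (P.pt a ≫ k a a) ≫ d.Z.left a a b = P.leftComparison a b ≫ k a b := by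
      rw [PointedBimodule.leftComparison, whiskerLeft_comp, assoc, assoc, hkl]
    rw [h]
    infer_instance
  · have := h₂ a b
    have h : (P.pt b ≫ k b b) ▷ τ.obj a b ≫ d.Z.right a b b = P.rightComparison a b ≫ k a b := by
      rw [PointedBimodule.rightComparison, comp_whiskerRight, assoc, assoc, hkr]
    rw [ofPointsApp, h]
    infer_instance

-- The factorization has to be functorial, so that the intermediate modules again form a functor of
-- b and the enrichment can be pulled back along it.
open BiMod in
lemma exists_functorial_factorization (hcomb : IsCombinatorial V) {Y X : C ⥤ RMod τ.toVCat}
    (θ : Y ⟶ X) : ∃ (N : C ⥤ RMod τ.toVCat) (f : Y ⟶ N) (p : N ⟶ X), f ≫ p = θ ∧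
      (∀ b, (levelwise (VCat.point V) τ.toVCat (fibrations V)).llp (f.app b)) ∧
      ∀ b, levelwise (VCat.point V) τ.toVCat (fibrations V) (p.app b) := by
  have := hasColimitsOfSize_of_isCombinatorial hcomb
  have := hasFunctorialFactorization_fibrations (VCat.point.{v, u, 0} V) τ.toVCat hcomb
  let d := MorphismProperty.factorizationData
    ((levelwise (VCat.point.{v, u, 0} V) τ.toVCat (fibrations V)).llp.functorCategory C)
    ((levelwise (VCat.point.{v, u, 0} V) τ.toVCat (fibrations V)).functorCategory C) θ
  exact ⟨d.Z, d.i, d.p, d.fac, d.hi, d.hp⟩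

namespace BiMod

variable (X : BiMod σ.toVCat τ.toVCat) (pt : ∀ c, 𝟙_ V ⟶ X.obj c c)

variable (τ) in
omit [ModelCategory V] in
/-- Evaluation of a map out of a slice of the regular bimodule at the unit. -/
noncomputable def sliceEvalUnit (a : C) (Z : RMod τ.toVCat) :
    RMod.HomObj (τ.regular.slice.obj a) Z ⟶ Z.ob a :=
  RMod.evalUnit a Z

omit [ModelCategory V] in
instance (a : C) (Z : RMod τ.toVCat) : IsIso (sliceEvalUnit τ a Z) :=
  inferInstanceAs (IsIso (RMod.evalUnit a Z))

omit [SymmetricCategory V] [MonoidalClosed V] [HasLimits V] [Small.{v} C] [ModelCategory V] in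
lemma unit_comp_left (a b : C) : σ.obj a b ◁ τ.unit a ≫ σ.obj a b ◁ X.ofPointsApp pt a a ≫
    X.left a a b = σ.obj a b ◁ pt a ≫ X.left a a b := by
  rw [← whiskerLeft_comp_assoc, unit_ofPointsApp]

-- Under Yoneda, letting σ(a, b) act and restricting along the point is acting on the point itself:
-- the left comparison map, up to a unitor.
omit [ModelCategory V] in
lemma actHomApp_homMapLeft_sliceEvalUnit (θ : τ.regular.slice ⟶ X.slice)
    (h : ∀ a, RMod.ap (θ.app a) a = X.ofPointsApp pt a a) (a b : C) :
    X.actHomApp a b ≫ RMod.homMapLeft (θ.app a) (X.slice.obj b) ≫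
        sliceEvalUnit τ a (X.slice.obj b) =
      (ρ_ _).inv ≫ σ.obj a b ◁ pt a ≫ X.left a a b := by
  have h₁ : RMod.homMapLeft (θ.app a) (X.slice.obj b) ▷ τ.obj a a ≫
      RMod.ev (τ.regular.slice.obj a) (X.slice.obj b) a = _ ◁ X.ofPointsApp pt a a ≫
        X.sliceEv a b a := by
    rw [← h]
    exact RMod.homMapLeft_ev (θ.app a) (X.slice.obj b) a
  refine (assoc _ _ _).symm.trans ?_
  refine (RMod.comp_evalUnit (τ := τ.toVCat) (X := X.slice.obj b)
    (f := (show σ.obj a b ⊗ τ.obj a a ⟶ X.obj a b from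
      σ.obj a b ◁ X.ofPointsApp pt a a ≫ X.left a a b)) _ ?_).trans ?_
  · refine (comp_whiskerRight_assoc _ _ _ _).trans ?_
    refine (congrArg (X.actHomApp a b ▷ τ.obj a a ≫ ·) h₁).trans ?_
    exact (whisker_exchange_assoc _ _ _).symm.trans
      (congrArg (σ.obj a b ◁ X.ofPointsApp pt a a ≫ ·) (X.actHomApp_ev a b a))
  · exact congrArg ((ρ_ _).inv ≫ ·) (X.unit_comp_left pt a b)

-- Under Yoneda, postcomposition with f on representables is the component of f at a.
omit [ModelCategory V] in
lemma actHomApp_homMapRight_sliceEvalUnit {b : C} (a : C) {Z : RMod τ.toVCat}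
    (f : τ.regular.slice.obj b ⟶ Z) :
    τ.regular.actHomApp a b ≫ RMod.homMapRight (τ.regular.slice.obj a) f ≫ sliceEvalUnit τ a Z =
      RMod.ap f a := by
  have h₁ : RMod.homMapRight (τ.regular.slice.obj a) f ▷ τ.obj a a ≫
      RMod.ev (τ.regular.slice.obj a) Z a = τ.regular.sliceEv a b a ≫ RMod.ap f a :=
    RMod.homMapRight_ev (τ.regular.slice.obj a) f a
  refine (assoc _ _ _).symm.trans ?_
  refine (RMod.comp_evalUnit (f := τ.comp a a b ≫ RMod.ap f a) _ ?_).trans ?_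
  · refine (comp_whiskerRight_assoc _ _ _ _).trans ?_
    refine (congrArg (τ.regular.actHomApp a b ▷ τ.obj a a ≫ ·) h₁).trans ?_
    exact (assoc _ _ _).symm.trans
      (congrArg (· ≫ RMod.ap f a) (τ.regular.actHomApp_ev a b a))
  · refine (congrArg ((ρ_ (τ.obj a b)).inv ≫ ·) ((assoc _ _ _).symm.trans
      (congrArg (· ≫ RMod.ap f a) (τ.comp_unit a b)))).trans ?_
    exact Iso.inv_hom_id_assoc _ _

end BiMod

variable [IsMonoidalModelCategory V]

-- The middle enrichment is End(N) for N a factorization of the map from representables to the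
-- slices; it is joined to σ and τ by fiber products along p and f, so that the outer maps are base
-- changes of trivial fibrations.
open BiMod Enrichment in
lemma PointedBimodule.exists_zigzag (hcomb : IsCombinatorial V)
    (hmonoid : MonoidAxiom V) (P : PointedBimodule σ τ)
    (h₁ : ∀ a b, WeakEquivalence (P.leftComparison a b))
    (h₂ : ∀ a b, WeakEquivalence (P.rightComparison a b)) :
    ∃ (E₁ E E₂ : Enrichment C V) (φ₁ : Hom E₁ σ) (ψ₁ : Hom E₁ E) (ψ₂ : Hom E₂ E) (φ₂ : Hom E₂ τ),
      φ₁.IsWeakEquivalence ∧ ψ₁.IsWeakEquivalence ∧ ψ₂.IsWeakEquivalence ∧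
        φ₂.IsWeakEquivalence := by
  obtain ⟨X, pt, hpt, hX, hl, hr⟩ := P.exists_fibrant_replacement hcomb hmonoid h₁ h₂
  obtain ⟨N, f, p, hfp, hf, hp⟩ := exists_functorial_factorization hcomb (X.ofPoints pt hpt)
  have := hasColimitsOfSize_of_isCombinatorial hcomb
  have hf' (a b : C) : WeakEquivalence (RMod.ap (f.app b) a) :=
    (weakEquivalence_iff _).2 (llp_levelwise_fibrations_le hcomb hmonoid _ (hf b) a _)
  have hp' (a b : C) : trivialFibrations V (RMod.ap (p.app b) a) := by
    have h : RMod.ap (f.app b) a ≫ RMod.ap (p.app b) a = X.ofPointsApp pt a b :=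
      congrArg (fun θ ↦ RMod.ap (NatTrans.app θ b) a) hfp
    have := hf' a b
    have : WeakEquivalence (RMod.ap (f.app b) a ≫ RMod.ap (p.app b) a) := by
      rw [h]
      exact hr a b
    exact (mem_trivialFibrations_iff _).2
      ⟨(fibration_iff _).2 (hp b a _), weakEquivalence_of_precomp (RMod.ap (f.app b) a) _⟩
  have hN (a b : C) : IsFibrant ((N.obj b).ob a) := by
    have : IsFibrant ((X.slice.obj b).ob a) := hX a b
    have := ((mem_trivialFibrations_iff _).1 (hp' a b)).1
    exact isFibrant_of_fibration (RMod.ap (p.app b) a)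
  have hfl (a : C) {Z : RMod τ.toVCat} (hZ : ∀ a, IsFibrant (Z.ob a)) :
      WeakEquivalence (RMod.homMapLeft (f.app a) Z) ∧ Fibration (RMod.homMapLeft (f.app a) Z) :=
    ((mem_trivialFibrations_iff _).1 (RMod.trivialFibrations_homMapLeft (f.app a) (hf a) Z hZ)).symm
  have hpr (a b : C) : trivialFibrations V (RMod.homMapRight (N.obj a) (p.app b)) :=
    RMod.trivialFibrations_homMapRight (b := a) (f.app a) (hf a) (p.app b) (fun c ↦ hp' c b)
  let E := RMod.homEnrichment τ.toVCat
  obtain ⟨E₁, φ₁, ψ₁, sq₁⟩ := exists_fiberProduct p X.actHom (Hom.id (E.pullback N))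
  obtain ⟨E₂, ψ₂, φ₂, sq₂⟩ := exists_fiberProduct f (Hom.id (E.pullback N)) τ.regular.actHom
  -- Continuing the leg by restriction along f and by the Yoneda isomorphism restricts along p f,
  -- the map given by the point; the total is the left comparison, and the continuation is a weak
  -- equivalence.
  have hleg₁ (a b : C) : WeakEquivalence (legLeft p X.actHom a b) := by
    have hm : RMod.homMapLeft (p.app a) (X.slice.obj b) ≫
        RMod.homMapLeft (f.app a) (X.slice.obj b) =
          RMod.homMapLeft ((X.ofPoints pt hpt).app a) (X.slice.obj b) := by
      have := E.mapLeft_comp (f.app a) (p.app a) (X.slice.obj b)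
      rw [← NatTrans.comp_app, hfp] at this
      exact this.symm
    let l : σ.obj a b ⟶ RMod.HomObj (N.obj a) (X.slice.obj b) := legLeft p X.actHom a b
    have h : l ≫ RMod.homMapLeft (f.app a) (X.slice.obj b) ≫
        sliceEvalUnit τ a (X.slice.obj b) = (ρ_ _).inv ≫ σ.obj a b ◁ pt a ≫ X.left a a b := by
      refine Eq.trans ?_
        (X.actHomApp_homMapLeft_sliceEvalUnit pt (X.ofPoints pt hpt) (fun _ ↦ rfl) a b)
      rw [← hm]
      refine (assoc _ _ _).trans (congrArg (X.actHomApp a b ≫ ·) (assoc _ _ _).symm)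
    have := hl a b
    have := (hfl a (Z := X.slice.obj b) (fun c ↦ hX c b)).1
    have : WeakEquivalence (RMod.homMapLeft (f.app a) (X.slice.obj b) ≫
      sliceEvalUnit τ a (X.slice.obj b)) := inferInstance
    have hc : WeakEquivalence ((ρ_ _).inv ≫ σ.obj a b ◁ pt a ≫ X.left a a b) := inferInstance
    have : WeakEquivalence (l ≫ RMod.homMapLeft (f.app a) (X.slice.obj b) ≫
        sliceEvalUnit τ a (X.slice.obj b)) := by
      rw [h]
      exact hc
    have : WeakEquivalence l := weakEquivalence_of_postcomp _
      (RMod.homMapLeft (f.app a) (X.slice.obj b) ≫ sliceEvalUnit τ a (X.slice.obj b))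
    exact this
  -- Followed by the Yoneda isomorphism, this leg is the component of f, a weak equivalence.
  have hleg₂ (a b : C) : WeakEquivalence (legRight f τ.regular.actHom a b) := by
    let l : τ.obj a b ⟶ RMod.HomObj (τ.regular.slice.obj a) (N.obj b) :=
      legRight f τ.regular.actHom a b
    have h : l ≫ sliceEvalUnit τ a (N.obj b) = RMod.ap (f.app b) a :=
      (assoc _ _ _).trans (actHomApp_homMapRight_sliceEvalUnit a (f.app b))
    have : WeakEquivalence (l ≫ sliceEvalUnit τ a (N.obj b)) := by
      rw [h]
      exact hf' a b
    have : WeakEquivalence l := weakEquivalence_of_postcomp _ (sliceEvalUnit τ a (N.obj b))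
    exact this
  have hφ₁ (a b : C) : WeakEquivalence (φ₁.ap a b) ∧
      WeakEquivalence (legRight p (Hom.id (E.pullback N)) a b) := by
    have h : trivialFibrations V (legRight p (Hom.id (E.pullback N)) a b) := by
      rw [legRight_id]
      exact hpr a b
    exact ⟨((mem_trivialFibrations_iff _).1 (MorphismProperty.of_isPullback (sq₁ a b).flip h)).2,
      ((mem_trivialFibrations_iff _).1 h).2⟩
  have hφ₂ (a b : C) : WeakEquivalence (φ₂.ap a b) ∧
      WeakEquivalence (legLeft f (Hom.id (E.pullback N)) a b) := by
    have h : trivialFibrations V (legLeft f (Hom.id (E.pullback N)) a b) := by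
      rw [legLeft_id]
      exact (mem_trivialFibrations_iff _).2 (hfl a (fun c ↦ hN c b)).symm
    exact ⟨((mem_trivialFibrations_iff _).1 (MorphismProperty.of_isPullback (sq₂ a b) h)).2,
      ((mem_trivialFibrations_iff _).1 h).2⟩
  refine ⟨E₁, E.pullback N, E₂, φ₁, ψ₁, ψ₂, φ₂, fun a b ↦ (hφ₁ a b).1, fun a b ↦ ?_, fun a b ↦ ?_,
    fun a b ↦ (hφ₂ a b).1⟩
  -- In the pullback square three sides are weak equivalences, hence so is the fourth; the next case
  -- is the same.
  · have := (hφ₁ a b).1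
    have := (hφ₁ a b).2
    have := hleg₁ a b
    exact weakEquivalence_of_postcomp_of_fac (sq₁ a b).w.symm
  · have := (hφ₂ a b).1
    have := (hφ₂ a b).2
    have := hleg₂ a b
    exact weakEquivalence_of_postcomp_of_fac (sq₂ a b).w

end

end Zigzags

end ModelEnrich

namespace ModelEnrich

/-! ### Zig-zags of direct equivalences -/

section DirectZigzags

variable {C : Type u₁} [Category.{v₁} C] {M : Type u₂} [Category.{v₂} M] [ModelCategory M]
  {F : C ⥤ M} {V : Type u} [Category.{v} V] [MonoidalCategory V] [ModelCategory V]

/-- An enrichment that is weakly equivalent to a model enrichment by a map to it is a model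
enrichment. -/
def ModelEnrichment.ofHomTo {σ : Enrichment C V} (τ : ModelEnrichment F V)
    (φ : Enrichment.Hom σ τ.toEnrichment) (hφ : φ.IsWeakEquivalence) : ModelEnrichment F V where
  toEnrichment := σ
  weakEquivalence_mapLeft {a a'} f x h₁ h₂ h₃ h₄ := by
    have := τ.weakEquivalence_mapLeft f x h₁ h₂ h₃ h₄
    have := hφ a x
    have := hφ a' x
    exact weakEquivalence_of_postcomp_of_fac (φ.mapLeft_ap f x)
  weakEquivalence_mapRight a x x' g h₁ h₂ h₃ h₄ := by
    have := τ.weakEquivalence_mapRight a g h₁ h₂ h₃ h₄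
    have := hφ a x
    have := hφ a x'
    exact weakEquivalence_of_postcomp_of_fac (φ.mapRight_ap a g)

/-- An enrichment that is weakly equivalent to a model enrichment by a map from it is a model
enrichment. -/
def ModelEnrichment.ofHomFrom {τ : Enrichment C V} (σ : ModelEnrichment F V)
    (φ : Enrichment.Hom σ.toEnrichment τ) (hφ : φ.IsWeakEquivalence) : ModelEnrichment F V where
  toEnrichment := τ
  weakEquivalence_mapLeft {a a'} f x h₁ h₂ h₃ h₄ := by
    have := σ.weakEquivalence_mapLeft f x h₁ h₂ h₃ h₄
    have := hφ a x
    have := hφ a' x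
    exact weakEquivalence_of_precomp_of_fac (φ.mapLeft_ap f x).symm
  weakEquivalence_mapRight a x x' g h₁ h₂ h₃ h₄ := by
    have := σ.weakEquivalence_mapRight a g h₁ h₂ h₃ h₄
    have := hφ a x
    have := hφ a x'
    exact weakEquivalence_of_precomp_of_fac (φ.mapRight_ap a g).symm

/-- Every object is cofibrant and fibrant, so a quasi-equivalence has weak equivalences as
comparison maps at all pairs, and the zig-zag of a single bimodule suffices. -/
lemma QuasiEquivalent.directZigzag [SymmetricCategory V] [MonoidalClosed V] [HasLimits V]
    [IsMonoidalModelCategory V] [Small.{v} C] (hcomb : IsCombinatorial V)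
    (hmonoid : MonoidAxiom V) (hF : ∀ c, IsCofibrant (F.obj c) ∧ IsFibrant (F.obj c))
    {σ τ : ModelEnrichment F V} (h : QuasiEquivalent σ τ) : DirectZigzag σ τ := by
  refine Relation.EqvGen.rec (motive := fun σ τ _ ↦ DirectZigzag σ τ) ?_ .refl
    (fun _ _ _ ↦ .symm _ _) (fun _ _ _ _ _ ↦ .trans _ _ _) h
  rintro σ τ ⟨P, hP⟩
  obtain ⟨E₁, E, E₂, φ₁, ψ₁, ψ₂, φ₂, hφ₁, hψ₁, hψ₂, hφ₂⟩ := P.exists_zigzag hcomb hmonoid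
    (fun a b ↦ (hP a b (hF a).1 (hF b).2).1) (fun a b ↦ (hP a b (hF a).1 (hF b).2).2)
  -- The model condition passes from σ to E₁ and End(N), and from τ to E₂, by two-out-of-three.
  let σ₁ : ModelEnrichment F V := σ.ofHomTo φ₁ hφ₁
  let σ₂ : ModelEnrichment F V := σ₁.ofHomFrom ψ₁ hψ₁
  let σ₃ : ModelEnrichment F V := τ.ofHomTo φ₂ hφ₂
  have h₁ : DirectZigzag σ₁ σ := .rel _ _ ⟨φ₁, fun a b _ _ ↦ hφ₁ a b⟩
  have h₂ : DirectZigzag σ₁ σ₂ := .rel _ _ ⟨ψ₁, fun a b _ _ ↦ hψ₁ a b⟩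
  have h₃ : DirectZigzag σ₃ σ₂ := .rel _ _ ⟨ψ₂, fun a b _ _ ↦ hψ₂ a b⟩
  have h₄ : DirectZigzag σ₃ τ := .rel _ _ ⟨φ₂, fun a b _ _ ↦ hφ₂ a b⟩
  exact ((h₁.symm.trans _ _ _ h₂).trans _ _ _ h₃.symm).trans _ _ _ h₄

/-- A map of enrichments induces maps of endomorphism monoids. -/
def Enrichment.Hom.endMonMap {σ τ : Enrichment C V} (φ : Enrichment.Hom σ τ) (X : C) :
    σ.endMon X ⟶ τ.endMon X where
  hom := φ.ap X X
  isMonHom_hom :=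
    { one_hom := φ.unit_app X
      mul_hom := φ.comp_app X X X }

lemma DirectZigzag.weaklyEquivalentMonoids {σ τ : ModelEnrichment F V} (h : DirectZigzag σ τ)
    (X : C) (h₁ : IsCofibrant (F.obj X)) (h₂ : IsFibrant (F.obj X)) :
    WeaklyEquivalentMonoids (σ.endMon X) (τ.endMon X) := by
  induction h with
  | rel σ τ h =>
    obtain ⟨φ, hφ⟩ := h
    exact .rel _ _ ⟨φ.endMonMap X, hφ X X h₁ h₂⟩
  | refl _ => exact .refl _
  | symm _ _ _ ih => exact .symm _ _ ih
  | trans _ _ _ _ _ ih₁ ih₂ => exact .trans _ _ _ ih₁ ih₂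

/-- The restriction of a pointed bimodule along a functor. -/
def PointedBimodule.pullback {D : Type u₂} [Category.{v₂} D] {σ τ : Enrichment C V}
    (P : PointedBimodule σ τ) (G : D ⥤ C) : PointedBimodule (σ.pullback G) (τ.pullback G) where
  obj a b := P.obj (G.obj a) (G.obj b)
  lact a b c := P.lact (G.obj a) (G.obj b) (G.obj c)
  ract a b c := P.ract (G.obj a) (G.obj b) (G.obj c)
  lact_assoc a b c d := P.lact_assoc (G.obj a) (G.obj b) (G.obj c) (G.obj d)
  unit_lact a b := P.unit_lact (G.obj a) (G.obj b)
  ract_assoc a b c d := P.ract_assoc (G.obj a) (G.obj b) (G.obj c) (G.obj d)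
  ract_unit a b := P.ract_unit (G.obj a) (G.obj b)
  lact_ract a b c d := P.lact_ract (G.obj a) (G.obj b) (G.obj c) (G.obj d)
  pt c := P.pt (G.obj c)
  pt_natural f := P.pt_natural (G.map f)

lemma QuasiEquivalent.restrict {σ τ : ModelEnrichment (𝟭 M) V} (h : QuasiEquivalent σ τ)
    (I : ObjectProperty M) : QuasiEquivalent (σ.restrict I) (τ.restrict I) := by
  induction h with
  | rel σ τ h =>
    obtain ⟨P, hP⟩ := h
    exact .rel _ _ ⟨P.pullback I.ι, fun a b h₁ h₂ ↦ hP a.obj b.obj h₁ h₂⟩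
  | refl _ => exact .refl _
  | symm _ _ _ ih => exact .symm _ _ ih
  | trans _ _ _ _ _ ih₁ ih₂ => exact .trans _ _ _ ih₁ ih₂

end DirectZigzags

end ModelEnrich

theorem proposition3p2
    {V : Type u} [Category.{v} V] [MonoidalCategory V] [SymmetricCategory V] [MonoidalClosed V]
    [HasLimits V] [ModelCategory V] [ModelEnrich.IsMonoidalModelCategory V]
    (hcomb : ModelEnrich.IsCombinatorial V)
    (hmonoid : ModelEnrich.MonoidAxiom V)
    (hunit : IsCofibrant (𝟙_ V))
    {M : Type u₂} [Category.{v} M] [ModelCategory M]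
    (σ τ : ModelEnrich.ModelEnrichment (𝟭 M) V) :
    (∀ I : ObjectProperty M, ObjectProperty.Small.{v} I →
      (∀ X : M, I X → IsCofibrant X ∧ IsFibrant X) →
      ModelEnrich.QuasiEquivalent (σ.restrict I) (τ.restrict I) →
        ModelEnrich.DirectZigzag (σ.restrict I) (τ.restrict I) ∧
        ∀ X : M, I X → ModelEnrich.WeaklyEquivalentMonoids (σ.endMon X) (τ.endMon X)) ∧
    (ModelEnrich.QuasiEquivalent σ τ →
      ∀ X : M, IsCofibrant X → IsFibrant X →
        ModelEnrich.WeaklyEquivalentMonoids (σ.endMon X) (τ.endMon X)) := by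
  have key (I : ObjectProperty M) (hI : ObjectProperty.Small.{v} I)
      (h : ∀ X : M, I X → IsCofibrant X ∧ IsFibrant X)
      (hst : ModelEnrich.QuasiEquivalent (σ.restrict I) (τ.restrict I)) :
      ModelEnrich.DirectZigzag (σ.restrict I) (τ.restrict I) ∧
        ∀ X : M, I X → ModelEnrich.WeaklyEquivalentMonoids (σ.endMon X) (τ.endMon X) := by
    have : Small.{v} (Subtype I) := hI
    have : Small.{v} I.FullSubcategory :=
      small_of_injective (f := fun X : I.FullSubcategory ↦ (⟨X.obj, X.property⟩ : Subtype I))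
        fun X Y hXY ↦ ObjectProperty.FullSubcategory.ext (congrArg Subtype.val hXY)
    have hz := hst.directZigzag hcomb hmonoid fun X ↦ h X.obj X.property
    exact ⟨hz, fun X hX ↦ hz.weaklyEquivalentMonoids ⟨X, hX⟩ (h X hX).1 (h X hX).2⟩
  refine ⟨key, fun hst X h₁ h₂ ↦ ?_⟩
  -- M need not be small, so the quasi-equivalence is restricted to the full subcategory on X alone,
  -- which is all that the monoids at X see.
  refine (key (ObjectProperty.singleton X) inferInstance (fun Y hY ↦ ?_)
    (hst.restrict _)).2 X (by simp)
  obtain rfl : X = Y := by simpa using hY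
  exact ⟨h₁, h₂⟩
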